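/- Fix constants $K_4>0$, $\overline{\sigma}\ge\underline{\sigma}>0$ and $M>0$. For each $n$ let $\mathbf{P}_{n,0}$ be the set of all joint distributions $P_n$ of shocks $(u_{n,1},\dots,u_{n,n})$ that are independent and identically distributed with mean zero, fourth moment $E_n[u_{n,t}^4]<K_4$ and variance $\sigma_n^2\in[\underline{\sigma},\overline{\sigma}]$. For $\rho\in\mathbf{R}$ let $y_{n,0}=0$ and $y_{n,t}=\rho\, y_{n,t-1}+u_{n,t}$ for $1\le t\le n$. For a horizon $1\le h<n$ let $(\hat\beta_n(h),\hat\gamma_n(h))$ be the coefficients of the linear regression of $y_{n,t+h}$ on $x_{n,t}=(y_{n,t},y_{n,t-1})'$, $$\begin{pmatrix}\hat\beta_n(h)\\ \hat\gamma_n(h)\end{pmatrix}=\Big(\sum_{t=1}^{n-h}x_{n,t}x_{n,t}'\Big)^{-1}\sum_{t=1}^{n-h}x_{n,t}\,y_{n,t+h},$$ with residuals $\hat\xi_{n,t}(h)=y_{n,t+h}-\hat\beta_n(h)y_{n,t}-\hat\gamma_n(h)y_{n,t-1}$; let $$\hat\rho_n(h)=\Big(\sum_{t=1}^{n-h}y_{n,t-1}^2\Big)^{-1}\sum_{t=1}^{n-h}y_{n,t}y_{n,t-1},\qquad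 \hat u_{n,t}(h)=y_{n,t}-\hat\rho_n(h)y_{n,t-1},$$ $$\hat s_n(h)=\Big(\sum_{t=1}^{n-h}\hat u_{n,t}(h)^2\Big)^{-1/2}\Big(\sum_{t=1}^{n-h}\hat\xi_{n,t}(h)^2\hat u_{n,t}(h)^2\Big)^{1/2}\Big(\sum_{t=1}^{n-h}\hat u_{n,t}(h)^2\Big)^{-1/2},$$ and let $$R_n(h)=\frac{\hat\beta_n(h)-\rho^h}{\hat s_n(h)},\qquad J_n(x,h,P_n,\rho)=P_n\big(R_n(h)\le x\big),$$ where $R_n(h)$ is given any fixed value, say by reading each undefined inverse as $0$, where it is not defined. Let $\Phi$ be the standard normal distribution function. Then, for every sequence of natural numbers $h_n\le n$ with $h_n=o(n)$, $$\sup_{1\le h\le h_n}\ \sup_{P_n\in\mathbf{P}_{n,0}}\ \sup_{|\rho|\le 1+M/n}\ \sup_{x\in\mathbf{R}}\big|J_n(x,h,P_n,\rho)-\Phi(x)\big|\to0\quad\text{as } n\to\infty,$$ where a supremum over the empty set is $0$. -/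

import Mathlib

open MeasureTheory ProbabilityTheory Filter Topology Asymptotics
open scoped Matrix ENNReal

noncomputable section

namespace LocalProjection

/-- The AR(1) path `y 0 = 0`, `y t = ρ * y (t - 1) + u_t` for `1 ≤ t ≤ n`. The `n` shocks are indexed
from zero: the coordinate `⟨t, _⟩` of `u : Fin n → ℝ` is the shock of date `t + 1`. Values after
date `n` are never used below. -/
def path {n : ℕ} (ρ : ℝ) (u : Fin n → ℝ) : ℕ → ℝ
  | 0 => 0
  | t + 1 => ρ * path ρ u t + if ht : t < n then u ⟨t, ht⟩ else 0

/-- The impulse response coefficient at horizon `h`. -/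
def impulseResponse (ρ : ℝ) (h : ℕ) : ℝ := ρ ^ h

/-- The regressor `x_t = (y_t, y_{t-1})` (used for `t ≥ 1`). -/
def regressor (y : ℕ → ℝ) (t : ℕ) : Fin 2 → ℝ := ![y t, y (t - 1)]

/-- The coefficients `(β̂_n(h), γ̂_n(h))` of the linear regression of `y_{t+h}` on
`(y_t, y_{t-1})`, `t = 1, …, n - h`. -/
def lpCoef (n h : ℕ) (y : ℕ → ℝ) : Fin 2 → ℝ :=
  (∑ t ∈ Finset.Icc 1 (n - h), Matrix.vecMulVec (regressor y t) (regressor y t))⁻¹ *ᵥ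
    ∑ t ∈ Finset.Icc 1 (n - h), y (t + h) • regressor y t

/-- The lag-augmented local projection estimator `β̂_n(h)`. -/
def betaHat (n h : ℕ) (y : ℕ → ℝ) : ℝ := lpCoef n h y 0

/-- The coefficient `γ̂_n(h)` of the lag. -/
def gammaHat (n h : ℕ) (y : ℕ → ℝ) : ℝ := lpCoef n h y 1

/-- The residual `ξ̂_t(h)` of the local projection. -/
def xiHat (n h : ℕ) (y : ℕ → ℝ) (t : ℕ) : ℝ :=
  y (t + h) - betaHat n h y * y t - gammaHat n h y * y (t - 1)

/-- The least squares estimator `ρ̂_n(h)` of the autoregressive coefficient. -/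
def rhoHat (n h : ℕ) (y : ℕ → ℝ) : ℝ :=
  (∑ t ∈ Finset.Icc 1 (n - h), y (t - 1) ^ 2)⁻¹ * ∑ t ∈ Finset.Icc 1 (n - h), y t * y (t - 1)

/-- The residual `û_t(h)` of the autoregression. -/
def uHat (n h : ℕ) (y : ℕ → ℝ) (t : ℕ) : ℝ := y t - rhoHat n h y * y (t - 1)

/-- The heteroskedasticity-consistent standard error `ŝ_n(h)`. -/
def sHat (n h : ℕ) (y : ℕ → ℝ) : ℝ :=
  (√(∑ t ∈ Finset.Icc 1 (n - h), uHat n h y t ^ 2))⁻¹ *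
    √(∑ t ∈ Finset.Icc 1 (n - h), xiHat n h y t ^ 2 * uHat n h y t ^ 2) *
    (√(∑ t ∈ Finset.Icc 1 (n - h), uHat n h y t ^ 2))⁻¹

/-- The root `R_n(h) = (β̂_n(h) - ρ ^ h) / ŝ_n(h)`, as a function of the shocks. -/
def root (n h : ℕ) (ρ : ℝ) (u : Fin n → ℝ) : ℝ :=
  (betaHat n h (path ρ u) - impulseResponse ρ h) / sHat n h (path ρ u)

/-- The distribution function `J_n(x, h, P, ρ)` of the root, where `P` is the joint law of the
shocks of dates `1, …, n`. -/
def rootCDF (n h : ℕ) (P : Measure (Fin n → ℝ)) (ρ x : ℝ) : ℝ :=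
  P.real {u | root n h ρ u ≤ x}

/-- The standard normal distribution function. -/
def Phi (x : ℝ) : ℝ := cdf (gaussianReal 0 1) x

/-- `P` is the joint law of `n` i.i.d. shocks with mean zero, fourth moment less than `K₄` and
variance in `[σlo, σhi]`. -/
structure IsShockLaw (K₄ σlo σhi : ℝ) (n : ℕ) (P : Measure (Fin n → ℝ)) : Prop where
  isProbabilityMeasure : IsProbabilityMeasure P
  indep : iIndepFun (fun (t : Fin n) (u : Fin n → ℝ) => u t) P
  identDistrib : ∀ s t : Fin n, IdentDistrib (fun u : Fin n → ℝ => u s) (fun u => u t) P P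
  mean_zero : ∀ t, P[fun u : Fin n → ℝ => u t] = 0
  integrable_fourth : ∀ t, Integrable (fun u : Fin n → ℝ => u t ^ 4) P
  fourth_lt : ∀ t, P[fun u : Fin n → ℝ => u t ^ 4] < K₄
  variance_mem : ∀ t, variance (fun u : Fin n → ℝ => u t) P ∈ Set.Icc σlo σhi

/-- The class of all admissible laws of the shocks of the `n`-th row. -/
def shockLaws (K₄ σlo σhi : ℝ) (n : ℕ) : Set (Measure (Fin n → ℝ)) :=
  {P | IsShockLaw K₄ σlo σhi n P}

end LocalProjection

end

/-! Iterating the autoregression gives y_{t+h} = ρ^h y_t + ξ_t, where ξ_t combines only the shocks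
of dates t+1, …, t+h. By Frisch–Waugh–Lovell the root equals Σ ξ_t û_t / (Σ ξ̂_t² û_t²)^{1/2}
(`root_eq_of_pos`), where û_t is u_t with its projection on y_{t-1} removed. The extra lag thus
replaces the possibly very persistent regressor y_t by a quantity close to the shock u_t.

The infeasible score Σ ξ_t u_t is a martingale transform in reversed time: given all later shocks,
ξ_t is known while u_t is independent and centred (`Shocks.martArray`). Its conditional variance v Σ
ξ_t² concentrates, because ξ_t² is dependent over about h dates only and h/T is small, T = n - h. A
martingale central limit theorem with explicit error (`MartArray.norm_integral_exp_sub_gaussian_le`)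
controls its characteristic function, and the theorems of Lévy and Pólya turn this into a bound
uniform in x (`exists_abs_cdf_sub_Phi_le`).

Replacing (û, ξ̂) by (u, ξ) is harmless whenever a few sample moments have their natural order
(`GoodSample.ratio`), which happens with high probability (`Shocks.prob_not_goodSample_le`). The
delicate moment is the lower bound on Σ y_t²; it comes from the quasi-differences y_{t+k} - ρ^k y_t
with k a small fraction of T.

Uniformity in ρ holds because every moment is measured in units of `gain`, so stationary and
near-unit-root cases need no separation; the bound |ρ| ≤ 1 + M/n enters only through ρ^{2k} ≤ e^{2M}
for k ≤ n. All estimates are nonasymptotic, and one threshold on h/(n-h) serves all laws, all ρ and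
all x (`exists_abs_prob_root_le_sub_Phi_le`). -/

namespace LocalProjection

/-! ### Shocks, their geometric blocks, and moment bounds -/

section

variable {Ω : Type*}

/-- Independent centred shocks with common variance `v` and fourth moments at most `K`. -/
structure Shocks [MeasurableSpace Ω] (P : Measure Ω) (u : ℕ → Ω → ℝ) (v K : ℝ) : Prop where
  prob : IsProbabilityMeasure P
  meas : ∀ t, Measurable (u t)
  indep : iIndepFun u P
  integrable_fourth : ∀ t, Integrable (fun ω => u t ω ^ 4) P
  mean_zero : ∀ t, ∫ ω, u t ω ∂P = 0
  second : ∀ t, ∫ ω, u t ω ^ 2 ∂P = v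
  fourth_le : ∀ t, ∫ ω, u t ω ^ 4 ∂P ≤ K

/-- The σ-algebra generated by the shocks with dates in `S`. -/
@[reducible] def sigmaOn (u : ℕ → Ω → ℝ) (S : Set ℕ) : MeasurableSpace Ω :=
  ⨆ i ∈ S, MeasurableSpace.comap (u i) inferInstance

/-- The accumulated shocks `∑ j < k, ρ ^ (k - 1 - j) * u (i + j)`. -/
def blk (ρ : ℝ) (u : ℕ → Ω → ℝ) : ℕ → ℕ → Ω → ℝ
  | 0, _ => fun _ => 0
  | k + 1, i => fun ω => ρ * blk ρ u k i ω + u (i + k) ω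

/-- The sum `∑ j < k, ρ ^ (2 * j)`. -/
def gain (ρ : ℝ) : ℕ → ℝ
  | 0 => 0
  | k + 1 => ρ ^ 2 * gain ρ k + 1

lemma sigmaOn_mono (u : ℕ → Ω → ℝ) {S S' : Set ℕ} (h : S ⊆ S') : sigmaOn u S ≤ sigmaOn u S' :=
  biSup_mono h

lemma measurable_sigmaOn (u : ℕ → Ω → ℝ) {S : Set ℕ} {i : ℕ} (hi : i ∈ S) :
    Measurable[sigmaOn u S] (u i) :=
  (comap_measurable (u i)).mono (le_biSup (fun i => MeasurableSpace.comap (u i) _) hi) le_rfl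

lemma measurable_blk (ρ : ℝ) (u : ℕ → Ω → ℝ) (k i : ℕ) {S : Set ℕ}
    (hS : Set.Ico i (i + k) ⊆ S) : Measurable[sigmaOn u S] (blk ρ u k i) := by
  induction k with
  | zero => exact measurable_const
  | succ k ih =>
    have h1 := ih ((Set.Ico_subset_Ico_right (by omega)).trans hS)
    have h2 : Measurable[sigmaOn u S] (u (i + k)) :=
      measurable_sigmaOn u (hS ⟨by omega, by omega⟩)
    have h3 : Measurable[sigmaOn u S] fun ω => ρ * blk ρ u k i ω := h1.const_mul ρ
    exact h3.add h2

lemma gain_nonneg (ρ : ℝ) (k : ℕ) : 0 ≤ gain ρ k := by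
  induction k with
  | zero => exact le_rfl
  | succ k ih => simp only [gain]; positivity

lemma one_le_gain (ρ : ℝ) {k : ℕ} (hk : 1 ≤ k) : 1 ≤ gain ρ k := by
  obtain ⟨k, rfl⟩ := Nat.exists_eq_add_of_le' hk
  have := gain_nonneg ρ k
  simp only [gain]; nlinarith [mul_nonneg (sq_nonneg ρ) this]

lemma gain_add (ρ : ℝ) (j k : ℕ) : gain ρ (j + k) = (ρ ^ k) ^ 2 * gain ρ j + gain ρ k := by
  induction k with
  | zero => simp [gain]
  | succ k ih => rw [← add_assoc]; simp only [gain, ih]; ring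

lemma gain_mono (ρ : ℝ) : Monotone (gain ρ) := by
  intro a b h
  obtain ⟨c, rfl⟩ := Nat.exists_eq_add_of_le' h
  rw [gain_add]
  have := gain_nonneg ρ c
  nlinarith [mul_nonneg (sq_nonneg (ρ ^ a)) this]

/-- With `i = 0` this is both the projection identity y_{t+h} = ρ^h y_t + ξ_t and the formula for
the quasi-differences that bound Σ y_t² from below. -/
lemma blk_add (ρ : ℝ) (u : ℕ → Ω → ℝ) (j k i : ℕ) (ω : Ω) :
    blk ρ u (j + k) i ω = ρ ^ k * blk ρ u j i ω + blk ρ u k (i + j) ω := by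
  induction k with
  | zero => simp [blk]
  | succ k ih => rw [← add_assoc]; simp only [blk, ih]; rw [← add_assoc]; ring

end

variable {Ω : Type*} [mΩ : MeasurableSpace Ω]

lemma integrable_pow_of_fourth {P : Measure Ω} [IsProbabilityMeasure P] {X : Ω → ℝ}
    (hX : Measurable X) (h4 : Integrable (fun ω => X ω ^ 4) P) {p : ℕ} (hp : p ≤ 4) :
    Integrable (fun ω => X ω ^ p) P := by
  refine ((integrable_const (1 : ℝ)).add h4).mono' (hX.pow_const p).aestronglyMeasurable
    (ae_of_all _ fun ω => ?_)
  simp only [Real.norm_eq_abs, abs_pow, Pi.add_apply]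
  rcases le_total |X ω| 1 with h | h
  · have := pow_le_one₀ (n := p) (abs_nonneg _) h
    nlinarith [sq_nonneg (X ω ^ 2)]
  · have := pow_le_pow_right₀ h hp
    have h4 : |X ω| ^ 4 = X ω ^ 4 := by rw [← abs_pow, abs_of_nonneg (by positivity)]
    linarith

namespace Shocks

variable {P : Measure Ω} {u : ℕ → Ω → ℝ} {v K : ℝ} (hu : Shocks P u v K)
include hu

lemma sigmaOn_le (S : Set ℕ) : sigmaOn u S ≤ mΩ :=
  iSup₂_le fun i _ => (hu.meas i).comap_le

lemma measurable_blk' (ρ : ℝ) (k i : ℕ) : Measurable (blk ρ u k i) :=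
  (measurable_blk ρ u k i subset_rfl).mono (hu.sigmaOn_le _) le_rfl

lemma indepFun_of_disjoint {S S' : Set ℕ} (hd : Disjoint S S') {X Y : Ω → ℝ}
    (hX : Measurable[sigmaOn u S] X) (hY : Measurable[sigmaOn u S'] Y) : IndepFun X Y P :=
  indep_of_indep_of_le_left
    (indep_of_indep_of_le_right
      (indep_iSup_of_disjoint (fun i => (hu.meas i).comap_le) hu.indep hd) hY.comap_le) hX.comap_le

lemma integral_mul_of_disjoint {S S' : Set ℕ} (hd : Disjoint S S') {X Y : Ω → ℝ}
    (hX : Measurable[sigmaOn u S] X) (hY : Measurable[sigmaOn u S'] Y) :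
    ∫ ω, X ω * Y ω ∂P = (∫ ω, X ω ∂P) * ∫ ω, Y ω ∂P :=
  (hu.indepFun_of_disjoint hd hX hY).integral_fun_mul_eq_mul_integral
    (hX.mono (hu.sigmaOn_le S) le_rfl).aestronglyMeasurable
    (hY.mono (hu.sigmaOn_le S') le_rfl).aestronglyMeasurable

lemma integrable_mul_of_disjoint {S S' : Set ℕ} (hd : Disjoint S S') {X Y : Ω → ℝ}
    (hX : Measurable[sigmaOn u S] X) (hY : Measurable[sigmaOn u S'] Y)
    (hXi : Integrable X P) (hYi : Integrable Y P) : Integrable (fun ω => X ω * Y ω) P :=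
  (hu.indepFun_of_disjoint hd hX hY).integrable_mul hXi hYi

lemma integrable_pow (t : ℕ) {p : ℕ} (hp : p ≤ 4) : Integrable (fun ω => u t ω ^ p) P :=
  have := hu.prob
  integrable_pow_of_fourth (hu.meas t) (hu.integrable_fourth t) hp

/-- The variance of a squared shock is nonnegative. Later bounds absorb v² into K this way. -/
lemma var_sq_le : v ^ 2 ≤ K := by
  have := hu.prob
  have h1 := hu.integrable_pow 0 (p := 2) (by norm_num)
  have h : 0 ≤ ∫ ω, (u 0 ω ^ 2 - v) ^ 2 ∂P := integral_nonneg fun ω => sq_nonneg _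
  have h2 : ∫ ω, (u 0 ω ^ 2 - v) ^ 2 ∂P = ∫ ω, (u 0 ω ^ 4 - 2 * v * u 0 ω ^ 2 + v ^ 2) ∂P := by
    congr 1; ext ω; ring
  have i1 : Integrable (fun ω => u 0 ω ^ 4 - 2 * v * u 0 ω ^ 2) P :=
    (hu.integrable_fourth 0).sub (h1.const_mul _)
  rw [h2, integral_add i1 (integrable_const _),
    integral_sub (hu.integrable_fourth 0) (h1.const_mul _), integral_const_mul, hu.second] at h
  simp at h
  nlinarith [hu.fourth_le 0]

/-- Odd cross terms vanish, so the new fourth moment is at most 3K c⁴b² + 6c²v²b + K. With v² ≤ K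
this is below 3K(c²b + 1)², so the constant 3 reproduces itself and never grows with the number of
shocks. -/
lemma moments_add_shock {S : Set ℕ} {t : ℕ} (ht : t ∉ S) {B : Ω → ℝ} {b : ℝ} (c : ℝ)
    (hB : Measurable[sigmaOn u S] B) (hB4 : Integrable (fun ω => B ω ^ 4) P)
    (h1 : ∫ ω, B ω ∂P = 0) (h2 : ∫ ω, B ω ^ 2 ∂P = v * b) (h4 : ∫ ω, B ω ^ 4 ∂P ≤ 3 * K * b ^ 2)
    (hb : 0 ≤ b) :
    Integrable (fun ω => (c * B ω + u t ω) ^ 4) P ∧ ∫ ω, (c * B ω + u t ω) ∂P = 0 ∧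
      ∫ ω, (c * B ω + u t ω) ^ 2 ∂P = v * (c ^ 2 * b + 1) ∧
      ∫ ω, (c * B ω + u t ω) ^ 4 ∂P ≤ 3 * K * (c ^ 2 * b + 1) ^ 2 := by
  have := hu.prob
  have hd : Disjoint S {t} := Set.disjoint_singleton_right.2 ht
  have hm : ∀ p : ℕ, Measurable[sigmaOn u S] fun ω => B ω ^ p := fun p =>
    @Measurable.pow_const _ _ _ _ _ _ _ (sigmaOn u S) _ hB p
  have hm' : ∀ p : ℕ, Measurable[sigmaOn u {t}] fun ω => u t ω ^ p := fun p =>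
    @Measurable.pow_const _ _ _ _ _ _ _ (sigmaOn u {t}) _ (measurable_sigmaOn u rfl) p
  have hBi : ∀ {p : ℕ}, p ≤ 4 → Integrable (fun ω => B ω ^ p) P := fun hp =>
    integrable_pow_of_fourth (hB.mono (hu.sigmaOn_le S) le_rfl) hB4 hp
  have I : ∀ p q : ℕ, p ≤ 4 → q ≤ 4 → Integrable (fun ω => B ω ^ p * u t ω ^ q) P :=
    fun p q hp hq => hu.integrable_mul_of_disjoint hd (hm p) (hm' q) (hBi hp) (hu.integrable_pow t hq)
  have E : ∀ p q : ℕ, ∫ ω, B ω ^ p * u t ω ^ q ∂P = (∫ ω, B ω ^ p ∂P) * ∫ ω, u t ω ^ q ∂P :=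
    fun p q => hu.integral_mul_of_disjoint hd (hm p) (hm' q)
  have e1 := E 1 1
  have e2 := E 2 2
  have e31 := E 3 1
  have e13 := E 1 3
  simp only [pow_one, hu.mean_zero, h1, h2, hu.second, mul_zero, zero_mul] at e1 e2 e31 e13
  have hB1 : Integrable B P := by simpa using hBi (p := 1) (by norm_num)
  have hu1 : Integrable (u t) P := by simpa using hu.integrable_pow t (p := 1) (by norm_num)
  have q2 : (fun ω => (c * B ω + u t ω) ^ 2) =
      fun ω => c ^ 2 * B ω ^ 2 + 2 * c * (B ω * u t ω) + u t ω ^ 2 := by ext ω; ring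
  have q4 : (fun ω => (c * B ω + u t ω) ^ 4) =
      fun ω => c ^ 4 * B ω ^ 4 + 4 * c ^ 3 * (B ω ^ 3 * u t ω) + 6 * c ^ 2 * (B ω ^ 2 * u t ω ^ 2)
        + 4 * c * (B ω * u t ω ^ 3) + u t ω ^ 4 := by ext ω; ring
  have i11 : Integrable (fun ω => B ω * u t ω) P := by
    simpa using I 1 1 (by norm_num) (by norm_num)
  have i31 : Integrable (fun ω => B ω ^ 3 * u t ω) P := by
    simpa using I 3 1 (by norm_num) (by norm_num)
  have i13 : Integrable (fun ω => B ω * u t ω ^ 3) P := by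
    simpa using I 1 3 (by norm_num) (by norm_num)
  have i22 := I 2 2 (by norm_num) (by norm_num)
  have iB2 := hBi (p := 2) (by norm_num)
  have iu2 := hu.integrable_pow t (p := 2) (by norm_num)
  have iu4 := hu.integrable_fourth t
  have j1 : Integrable (fun ω => c ^ 4 * B ω ^ 4 + 4 * c ^ 3 * (B ω ^ 3 * u t ω)) P :=
    (hB4.const_mul _).add (i31.const_mul _)
  have j2 := j1.add (i22.const_mul (6 * c ^ 2))
  have j3 := j2.add (i13.const_mul (4 * c))
  simp only [Pi.add_def] at j2 j3
  refine ⟨?_, ?_, ?_, ?_⟩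
  · rw [q4]; exact j3.add iu4
  · rw [integral_add (hB1.const_mul _) hu1, integral_const_mul, h1, hu.mean_zero]; simp
  · have j0 : Integrable (fun ω => c ^ 2 * B ω ^ 2 + 2 * c * (B ω * u t ω)) P :=
      (iB2.const_mul _).add (i11.const_mul _)
    rw [q2, integral_add j0 iu2,
      integral_add (iB2.const_mul _) (i11.const_mul _), integral_const_mul, integral_const_mul,
      h2, e1, hu.second]
    ring
  · rw [q4, integral_add j3 iu4, integral_add j2 (i13.const_mul _),
      integral_add j1 (i22.const_mul _), integral_add (hB4.const_mul _) (i31.const_mul _)]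
    simp only [integral_const_mul, e2, e31, e13]
    have hc : 0 ≤ c ^ 2 * b := by positivity
    have := mul_le_mul_of_nonneg_left h4 (by positivity : 0 ≤ c ^ 4)
    have h5 := mul_le_mul_of_nonneg_left hu.var_sq_le hc
    have := hu.fourth_le t
    have hK : 0 ≤ K := (sq_nonneg v).trans hu.var_sq_le
    nlinarith

/-- The fourth moment is comparable to the square of `gain`, with a constant free of ρ and k. This
scale-free bound is the source of uniformity in ρ and h. -/
lemma blk_moments (ρ : ℝ) (k i : ℕ) :
    Integrable (fun ω => blk ρ u k i ω ^ 4) P ∧ ∫ ω, blk ρ u k i ω ∂P = 0 ∧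
      ∫ ω, blk ρ u k i ω ^ 2 ∂P = v * gain ρ k ∧
      ∫ ω, blk ρ u k i ω ^ 4 ∂P ≤ 3 * K * gain ρ k ^ 2 := by
  induction k with
  | zero => simp [blk, gain]
  | succ k ih =>
    exact hu.moments_add_shock (S := Set.Ico i (i + k)) (by simp) ρ
      (measurable_blk ρ u k i subset_rfl) ih.1 ih.2.1 ih.2.2.1 ih.2.2.2 (gain_nonneg ρ k)

lemma integrable_blk_pow (ρ : ℝ) (k i : ℕ) {p : ℕ} (hp : p ≤ 4) :
    Integrable (fun ω => blk ρ u k i ω ^ p) P :=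
  have := hu.prob
  integrable_pow_of_fourth (hu.measurable_blk' ρ k i) (hu.blk_moments ρ k i).1 hp

/-- Second moment bound for sums of a sequence that is dependent over at most `h` dates. -/
lemma integral_sq_sum_sub_le {Z : ℕ → Ω → ℝ} {h : ℕ} {m B : ℝ}
    (hZ : ∀ i, Measurable[sigmaOn u (Set.Ico i (i + h + 1))] (Z i))
    (hZ2 : ∀ i, Integrable (fun ω => Z i ω ^ 2) P) (hm : ∀ i, ∫ ω, Z i ω ∂P = m)
    (hB : ∀ i, ∫ ω, Z i ω ^ 2 ∂P ≤ B) (T : ℕ) :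
    Integrable (fun ω => (∑ i ∈ Finset.range T, Z i ω - T * m) ^ 2) P ∧
      ∫ ω, (∑ i ∈ Finset.range T, Z i ω - T * m) ^ 2 ∂P ≤ T * (2 * h + 1) * B := by
  have := hu.prob
  have hZm : ∀ i, Measurable (Z i) := fun i => (hZ i).mono (hu.sigmaOn_le _) le_rfl
  have hZi : ∀ i, Integrable (Z i) P := fun i =>
    ((memLp_two_iff_integrable_sq (hZm i).aestronglyMeasurable).2 (hZ2 i)).integrable (by norm_num)
  set W : ℕ → Ω → ℝ := fun i ω => Z i ω - m with hW
  have hW2 : ∀ i, MemLp (W i) 2 P := fun i =>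
    ((memLp_two_iff_integrable_sq (hZm i).aestronglyMeasurable).2 (hZ2 i)).sub (memLp_const m)
  have hWW : ∀ i j, Integrable (fun ω => W i ω * W j ω) P := fun i j =>
    (hW2 i).integrable_mul (hW2 j)
  have hWm : ∀ i, ∫ ω, W i ω ∂P = 0 := fun i => by
    simp [hW, integral_sub (hZi i) (integrable_const m), hm]
  have hWB : ∀ i, ∫ ω, W i ω * W i ω ∂P ≤ B := fun i => by
    have : (fun ω => W i ω * W i ω) = fun ω => Z i ω ^ 2 - 2 * m * Z i ω + m ^ 2 := by
      ext ω; simp only [hW]; ring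
    have j0 : Integrable (fun ω => Z i ω ^ 2 - 2 * m * Z i ω) P :=
      (hZ2 i).sub ((hZi i).const_mul _)
    rw [this, integral_add j0 (integrable_const _),
      integral_sub (hZ2 i) ((hZi i).const_mul _), integral_const_mul, hm]
    simp
    nlinarith [hB i, sq_nonneg m]
  have hB0 : 0 ≤ B := (integral_nonneg fun ω => sq_nonneg (Z 0 ω)).trans (hB 0)
  have hWs : ∀ i, Measurable[sigmaOn u (Set.Ico i (i + h + 1))] (W i) := fun i =>
    (hZ i).sub_const m
  have hzero : ∀ i j, i + h < j → ∫ ω, W i ω * W j ω ∂P = 0 := fun i j hij => by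
    rw [hu.integral_mul_of_disjoint (S := Set.Ico i (i + h + 1)) (S' := Set.Ico j (j + h + 1)) _
      (hWs i) (hWs j), hWm, zero_mul]
    rw [Set.disjoint_left]
    rintro x ⟨_, hx⟩ ⟨hx', _⟩
    omega
  -- Nearby dates contribute at most B by 2ab ≤ a² + b²; dates more than h apart are independent.
  -- Truncated subtraction in `i - h` only shortens the interval, so each i has at most 2h + 1
  -- neighbours.
  have hle : ∀ i j, ∫ ω, W i ω * W j ω ∂P ≤ if j ∈ Finset.Icc (i - h) (i + h) then B else 0 := by
    intro i j
    split_ifs with hij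
    · have : ∫ ω, W i ω * W j ω ∂P ≤ ∫ ω, (1 / 2 * (W i ω * W i ω) + 1 / 2 * (W j ω * W j ω)) ∂P :=
        integral_mono (hWW i j) (((hWW i i).const_mul _).add ((hWW j j).const_mul _)) fun ω => by
          have := sq_nonneg (W i ω - W j ω)
          simp only []
          nlinarith
      rw [integral_add ((hWW i i).const_mul _) ((hWW j j).const_mul _), integral_const_mul,
        integral_const_mul] at this
      linarith [hWB i, hWB j]
    · rw [Finset.mem_Icc] at hij
      rcases Nat.lt_or_ge (i + h) j with h1 | h1
      · exact (hzero i j h1).le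
      · have h2 : j + h < i := by omega
        rw [← hzero j i h2]
        exact (integral_congr_ae (ae_of_all _ fun ω => mul_comm _ _)).le
  have hsq : (fun ω => (∑ i ∈ Finset.range T, Z i ω - T * m) ^ 2) =
      fun ω => ∑ i ∈ Finset.range T, ∑ j ∈ Finset.range T, W i ω * W j ω := by
    ext ω
    rw [← Finset.sum_mul_sum, ← sq]
    simp [hW, Finset.sum_sub_distrib]
  rw [hsq]
  refine ⟨integrable_finsetSum _ fun i _ => integrable_finsetSum _ fun j _ => hWW i j, ?_⟩
  rw [integral_finsetSum _ fun i _ => integrable_finsetSum _ fun j _ => hWW i j]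
  have : ∀ i ∈ Finset.range T,
      ∫ ω, ∑ j ∈ Finset.range T, W i ω * W j ω ∂P ≤ (2 * h + 1) * B := fun i _ => by
    rw [integral_finsetSum _ fun j _ => hWW i j]
    refine (Finset.sum_le_sum fun j _ => hle i j).trans ?_
    rw [← Finset.sum_filter, Finset.sum_const, nsmul_eq_mul]
    refine mul_le_mul_of_nonneg_right ?_ hB0
    have h1 : (Finset.filter (· ∈ Finset.Icc (i - h) (i + h)) (Finset.range T)).card ≤
        (Finset.Icc (i - h) (i + h)).card :=
      Finset.card_le_card fun x hx => (Finset.mem_filter.1 hx).2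
    rw [Nat.card_Icc] at h1
    have h2 : (Finset.filter (· ∈ Finset.Icc (i - h) (i + h)) (Finset.range T)).card ≤ 2 * h + 1 :=
      h1.trans (by omega)
    exact_mod_cast h2
  refine (Finset.sum_le_sum this).trans ?_
  simp only [Finset.sum_const, Finset.card_range, nsmul_eq_mul]
  linarith

end Shocks

lemma prob_lt_le {P : Measure Ω} [IsProbabilityMeasure P] {f : Ω → ℝ} (hf : ∀ ω, 0 ≤ f ω)
    (hi : Integrable f P) {c a : ℝ} (hc : ∫ ω, f ω ∂P ≤ c * a) (ha : 0 < a) :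
    P.real {ω | a < f ω} ≤ c := by
  have h := mul_meas_ge_le_integral_of_nonneg (ae_of_all _ hf) hi a
  have h2 : P.real {ω | a < f ω} ≤ P.real {ω | a ≤ f ω} :=
    measureReal_mono fun ω (hω : a < f ω) => hω.le
  have h3 : a * P.real {ω | a ≤ f ω} ≤ a * c := by linarith
  exact h2.trans (le_of_mul_le_mul_left h3 ha)

end LocalProjection

/-! ### A martingale central limit theorem with explicit error -/

namespace LocalProjection

open Complex in
-- The cubic Taylor remainder is split by 2|x|³ ≤ ηx² + x⁴/η. Only even powers remain, whose moments
-- factor by independence, and η is left free for balancing.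
lemma norm_exp_mul_I_sub_taylor_le (x : ℝ) {η : ℝ} (hη : 0 < η) :
    ‖cexp (x * I) - 1 - x * I + x ^ 2 / 2‖ ≤ 2 * (η * x ^ 2 + x ^ 4 / η) := by
  have h1 : ‖cexp (x * I) - 1 - x * I + x ^ 2 / 2‖ ≤ 4 * |x| ^ 3 := by
    rcases le_or_gt |x| 1 with hx | hx
    · have hn : ‖(x : ℂ) * I‖ = |x| := by simp
      have := Complex.exp_bound (x := x * I) (by rw [hn]; exact hx) (n := 3) (by norm_num)
      rw [hn] at this
      simp only [Finset.sum_range_succ, Finset.sum_range_zero] at this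
      have e : cexp (x * I) - 1 - x * I + x ^ 2 / 2 = cexp (x * I) - (0 + (x * I) ^ 0 / (Nat.factorial 0 : ℕ)
          + (x * I) ^ 1 / (Nat.factorial 1 : ℕ) + (x * I) ^ 2 / (Nat.factorial 2 : ℕ)) := by
        simp only [mul_pow, I_sq, Nat.factorial]; push_cast; ring
      rw [e]
      refine this.trans ?_
      have : (0 : ℝ) ≤ |x| ^ 3 := by positivity
      norm_num [Nat.factorial]
      linarith
    · have h2 : ‖cexp (x * I) - 1 - x * I + x ^ 2 / 2‖ ≤ 1 + 1 + |x| + |x| ^ 2 / 2 := by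
        refine (norm_add_le _ _).trans (add_le_add ((norm_sub_le _ _).trans (add_le_add
          ((norm_sub_le _ _).trans (add_le_add ?_ ?_)) ?_)) ?_)
        · rw [Complex.norm_exp_ofReal_mul_I]
        · simp
        · simp
        · simp
      have h3 : |x| ≤ |x| ^ 3 := le_self_pow₀ hx.le (by norm_num)
      have h4 : |x| ^ 2 ≤ |x| ^ 3 := pow_le_pow_right₀ hx.le (by norm_num)
      linarith
  refine h1.trans ?_
  have h2 : x ^ 4 / η = η * (x ^ 2 / η) ^ 2 := by field_simp
  have h3 : |x| ^ 3 = η * (|x| * (x ^ 2 / η)) := by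
    rw [← sq_abs x]; field_simp
  rw [h2, h3, ← sq_abs x]
  nlinarith [mul_nonneg hη.le (sq_nonneg (|x| - |x| ^ 2 / η))]

lemma abs_exp_neg_sub_taylor_le {y : ℝ} (hy : 0 ≤ y) : |Real.exp (-y) - 1 + y| ≤ y ^ 2 := by
  rcases le_or_gt y 1 with h | h
  · have := Real.norm_exp_sub_one_sub_id_le (x := -y) (by rw [norm_neg, Real.norm_of_nonneg hy]; exact h)
    simpa [Real.norm_eq_abs, sub_neg_eq_add] using this
  · have h1 := Real.add_one_le_exp (-y)
    have h2 : Real.exp (-y) ≤ 1 := Real.exp_le_one_iff.2 (by linarith)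
    rw [abs_of_nonneg (by linarith)]
    nlinarith

lemma abs_exp_sub_one_le (x : ℝ) : |Real.exp x - 1| ≤ |x| * Real.exp |x| := by
  have := Complex.norm_exp_sub_sum_le_norm_mul_exp (x : ℂ) 1
  simp at this
  rw [← Real.norm_eq_abs, ← Complex.norm_real]
  push_cast
  exact this

variable {Ω : Type*} {𝓖 : MeasurableSpace Ω} [mΩ : MeasurableSpace Ω]

/-- A martingale difference array `c m * X m` with predictable coefficients `c m`. -/
structure MartArray (P : Measure Ω) (𝓖 : ℕ → MeasurableSpace Ω) (c X : ℕ → Ω → ℝ) (v K : ℝ)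
    (N : ℕ) : Prop where
  prob : IsProbabilityMeasure P
  mono : Monotone 𝓖
  le : ∀ m, 𝓖 m ≤ mΩ
  meas_coef : ∀ m < N, Measurable[𝓖 m] (c m)
  meas_shock : ∀ m < N, Measurable[𝓖 (m + 1)] (X m)
  indep : ∀ m < N, Indep (𝓖 m) (MeasurableSpace.comap (X m) inferInstance) P
  integrable_fourth : ∀ m < N, Integrable (fun ω => X m ω ^ 4) P
  mean_zero : ∀ m < N, ∫ ω, X m ω ∂P = 0
  second : ∀ m < N, ∫ ω, X m ω ^ 2 ∂P = v
  fourth_le : ∀ m < N, ∫ ω, X m ω ^ 4 ∂P ≤ K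
  coef_fourth : ∀ m < N, Integrable (fun ω => c m ω ^ 4) P

/-- Given 𝓖, the conditional characteristic function of cX and the Gaussian factor agree up to
second order, so only the remainders `r1` and `r2` survive. The bounded weight W carries the rest of
the product in the telescoping argument. -/
lemma norm_integral_char_step_le {P : Measure Ω} [IsProbabilityMeasure P]
    (h𝓖 : 𝓖 ≤ mΩ) {W : Ω → ℂ} {c X : Ω → ℝ} {v K w b η : ℝ} (hη : 0 < η) (hv : 0 ≤ v)
    (hW : Measurable[𝓖] W) (hc : Measurable[𝓖] c) (hX : Measurable X)
    (hind : Indep 𝓖 (MeasurableSpace.comap X inferInstance) P) (hWb : ∀ ω, ‖W ω‖ ≤ w)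
    (hcb : ∀ ω, |c ω| ≤ b) (hX4 : Integrable (fun ω => X ω ^ 4) P) (h1 : ∫ ω, X ω ∂P = 0)
    (h2 : ∫ ω, X ω ^ 2 ∂P = v) (h4 : ∫ ω, X ω ^ 4 ∂P ≤ K) :
    ‖∫ ω, W ω * (Complex.exp ((c ω * X ω : ℝ) * Complex.I) - Real.exp (-(v * c ω ^ 2 / 2))) ∂P‖ ≤
      w * (2 * η * (v * ∫ ω, c ω ^ 2 ∂P) + (2 * K / η + v ^ 2) * ∫ ω, c ω ^ 4 ∂P) := by
  have hWm : Measurable W := hW.mono h𝓖 le_rfl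
  have hcm : Measurable c := hc.mono h𝓖 le_rfl
  have ind : ∀ {Y : Ω → ℂ} {Z : ℝ → ℂ}, Measurable[𝓖] Y → Measurable Z →
      ∫ ω, Y ω * Z (X ω) ∂P = (∫ ω, Y ω ∂P) * ∫ ω, Z (X ω) ∂P := fun {Y Z} hY hZ => by
    have : IndepFun Y (fun ω => Z (X ω)) P :=
      indep_of_indep_of_le_left (indep_of_indep_of_le_right hind
        ((hZ.comp (comap_measurable X)).comap_le)) hY.comap_le
    exact this.integral_fun_mul_eq_mul_integral (hY.mono h𝓖 le_rfl).aestronglyMeasurable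
      (hZ.comp hX).aestronglyMeasurable
  have indR : ∀ p : ℕ, ∫ ω, c ω ^ p * X ω ^ p ∂P = (∫ ω, c ω ^ p ∂P) * ∫ ω, X ω ^ p ∂P := fun p => by
    have : IndepFun (fun ω => c ω ^ p) (fun ω => X ω ^ p) P :=
      indep_of_indep_of_le_left (indep_of_indep_of_le_right hind
        (((measurable_id.pow_const p).comp (comap_measurable X)).comap_le)) (hc.pow_const p).comap_le
    exact this.integral_fun_mul_eq_mul_integral (hcm.pow_const p).aestronglyMeasurable
      (hX.pow_const p).aestronglyMeasurable
  have hXp : ∀ {p : ℕ}, p ≤ 4 → Integrable (fun ω => X ω ^ p) P := fun hp =>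
    integrable_pow_of_fourth hX hX4 hp
  have hcp : ∀ p : ℕ, Integrable (fun ω => c ω ^ p) P := fun p =>
    Integrable.of_bound (hcm.pow_const p).aestronglyMeasurable (b ^ p) (ae_of_all _ fun ω => by
      rw [norm_pow]; exact pow_le_pow_left₀ (norm_nonneg _) (hcb ω) p)
  have hw : 0 ≤ w := by
    obtain ⟨ω⟩ := nonempty_of_isProbabilityMeasure P
    exact (norm_nonneg _).trans (hWb ω)
  have hcX : ∀ {p : ℕ}, p ≤ 4 → Integrable (fun ω => c ω ^ p * X ω ^ p) P := fun {p} hp =>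
    (hXp hp).bdd_mul (c := b ^ p) (hcm.pow_const p).aestronglyMeasurable (ae_of_all _ fun ω => by
      rw [norm_pow]; exact pow_le_pow_left₀ (norm_nonneg _) (hcb ω) p)
  set r1 : Ω → ℂ := fun ω => Complex.exp ((c ω * X ω : ℝ) * Complex.I) - 1 -
    (c ω * X ω : ℝ) * Complex.I + (c ω * X ω : ℝ) ^ 2 / 2 with hr1
  set r2 : Ω → ℝ := fun ω => Real.exp (-(v * c ω ^ 2 / 2)) - 1 + v * c ω ^ 2 / 2 with hr2
  have hr1m : Measurable r1 := by fun_prop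
  have hr2m : Measurable r2 := by fun_prop
  have hr1b : ∀ ω, ‖r1 ω‖ ≤ 2 * (η * (c ω ^ 2 * X ω ^ 2) + c ω ^ 4 * X ω ^ 4 / η) := fun ω => by
    have := norm_exp_mul_I_sub_taylor_le (c ω * X ω) hη
    rwa [mul_pow, mul_pow] at this
  have hr2b : ∀ ω, |r2 ω| ≤ v ^ 2 * c ω ^ 4 := fun ω => by
    have := abs_exp_neg_sub_taylor_le (y := v * c ω ^ 2 / 2) (by positivity)
    refine this.trans ?_
    have : 0 ≤ v ^ 2 * c ω ^ 4 := by positivity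
    nlinarith
  set g : Ω → ℝ := fun ω => 2 * (η * (c ω ^ 2 * X ω ^ 2) + c ω ^ 4 * X ω ^ 4 / η) + v ^ 2 * c ω ^ 4
    with hg
  have i2 : Integrable (fun ω => η * (c ω ^ 2 * X ω ^ 2)) P := (hcX (by norm_num)).const_mul η
  have i4 : Integrable (fun ω => c ω ^ 4 * X ω ^ 4 / η) P := (hcX le_rfl).div_const η
  have i24 : Integrable (fun ω => 2 * (η * (c ω ^ 2 * X ω ^ 2) + c ω ^ 4 * X ω ^ 4 / η)) P :=
    (i2.add i4).const_mul 2
  have ic4 : Integrable (fun ω => v ^ 2 * c ω ^ 4) P := (hcp 4).const_mul _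
  have hgi : Integrable g P := i24.add ic4
  have hrem : Integrable (fun ω => W ω * (r1 ω - r2 ω)) P := by
    refine (hgi.const_mul w).mono' (hWm.mul (hr1m.sub (by fun_prop))).aestronglyMeasurable
      (ae_of_all _ fun ω => ?_)
    rw [norm_mul]
    refine mul_le_mul (hWb ω) ((norm_sub_le _ _).trans (add_le_add (hr1b ω) ?_)) (norm_nonneg _) hw
    rw [Complex.norm_real]; exact hr2b ω
  have hWc : ∀ ω, ‖W ω * c ω‖ ≤ w * b := fun ω => by
    rw [norm_mul, Complex.norm_real]
    exact mul_le_mul (hWb ω) (hcb ω) (norm_nonneg _) hw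
  have hWc2 : ∀ ω, ‖W ω * c ω ^ 2‖ ≤ w * b ^ 2 := fun ω => by
    rw [norm_mul, norm_pow, Complex.norm_real]
    exact mul_le_mul (hWb ω) (pow_le_pow_left₀ (norm_nonneg _) (hcb ω) 2) (by positivity) hw
  have hl1 : Integrable (fun ω => (W ω * c ω) * (X ω : ℂ)) P := by
    refine Integrable.bdd_mul (c := w * b) ?_ (hWm.mul (by fun_prop)).aestronglyMeasurable
      (ae_of_all _ hWc)
    have := hXp (p := 1) (by norm_num)
    simp only [pow_one] at this
    exact this.ofReal
  have hl2 : Integrable (fun ω => (W ω * c ω ^ 2) * ((X ω ^ 2 - v : ℝ) : ℂ)) P := by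
    refine Integrable.bdd_mul (c := w * b ^ 2) ?_ (hWm.mul (by fun_prop)).aestronglyMeasurable
      (ae_of_all _ hWc2)
    exact ((hXp (p := 2) (by norm_num)).sub (integrable_const v)).ofReal
  have hc' : Measurable[𝓖] fun ω => (c ω : ℂ) := Complex.measurable_ofReal.comp hc
  have e1 : ∫ ω, (W ω * c ω) * (X ω : ℂ) ∂P = 0 := by
    rw [ind (Y := fun ω => W ω * c ω) (Z := fun x => (x : ℂ)) (hW.mul hc')
      Complex.measurable_ofReal, integral_complex_ofReal, h1]
    simp
  have e2 : ∫ ω, (W ω * c ω ^ 2) * ((X ω ^ 2 - v : ℝ) : ℂ) ∂P = 0 := by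
    rw [ind (Y := fun ω => W ω * c ω ^ 2) (Z := fun x => ((x ^ 2 - v : ℝ) : ℂ))
      (hW.mul (hc'.pow_const 2)) (by fun_prop), integral_complex_ofReal,
      integral_sub (hXp (by norm_num)) (integrable_const v), h2]
    simp
  have e : ∫ ω, W ω * (Complex.exp ((c ω * X ω : ℝ) * Complex.I) - Real.exp (-(v * c ω ^ 2 / 2))) ∂P
      = ∫ ω, W ω * (r1 ω - r2 ω) ∂P := by
    -- The integrand minus its remainder is iWcX - Wc²(X² - v)/2, and both parts have mean zero by
    -- independence.
    have e3 : ∫ ω, (Complex.I * ((W ω * c ω) * (X ω : ℂ)) -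
        1 / 2 * ((W ω * c ω ^ 2) * ((X ω ^ 2 - v : ℝ) : ℂ))) ∂P = 0 := by
      rw [integral_sub (hl1.const_mul _) (hl2.const_mul _), integral_const_mul, integral_const_mul,
        e1, e2]
      simp
    have e4 : Integrable (fun ω => Complex.I * ((W ω * c ω) * (X ω : ℂ)) -
        1 / 2 * ((W ω * c ω ^ 2) * ((X ω ^ 2 - v : ℝ) : ℂ))) P :=
      (hl1.const_mul _).sub (hl2.const_mul _)
    rw [← add_zero (∫ ω, W ω * (r1 ω - r2 ω) ∂P), ← e3, ← integral_add hrem e4]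
    congr 1; ext ω
    simp only [hr1, hr2]
    push_cast
    ring
  rw [e]
  refine (norm_integral_le_of_norm_le (hgi.const_mul w) (ae_of_all _ fun ω => ?_)).trans ?_
  · rw [norm_mul]
    refine mul_le_mul (hWb ω) ((norm_sub_le _ _).trans (add_le_add (hr1b ω) ?_)) (norm_nonneg _) hw
    rw [Complex.norm_real]; exact hr2b ω
  · rw [integral_const_mul]
    refine mul_le_mul_of_nonneg_left ?_ hw
    have hc4 : 0 ≤ ∫ ω, c ω ^ 4 ∂P := integral_nonneg fun ω => by positivity
    rw [hg, integral_add i24 ic4, integral_const_mul, integral_add i2 i4, integral_const_mul,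
      integral_div, integral_const_mul, indR, indR, h2]
    have : (∫ ω, c ω ^ 4 ∂P) * (∫ ω, X ω ^ 4 ∂P) / η ≤ (∫ ω, c ω ^ 4 ∂P) * K / η := by gcongr
    have e5 : 2 * K / η * ∫ ω, c ω ^ 4 ∂P = 2 * ((∫ ω, c ω ^ 4 ∂P) * K / η) := by ring
    rw [add_mul, e5]
    linarith

end LocalProjection

/-! ### Telescoping and truncation for martingale arrays -/

namespace LocalProjection

namespace MartArray

variable {Ω : Type*} [mΩ : MeasurableSpace Ω] {P : Measure Ω} {𝓖 : ℕ → MeasurableSpace Ω}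
  {c X : ℕ → Ω → ℝ} {v K : ℝ} {N : ℕ} (hA : MartArray P 𝓖 c X v K N)
include hA

lemma measurable_condVar {k m : ℕ} (hk : k ≤ N) (hkm : k ≤ m + 1) :
    Measurable[𝓖 m] fun ω => v * ∑ j ∈ Finset.range k, c j ω ^ 2 := by
  have : Measurable[𝓖 m] fun ω => ∑ j ∈ Finset.range k, c j ω ^ 2 :=
    Finset.measurable_fun_sum _ fun j hj => by
      have hj := Finset.mem_range.1 hj
      exact ((hA.meas_coef j (by omega)).mono (hA.mono (by omega)) le_rfl).pow_const 2
  exact this.const_mul v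

lemma measurable_sum {m : ℕ} (hm : m ≤ N) :
    Measurable[𝓖 m] fun ω => ∑ j ∈ Finset.range m, c j ω * X j ω :=
  Finset.measurable_fun_sum _ fun j hj => by
    have hj := Finset.mem_range.1 hj
    have h1 : Measurable[𝓖 m] (c j) :=
      (hA.meas_coef j (by omega)).mono (hA.mono (by omega)) le_rfl
    exact h1.mul ((hA.meas_shock j (by omega)).mono (hA.mono (by omega)) le_rfl)

/-- With S_m the partial sum and V_m its conditional variance, exp(iS_m + V_m/2) has nearly constant
expectation in m. The bound V_N ≤ L keeps the compensator below exp(L/2), and the one-step errors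
are summed. -/
lemma norm_integral_exp_sub_one_le (hv : 0 < v) {L η : ℝ} (hη : 0 < η)
    (hL : ∀ ω, v * ∑ j ∈ Finset.range N, c j ω ^ 2 ≤ L) :
    ‖∫ ω, Complex.exp ((∑ j ∈ Finset.range N, c j ω * X j ω : ℝ) * Complex.I +
        (v * ∑ j ∈ Finset.range N, c j ω ^ 2 : ℝ) / 2) ∂P - 1‖ ≤
      Real.exp (L / 2) * (2 * η * L +
        (2 * K / η + v ^ 2) * ∑ j ∈ Finset.range N, ∫ ω, c j ω ^ 4 ∂P) := by
  have := hA.prob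
  set D : ℕ → Ω → ℂ := fun m ω => Complex.exp ((∑ j ∈ Finset.range m, c j ω * X j ω : ℝ) * Complex.I +
        (v * ∑ j ∈ Finset.range m, c j ω ^ 2 : ℝ) / 2) with hD
  have hLm : ∀ m ≤ N, ∀ ω, v * ∑ j ∈ Finset.range m, c j ω ^ 2 ≤ L := fun m hm ω =>
    (mul_le_mul_of_nonneg_left (Finset.sum_le_sum_of_subset_of_nonneg
      (Finset.range_mono hm) fun _ _ _ => sq_nonneg _) hv.le).trans (hL ω)
  have hnorm : ∀ a b : ℝ, ‖Complex.exp ((a : ℂ) * Complex.I + (b : ℂ) / 2)‖ = Real.exp (b / 2) := by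
    intro a b
    rw [Complex.norm_exp]; simp
  have hsm : ∀ m ≤ N, Measurable fun ω => ∑ j ∈ Finset.range m, c j ω * X j ω := fun m hm =>
    (hA.measurable_sum hm).mono (hA.le m) le_rfl
  have hvm : ∀ m ≤ N, Measurable fun ω => v * ∑ j ∈ Finset.range m, c j ω ^ 2 := fun m hm =>
    (hA.measurable_condVar hm (Nat.le_succ m)).mono (hA.le m) le_rfl
  have hDi : ∀ m ≤ N, Integrable (D m) P := fun m hm => by
    have h1 := hsm m hm
    have h2 := hvm m hm
    refine Integrable.of_bound (C := Real.exp (L / 2)) ?_ (ae_of_all _ fun ω => ?_)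
    · exact Measurable.aestronglyMeasurable (by fun_prop)
    · rw [hnorm]; exact Real.exp_le_exp.2 (by linarith [hLm m hm ω])
  have hc4 : ∀ m, 0 ≤ ∫ ω, c m ω ^ 4 ∂P := fun m => integral_nonneg fun ω => by positivity
  have hstep : ∀ m < N, ‖∫ ω, D (m + 1) ω ∂P - ∫ ω, D m ω ∂P‖ ≤
      Real.exp (L / 2) * (2 * η * (v * ∫ ω, c m ω ^ 2 ∂P) +
        (2 * K / η + v ^ 2) * ∫ ω, c m ω ^ 4 ∂P) := fun m hm => by
    rw [← integral_sub (hDi (m + 1) hm) (hDi m hm.le)]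
    -- The weight pairs S_m with V_{m+1}, which is already known at stage m because `c m` is
    -- predictable. With it, D_{m+1} - D_m is exactly the weight times the one-step difference.
    have hW : Measurable[𝓖 m] fun ω => Complex.exp ((∑ j ∈ Finset.range m, c j ω * X j ω : ℝ) *
        Complex.I + (v * ∑ j ∈ Finset.range (m + 1), c j ω ^ 2 : ℝ) / 2) := by
      have h1 : Measurable[𝓖 m] fun ω => ((∑ j ∈ Finset.range m, c j ω * X j ω : ℝ) : ℂ) :=
        Complex.measurable_ofReal.comp (hA.measurable_sum hm.le)
      have h2 : Measurable[𝓖 m] fun ω => ((v * ∑ j ∈ Finset.range (m + 1), c j ω ^ 2 : ℝ) : ℂ) :=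
        Complex.measurable_ofReal.comp (hA.measurable_condVar hm le_rfl)
      exact Complex.measurable_exp.comp ((h1.mul_const _).add (h2.div_const 2))
    have hXm : Measurable (X m) := (hA.meas_shock m hm).mono (hA.le _) le_rfl
    have := norm_integral_char_step_le (hA.le m) hη hv.le hW (hA.meas_coef m hm) hXm (hA.indep m hm)
      (w := Real.exp (L / 2)) (b := √(L / v))
      (fun ω => by rw [hnorm]; exact Real.exp_le_exp.2 (by linarith [hLm (m + 1) hm ω]))
      (fun ω => by
        refine Real.abs_le_sqrt ?_
        rw [le_div_iff₀ hv, mul_comm]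
        refine (mul_le_mul_of_nonneg_left ?_ hv.le).trans (hLm (m + 1) hm ω)
        exact Finset.single_le_sum (f := fun j => c j ω ^ 2) (fun _ _ => sq_nonneg _)
          (Finset.self_mem_range_succ m))
      (hA.integrable_fourth m hm) (hA.mean_zero m hm) (hA.second m hm) (hA.fourth_le m hm)
    convert this using 4 with ω
    rw [mul_sub, Complex.ofReal_exp, ← Complex.exp_add, ← Complex.exp_add]
    simp only [hD, Finset.sum_range_succ]
    congr 2 <;> push_cast <;> ring
  have htel : ∫ ω, D N ω ∂P - 1 = ∑ m ∈ Finset.range N, (∫ ω, D (m + 1) ω ∂P - ∫ ω, D m ω ∂P) := by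
    rw [Finset.sum_range_sub (fun m => ∫ ω, D m ω ∂P)]
    simp [hD]
  rw [htel]
  refine (norm_sum_le _ _).trans ((Finset.sum_le_sum fun m hm =>
    hstep m (Finset.mem_range.1 hm)).trans ?_)
  rw [← Finset.mul_sum, Finset.sum_add_distrib, ← Finset.mul_sum, ← Finset.mul_sum, ← Finset.mul_sum]
  refine mul_le_mul_of_nonneg_left (add_le_add ?_ le_rfl) (Real.exp_pos _).le
  refine mul_le_mul_of_nonneg_left ?_ (by positivity)
  have hci : ∀ m < N, Integrable (fun ω => c m ω ^ 2) P := fun m hm =>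
    integrable_pow_of_fourth ((hA.meas_coef m hm).mono (hA.le m) le_rfl) (hA.coef_fourth m hm)
      (by norm_num)
  rw [← integral_finsetSum _ fun m hm => hci m (Finset.mem_range.1 hm), ← integral_const_mul]
  have : ∫ ω, v * ∑ j ∈ Finset.range N, c j ω ^ 2 ∂P ≤ ∫ _, L ∂P :=
    integral_mono ((integrable_finsetSum _ fun m hm => hci m (Finset.mem_range.1 hm)).const_mul v)
      (integrable_const L) hL
  simpa using this

/-- Truncation of the coefficients at the first date where the conditional variance exceeds `L`. -/
lemma truncate (L : ℝ) :
    MartArray P 𝓖 (fun m ω => if v * ∑ j ∈ Finset.range (m + 1), c j ω ^ 2 ≤ L then c m ω else 0)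
      X v K N where
  prob := hA.prob
  mono := hA.mono
  le := hA.le
  meas_coef m hm := by
    refine Measurable.ite (m := 𝓖 m) ?_ (hA.meas_coef m hm) measurable_const
    exact measurableSet_le (hA.measurable_condVar hm le_rfl) measurable_const
  meas_shock := hA.meas_shock
  indep := hA.indep
  integrable_fourth := hA.integrable_fourth
  mean_zero := hA.mean_zero
  second := hA.second
  fourth_le := hA.fourth_le
  coef_fourth m hm := by
    refine (hA.coef_fourth m hm).mono' ?_ (ae_of_all _ fun ω => ?_)
    · refine Measurable.aestronglyMeasurable (Measurable.pow_const (Measurable.ite ?_ ?_ ?_) 4)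
      · exact measurableSet_le ((hA.measurable_condVar hm le_rfl).mono (hA.le m) le_rfl)
          measurable_const
      · exact (hA.meas_coef m hm).mono (hA.le m) le_rfl
      · exact measurable_const
    · have : 0 ≤ c m ω ^ 4 := by positivity
      split_ifs
      · rw [Real.norm_of_nonneg this]
      · simpa using this

/-- Central limit theorem for martingale difference arrays, at the level of characteristic
functions and with an explicit error. -/
theorem norm_integral_exp_sub_gaussian_le (hv : 0 < v) (hK : 0 ≤ K) {τ η : ℝ} (hτ : 0 < τ)
    (hη : 0 < η)
    (hV : Integrable (fun ω => |v * ∑ j ∈ Finset.range N, c j ω ^ 2 - τ|) P) :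
    ‖∫ ω, Complex.exp ((∑ j ∈ Finset.range N, c j ω * X j ω : ℝ) * Complex.I) ∂P -
        Real.exp (-τ / 2)‖ ≤
      Real.exp τ * (4 * η * τ + (2 * K / η + v ^ 2) * ∑ j ∈ Finset.range N, ∫ ω, c j ω ^ 4 ∂P) +
        (Real.exp (τ / 2) + 2 / τ) * ∫ ω, |v * ∑ j ∈ Finset.range N, c j ω ^ 2 - τ| ∂P := by
  have := hA.prob
  -- Truncating at 2τ changes nothing where V ≤ 2τ, and elsewhere |V - τ| > τ, so its cost is
  -- controlled by the integral of |V - τ|.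
  have hB := hA.truncate (2 * τ)
  set d : ℕ → Ω → ℝ := fun m ω =>
    if v * ∑ j ∈ Finset.range (m + 1), c j ω ^ 2 ≤ 2 * τ then c m ω else 0 with hd
  set V : Ω → ℝ := fun ω => v * ∑ j ∈ Finset.range N, c j ω ^ 2 with hVdef
  set V' : Ω → ℝ := fun ω => v * ∑ j ∈ Finset.range N, d j ω ^ 2 with hV'def
  have hd0 : ∀ m ω, d m ω ^ 2 ≤ c m ω ^ 2 := fun m ω => by
    simp only [hd]; split_ifs
    · exact le_rfl
    · simpa using sq_nonneg (c m ω)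
  have hV'le : ∀ ω, V' ω ≤ 2 * τ := by
    intro ω
    have : ∀ m, v * ∑ j ∈ Finset.range m, d j ω ^ 2 ≤ 2 * τ := by
      intro m
      induction m with
      | zero => simp; linarith
      | succ m ih =>
        by_cases h : v * ∑ j ∈ Finset.range (m + 1), c j ω ^ 2 ≤ 2 * τ
        · exact (mul_le_mul_of_nonneg_left (Finset.sum_le_sum fun j _ => hd0 j ω) hv.le).trans h
        · rw [Finset.sum_range_succ]
          have : d m ω = 0 := by simp only [hd]; rw [if_neg h]
          rw [this]; simpa using ih
    exact this N
  have hV'0 : ∀ ω, 0 ≤ V' ω := fun ω =>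
    mul_nonneg hv.le (Finset.sum_nonneg fun _ _ => sq_nonneg _)
  have heq : ∀ ω, V ω ≤ 2 * τ → ∀ m < N, d m ω = c m ω := fun ω hω m hm => by
    simp only [hd]
    refine if_pos (le_trans ?_ hω)
    exact mul_le_mul_of_nonneg_left (Finset.sum_le_sum_of_subset_of_nonneg
      (Finset.range_mono hm) fun _ _ _ => sq_nonneg _) hv.le
  have hVV : ∀ ω, |V' ω - τ| ≤ |V ω - τ| := fun ω => by
    rcases le_or_gt (V ω) (2 * τ) with h | h
    · have : V' ω = V ω := by
        simp only [hVdef, hV'def]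
        congr 1
        exact Finset.sum_congr rfl fun m hm => by rw [heq ω h m (Finset.mem_range.1 hm)]
      rw [this]
    · rw [abs_of_pos (by linarith : 0 < V ω - τ)]
      have : |V' ω - τ| ≤ τ := abs_le.2 ⟨by linarith [hV'0 ω], by linarith [hV'le ω]⟩
      linarith
  set S : Ω → ℝ := fun ω => ∑ j ∈ Finset.range N, c j ω * X j ω with hS
  set S' : Ω → ℝ := fun ω => ∑ j ∈ Finset.range N, d j ω * X j ω with hS'
  have hSm : Measurable S := (hA.measurable_sum le_rfl).mono (hA.le N) le_rfl
  have hS'm : Measurable S' := (hB.measurable_sum le_rfl).mono (hA.le N) le_rfl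
  have hV'm : Measurable V' := (hB.measurable_condVar le_rfl (Nat.le_succ N)).mono (hA.le N) le_rfl
  have h1 := hB.norm_integral_exp_sub_one_le hv hη (L := 2 * τ) hV'le
  have h1' : ‖∫ ω, Complex.exp ((S' ω : ℝ) * Complex.I + (V' ω : ℝ) / 2) ∂P - 1‖ ≤
      Real.exp τ * (4 * η * τ +
        (2 * K / η + v ^ 2) * ∑ j ∈ Finset.range N, ∫ ω, c j ω ^ 4 ∂P) := by
    refine h1.trans ?_
    rw [mul_div_cancel_left₀ τ (two_ne_zero)]
    refine mul_le_mul_of_nonneg_left (add_le_add (le_of_eq (by ring)) ?_) (Real.exp_pos _).le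
    refine mul_le_mul_of_nonneg_left (Finset.sum_le_sum fun m hm => ?_) (by positivity)
    have hm := Finset.mem_range.1 hm
    refine integral_mono (hB.coef_fourth m hm) (hA.coef_fourth m hm) fun ω => ?_
    have h2 := pow_le_pow_left₀ (sq_nonneg _) (hd0 m ω) 2
    calc d m ω ^ 4 = (d m ω ^ 2) ^ 2 := by ring
      _ ≤ _ := h2
      _ = c m ω ^ 4 := by ring
  have hexpi : ∀ {Y : Ω → ℝ}, Measurable Y →
      Integrable (fun ω => Complex.exp ((Y ω : ℂ) * Complex.I)) P := fun hY =>
    Integrable.of_bound (C := 1) (Measurable.aestronglyMeasurable (by fun_prop))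
      (ae_of_all _ fun ω => by rw [Complex.norm_exp_ofReal_mul_I])
  have hEi : Integrable (fun ω => Complex.exp ((S' ω : ℝ) * Complex.I + (V' ω : ℝ) / 2)) P := by
    refine Integrable.of_bound (C := Real.exp τ) (Measurable.aestronglyMeasurable (by fun_prop))
      (ae_of_all _ fun ω => ?_)
    rw [Complex.norm_exp]
    simp
    linarith [hV'le ω]
  have h2 : ‖∫ ω, Complex.exp ((S ω : ℂ) * Complex.I) ∂P - ∫ ω, Complex.exp ((S' ω : ℂ) * Complex.I) ∂P‖
      ≤ 2 / τ * ∫ ω, |V ω - τ| ∂P := by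
    rw [← integral_sub (hexpi hSm) (hexpi hS'm), ← integral_const_mul]
    refine norm_integral_le_of_norm_le (hV.const_mul _) (ae_of_all _ fun ω => ?_)
    rcases le_or_gt (V ω) (2 * τ) with h | h
    · have : S' ω = S ω := Finset.sum_congr rfl fun m hm => by rw [heq ω h m (Finset.mem_range.1 hm)]
      rw [this, sub_self, norm_zero]
      positivity
    · refine (norm_sub_le _ _).trans ?_
      rw [Complex.norm_exp_ofReal_mul_I, Complex.norm_exp_ofReal_mul_I,
        abs_of_pos (by linarith : 0 < V ω - τ), div_mul_eq_mul_div, le_div_iff₀ hτ]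
      linarith
  -- Here the random compensator exp(V'/2) is exchanged for the constant exp(τ/2). The exponent
  -- difference is at most τ/2 in size, which gives the factor exp(τ/2).
  have h3 : ‖∫ ω, Complex.exp ((S' ω : ℂ) * Complex.I) ∂P -
      Real.exp (-τ / 2) * ∫ ω, Complex.exp ((S' ω : ℝ) * Complex.I + (V' ω : ℝ) / 2) ∂P‖ ≤
      Real.exp (τ / 2) * ∫ ω, |V ω - τ| ∂P := by
    rw [← integral_const_mul, ← integral_sub (hexpi hS'm) (hEi.const_mul _), ← integral_const_mul]
    refine norm_integral_le_of_norm_le (hV.const_mul _) (ae_of_all _ fun ω => ?_)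
    have e : Complex.exp ((S' ω : ℂ) * Complex.I) -
        Real.exp (-τ / 2) * Complex.exp ((S' ω : ℝ) * Complex.I + (V' ω : ℝ) / 2) =
        Complex.exp ((S' ω : ℂ) * Complex.I) * ((-(Real.exp ((V' ω - τ) / 2) - 1) : ℝ) : ℂ) := by
      push_cast
      rw [Complex.exp_add, show ((V' ω : ℂ) - τ) / 2 = -τ / 2 + V' ω / 2 by ring, Complex.exp_add]
      ring
    rw [e, norm_mul, Complex.norm_exp_ofReal_mul_I, one_mul, Complex.norm_real, norm_neg,
      Real.norm_eq_abs]
    refine (abs_exp_sub_one_le _).trans ?_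
    have h4 : |(V' ω - τ) / 2| ≤ |V ω - τ| / 2 := by
      rw [abs_div, abs_two]; linarith [hVV ω]
    have h5 : |(V' ω - τ) / 2| ≤ τ / 2 := by
      rw [abs_div, abs_two]
      have : |V' ω - τ| ≤ τ := abs_le.2 ⟨by linarith [hV'0 ω], by linarith [hV'le ω]⟩
      linarith
    have h6 := mul_le_mul h4 (Real.exp_le_exp.2 h5) (Real.exp_pos _).le (by positivity)
    refine h6.trans ?_
    have := mul_nonneg (abs_nonneg (V ω - τ)) (Real.exp_pos (τ / 2)).le
    linarith
  have h4 : ‖(Real.exp (-τ / 2) : ℂ) * ∫ ω, Complex.exp ((S' ω : ℝ) * Complex.I + (V' ω : ℝ) / 2) ∂P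
      - Real.exp (-τ / 2)‖ ≤ Real.exp τ * (4 * η * τ +
        (2 * K / η + v ^ 2) * ∑ j ∈ Finset.range N, ∫ ω, c j ω ^ 4 ∂P) := by
    rw [show ∀ a b : ℂ, a * b - a = a * (b - 1) by intro a b; ring, norm_mul, Complex.norm_real,
      Real.norm_of_nonneg (Real.exp_pos _).le]
    refine (mul_le_of_le_one_left (norm_nonneg _) (Real.exp_le_one_iff.2 (by linarith))).trans h1'
  have h5 := (norm_sub_le_norm_sub_add_norm_sub (∫ ω, Complex.exp ((S ω : ℂ) * Complex.I) ∂P)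
    (∫ ω, Complex.exp ((S' ω : ℂ) * Complex.I) ∂P) (Real.exp (-τ / 2) : ℂ))
  have h6 := (norm_sub_le_norm_sub_add_norm_sub (∫ ω, Complex.exp ((S' ω : ℂ) * Complex.I) ∂P)
    (Real.exp (-τ / 2) * ∫ ω, Complex.exp ((S' ω : ℝ) * Complex.I + (V' ω : ℝ) / 2) ∂P)
    (Real.exp (-τ / 2) : ℂ))
  rw [add_mul]
  linarith

end MartArray

end LocalProjection

/-! ### Normal approximation of the score -/

namespace LocalProjection

lemma integral_abs_le_sqrt {Ω : Type*} [MeasurableSpace Ω] {P : Measure Ω}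
    [IsProbabilityMeasure P] {f : Ω → ℝ}
    (hf : Measurable f) (hi : Integrable (fun ω => f ω ^ 2) P) {b : ℝ} (hb : ∫ ω, f ω ^ 2 ∂P ≤ b) :
    Integrable (fun ω => |f ω|) P ∧ ∫ ω, |f ω| ∂P ≤ √b := by
  have h2 : MemLp f 2 P := (memLp_two_iff_integrable_sq hf.aestronglyMeasurable).2 hi
  have h1 : Integrable (fun ω => |f ω|) P := (h2.integrable (by norm_num)).abs
  refine ⟨h1, Real.le_sqrt_of_sq_le (le_trans ?_ hb)⟩
  set m := ∫ ω, |f ω| ∂P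
  have h0 : 0 ≤ ∫ ω, (|f ω| - m) ^ 2 ∂P := integral_nonneg fun ω => sq_nonneg _
  have e : (fun ω => (|f ω| - m) ^ 2) = fun ω => f ω ^ 2 - 2 * m * |f ω| + m ^ 2 := by
    ext ω; rw [sub_sq, sq_abs]; ring
  have j : Integrable (fun ω => f ω ^ 2 - 2 * m * |f ω|) P := hi.sub (h1.const_mul _)
  rw [e, integral_add j (integrable_const _), integral_sub hi (h1.const_mul _),
    integral_const_mul] at h0
  simp at h0
  have : ∫ ω, |f ω| ∂P = m := rfl
  rw [this] at h0
  nlinarith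

namespace Shocks

variable {Ω : Type*} [mΩ : MeasurableSpace Ω] {P : Measure Ω} {u : ℕ → Ω → ℝ} {v K : ℝ}
  (hu : Shocks P u v K)
include hu

/-- Time is reversed: stage m knows the shocks of index at least T - m. The block starting at T - m
is then known, while the shock of index T - 1 - m is still fresh. In forward order the products
would not be adapted, since a block looks h dates ahead. -/
lemma martArray (ρ a : ℝ) (h T : ℕ) :
    MartArray P (fun m => sigmaOn u {i | T ≤ i + m}) (fun m ω => a * blk ρ u h (T - m) ω)
      (fun m => u (T - 1 - m)) v K T where
  prob := hu.prob
  mono m m' hm := sigmaOn_mono u fun i (hi : T ≤ i + m) => show T ≤ i + m' by omega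
  le m := hu.sigmaOn_le _
  meas_coef m hm := by
    have : Measurable[sigmaOn u {i | T ≤ i + m}] (blk ρ u h (T - m)) :=
      measurable_blk ρ u h (T - m) fun i hi => show T ≤ i + m by have := hi.1; omega
    exact this.const_mul a
  meas_shock m hm := measurable_sigmaOn u (show T ≤ T - 1 - m + (m + 1) by omega)
  indep m hm := by
    have h1 : Disjoint {i | T ≤ i + m} {T - 1 - m} :=
      Set.disjoint_singleton_right.2 fun (hi : T ≤ T - 1 - m + m) => by omega
    have h2 : MeasurableSpace.comap (u (T - 1 - m)) inferInstance ≤ sigmaOn u {T - 1 - m} :=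
      (measurable_sigmaOn u (Set.mem_singleton _)).comap_le
    exact indep_of_indep_of_le_right
      (indep_iSup_of_disjoint (fun i => (hu.meas i).comap_le) hu.indep h1) h2
  integrable_fourth m _ := hu.integrable_fourth _
  mean_zero m _ := hu.mean_zero _
  second m _ := hu.second _
  fourth_le m _ := hu.fourth_le _
  coef_fourth m _ := by
    simp only [mul_pow]
    exact (hu.blk_moments ρ h (T - m)).1.const_mul _

/-- The summand of index i depends only on the shocks i, …, i + h + s, so the relative variance of
the sum is of order (h + s)/T, whatever ρ is. -/
lemma integral_sq_sum_blk_sq_sub_le (ρ : ℝ) (h s T : ℕ) :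
    Integrable (fun ω => (∑ i ∈ Finset.range T, blk ρ u h (i + s) ω ^ 2 - T * (v * gain ρ h)) ^ 2) P ∧
    ∫ ω, (∑ i ∈ Finset.range T, blk ρ u h (i + s) ω ^ 2 - T * (v * gain ρ h)) ^ 2 ∂P ≤
      T * (2 * (h + s : ℕ) + 1) * (3 * K * gain ρ h ^ 2) := by
  have e : ∀ i, (fun ω => (blk ρ u h (i + s) ω ^ 2) ^ 2) = fun ω => blk ρ u h (i + s) ω ^ 4 :=
    fun i => by ext ω; ring
  refine hu.integral_sq_sum_sub_le (Z := fun i ω => blk ρ u h (i + s) ω ^ 2) (fun i => ?_)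
    (fun i => ?_) (fun i => (hu.blk_moments ρ h (i + s)).2.2.1) (fun i => ?_) T
  · have : Measurable[sigmaOn u (Set.Ico i (i + (h + s) + 1))] (blk ρ u h (i + s)) :=
      measurable_blk ρ u h (i + s) (Set.Ico_subset_Ico (by omega) (by omega))
    exact this.pow_const 2
  · rw [e]; exact (hu.blk_moments ρ h (i + s)).1
  · rw [e]; exact (hu.blk_moments ρ h (i + s)).2.2.2

lemma measurable_sum_blk_mul (ρ : ℝ) (h T : ℕ) :
    Measurable fun ω => ∑ i ∈ Finset.range T, blk ρ u h (i + 1) ω * u i ω :=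
  Finset.measurable_fun_sum _ fun i _ => (hu.measurable_blk' ρ h (i + 1)).mul (hu.meas i)

/-- The characteristic function of the normalised score is close to the Gaussian one. -/
lemma norm_integral_exp_score_le (hv : 0 < v) (ρ : ℝ) {h T : ℕ} (hh : 1 ≤ h) (hT : 1 ≤ T)
    {r : ℝ} (hr : 0 < r) (hr2 : (2 * h + 3 : ℝ) ≤ r ^ 2 * T) (l : ℝ) :
    ‖∫ ω, Complex.exp ((l * ((∑ i ∈ Finset.range T, blk ρ u h (i + 1) ω * u i ω) /
        (v * √(T * gain ρ h))) : ℝ) * Complex.I) ∂P - Real.exp (-l ^ 2 / 2)‖ ≤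
      r * (Real.exp (l ^ 2) * (4 * l ^ 2 + 9 * K ^ 2 * l ^ 4 / v ^ 4) +
        (Real.exp (l ^ 2 / 2) * l ^ 2 + 2) * (√(3 * K) / v)) := by
  have := hu.prob
  have hK : 0 ≤ K := (sq_nonneg v).trans hu.var_sq_le
  -- The limit theorem needs a positive target variance τ = l², so l = 0 is treated apart.
  rcases eq_or_ne l 0 with rfl | hl
  · simp; positivity
  set g := gain ρ h
  have hg : 0 < g := lt_of_lt_of_le one_pos (one_le_gain ρ hh)
  have hT0 : (0 : ℝ) < T := by exact_mod_cast hT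
  have hT1 : (1 : ℝ) ≤ T := by exact_mod_cast hT
  have hTg : 0 < √(T * g) := Real.sqrt_pos.2 (by positivity)
  -- The frequency l and the normalisation go into the coefficients, so that the array sums to l
  -- times the score and the target variance is l².
  set a := l / (v * √(T * g)) with ha
  have ha2 : a ^ 2 = l ^ 2 / (v ^ 2 * (T * g)) := by
    rw [ha, div_pow, mul_pow, Real.sq_sqrt (by positivity)]
  have hA := hu.martArray ρ a h T
  have hsum : ∀ f : ℕ → ℝ, ∑ m ∈ Finset.range T, f (T - m) = ∑ i ∈ Finset.range T, f (i + 1) := by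
    intro f
    rw [← Finset.sum_range_reflect (fun i => f (i + 1)) T]
    exact Finset.sum_congr rfl fun m hm => by
      have := Finset.mem_range.1 hm
      congr 1; omega
  have hS : ∀ ω, ∑ m ∈ Finset.range T, a * blk ρ u h (T - m) ω * u (T - 1 - m) ω =
      l * ((∑ i ∈ Finset.range T, blk ρ u h (i + 1) ω * u i ω) / (v * √(T * g))) := fun ω => by
    rw [← Finset.sum_range_reflect (fun i => blk ρ u h (i + 1) ω * u i ω) T, ha, Finset.sum_div,
      Finset.mul_sum]
    exact Finset.sum_congr rfl fun m hm => by
      have := Finset.mem_range.1 hm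
      rw [show T - 1 - m + 1 = T - m by omega]; ring
  set Q : Ω → ℝ := fun ω => ∑ i ∈ Finset.range T, blk ρ u h (i + 1) ω ^ 2 - T * (v * g) with hQ
  have hVQ : ∀ ω, |v * ∑ m ∈ Finset.range T, (a * blk ρ u h (T - m) ω) ^ 2 - l ^ 2| =
      v * a ^ 2 * |Q ω| := fun ω => by
    have h1 : 0 ≤ v * a ^ 2 := by positivity
    refine Eq.trans ?_ (show |v * a ^ 2 * Q ω| = _ by rw [abs_mul, abs_of_nonneg h1])
    congr 1
    have h2 := hsum fun i => blk ρ u h i ω ^ 2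
    simp only [mul_pow, ← Finset.mul_sum, h2, hQ, mul_sub]
    congr 1
    · ring
    · rw [ha2]; field_simp
  have hQm : Measurable Q :=
    (Finset.measurable_fun_sum _ fun i _ => (hu.measurable_blk' ρ h (i + 1)).pow_const 2).sub_const _
  obtain ⟨hQ2, hQ2le⟩ := hu.integral_sq_sum_blk_sq_sub_le ρ h 1 T
  have hQle : ∫ ω, Q ω ^ 2 ∂P ≤ 3 * K * (r * T * g) ^ 2 := hQ2le.trans (by
    have h1 : (2 * ((h + 1 : ℕ) : ℝ) + 1) ≤ r ^ 2 * T := by push_cast; linarith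
    have h2 : (T : ℝ) * (2 * ((h + 1 : ℕ) : ℝ) + 1) ≤ T * (r ^ 2 * T) := by gcongr
    have h3 := mul_le_mul_of_nonneg_right h2 (by positivity : 0 ≤ 3 * K * g ^ 2)
    refine h3.trans (le_of_eq (by ring)))
  obtain ⟨hQi, hQ1⟩ := integral_abs_le_sqrt hQm hQ2 hQle
  rw [Real.sqrt_mul (by positivity), Real.sqrt_sq (by positivity)] at hQ1
  have hVint : Integrable
      (fun ω => |v * ∑ m ∈ Finset.range T, (a * blk ρ u h (T - m) ω) ^ 2 - l ^ 2|) P := by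
    simp only [hVQ]; exact hQi.const_mul _
  -- The fourth-moment sum is of order 1/T ≤ r², so η = r makes both Taylor errors of order r. The
  -- conditional variance also errs by order r, because 2h + 3 ≤ r²T.
  have key := hA.norm_integral_exp_sub_gaussian_le hv hK (τ := l ^ 2) (η := r) (by positivity) hr hVint
  simp only [hS, hVQ] at key
  refine key.trans ?_
  rw [integral_const_mul]
  have hr1 : 1 / T ≤ r ^ 2 := by
    rw [div_le_iff₀ hT0]
    have : (1 : ℝ) ≤ h := by exact_mod_cast hh
    linarith
  have hc4 : ∑ m ∈ Finset.range T, ∫ ω, (a * blk ρ u h (T - m) ω) ^ 4 ∂P ≤ 3 * K * l ^ 4 / v ^ 4 / T := by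
    have : ∀ m ∈ Finset.range T, ∫ ω, (a * blk ρ u h (T - m) ω) ^ 4 ∂P ≤ a ^ 4 * (3 * K * g ^ 2) :=
      fun m _ => by
        simp only [mul_pow]
        rw [integral_const_mul]
        exact mul_le_mul_of_nonneg_left (hu.blk_moments ρ h (T - m)).2.2.2 (by positivity)
    refine (Finset.sum_le_sum this).trans (le_of_eq ?_)
    rw [Finset.sum_const, Finset.card_range, nsmul_eq_mul, show a ^ 4 = (a ^ 2) ^ 2 by ring, ha2]
    field_simp
  have hpart2 : (Real.exp (l ^ 2 / 2) + 2 / l ^ 2) * (v * a ^ 2 * ∫ ω, |Q ω| ∂P) ≤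
      r * ((Real.exp (l ^ 2 / 2) * l ^ 2 + 2) * (√(3 * K) / v)) := by
    have h1 : v * a ^ 2 * ∫ ω, |Q ω| ∂P ≤ v * a ^ 2 * (√(3 * K) * (r * T * g)) := by gcongr
    have h2 := mul_le_mul_of_nonneg_left h1
      (by positivity : 0 ≤ Real.exp (l ^ 2 / 2) + 2 / l ^ 2)
    refine h2.trans (le_of_eq ?_)
    rw [ha2]; field_simp
  have hpart1 : (2 * K / r + v ^ 2) * ∑ m ∈ Finset.range T, ∫ ω, (a * blk ρ u h (T - m) ω) ^ 4 ∂P ≤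
      r * (9 * K ^ 2 * l ^ 4 / v ^ 4) := by
    have h1 : (2 * K / r + v ^ 2) * (1 / T) ≤ 3 * K * r := by
      have h3 : 2 * K / r * (1 / T) ≤ 2 * K / r * r ^ 2 := by gcongr
      have h4 : 2 * K / r * r ^ 2 = 2 * K * r := by field_simp
      have h5 : 1 / (T : ℝ) ≤ r := by
        rcases le_total r 1 with h | h
        · nlinarith
        · exact ((div_le_one hT0).2 hT1).trans h
      have h6 : v ^ 2 * (1 / T) ≤ K * r := mul_le_mul hu.var_sq_le h5 (by positivity) hK
      linarith
    calc _ ≤ (2 * K / r + v ^ 2) * (3 * K * l ^ 4 / v ^ 4 / T) := by gcongr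
      _ = (2 * K / r + v ^ 2) * (1 / T) * (3 * K * l ^ 4 / v ^ 4) := by ring
      _ ≤ 3 * K * r * (3 * K * l ^ 4 / v ^ 4) := by gcongr
      _ = _ := by ring
  have := mul_le_mul_of_nonneg_left hpart1 (Real.exp_pos (l ^ 2)).le
  linarith

end Shocks

end LocalProjection

/-! ### The normal distribution function and uniform convergence to it -/

namespace LocalProjection

lemma Phi_mono : Monotone Phi := monotone_cdf _

lemma Phi_nonneg (x : ℝ) : 0 ≤ Phi x := cdf_nonneg _ x

lemma Phi_le_one (x : ℝ) : Phi x ≤ 1 := cdf_le_one _ x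

lemma Phi_sub_le {x y : ℝ} (hxy : x ≤ y) : Phi y - Phi x ≤ y - x := by
  have h1 : Phi y - Phi x = (gaussianReal 0 1).real (Set.Ioc x y) := by
    rw [Phi, Phi, cdf_eq_real, cdf_eq_real, ← measureReal_sdiff (Set.Iic_subset_Iic.2 hxy)
      measurableSet_Iic]
    congr 1; ext z; simp [and_comm]
  rw [h1, measureReal_def]
  refine ENNReal.toReal_le_of_le_ofReal (by linarith) ?_
  rw [gaussianReal_apply _ one_ne_zero]
  calc ∫⁻ z in Set.Ioc x y, gaussianPDF 0 1 z ≤ ∫⁻ _ in Set.Ioc x y, 1 := by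
        refine lintegral_mono fun z => ?_
        rw [gaussianPDF, ENNReal.ofReal_le_one, gaussianPDFReal]
        refine mul_le_one₀ (inv_le_one_of_one_le₀ ?_) (Real.exp_pos _).le
          (Real.exp_le_one_iff.2 ?_)
        · rw [Real.one_le_sqrt]
          have := Real.pi_gt_three
          simp; linarith
        · rw [neg_div]; exact neg_nonpos.2 (by positivity)
    _ = ENNReal.ofReal (y - x) := by simp

lemma Phi_tails {ε : ℝ} (hε : 0 < ε) : ∃ L : ℝ, 0 < L ∧ Phi (-L) ≤ ε ∧ 1 - ε ≤ Phi L := by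
  have h1 : ∀ᶠ x in atBot, Phi x < ε := (tendsto_cdf_atBot _).eventually (gt_mem_nhds hε)
  have h2 : ∀ᶠ x in atTop, 1 - ε < Phi x :=
    (tendsto_cdf_atTop _).eventually (lt_mem_nhds (by linarith))
  obtain ⟨L, ⟨hL1, hL2⟩, hL⟩ :=
    (((tendsto_neg_atTop_atBot.eventually h1).and h2).and (eventually_gt_atTop 0)).exists
  exact ⟨L, hL, hL1.le, hL2.le⟩

/-- A window proportional to |x| + 1 is what remains of a small shift and a rescaling near 1. For
moderate x the Lipschitz bound suffices; for large |x| the whole window lies in one tail, since δ ≤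
1/2 keeps it beyond (|x| - 1)/2 > L. -/
lemma Phi_modulus {ε : ℝ} (hε : 0 < ε) :
    ∃ δ : ℝ, 0 < δ ∧ δ ≤ 1 / 2 ∧ ∀ x, Phi (x + δ * (|x| + 1)) - Phi (x - δ * (|x| + 1)) ≤ ε := by
  obtain ⟨L, hL, h1, h2⟩ := Phi_tails hε
  set B := 2 * L + 1 with hB
  have hB1 : 0 < B + 1 := by positivity
  refine ⟨min (1 / 2) (ε / (2 * (B + 1))), by positivity, min_le_left _ _, fun x => ?_⟩
  set δ := min (1 / 2) (ε / (2 * (B + 1)))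
  have hδ : δ ≤ 1 / 2 := min_le_left _ _
  have hδ0 : 0 < δ := by positivity
  rcases le_or_gt |x| B with hx | hx
  · have h3 : δ ≤ ε / (2 * (B + 1)) := min_le_right _ _
    have h4 : δ * (|x| + 1) ≤ ε / (2 * (B + 1)) * (B + 1) := by gcongr
    have h5 : ε / (2 * (B + 1)) * (B + 1) = ε / 2 := by field_simp
    have h6 : 0 ≤ δ * (|x| + 1) := by positivity
    have := Phi_sub_le (x := x - δ * (|x| + 1)) (y := x + δ * (|x| + 1)) (by linarith)
    linarith
  · have h4 : δ * (|x| + 1) ≤ 1 / 2 * (|x| + 1) := by gcongr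
    rcases le_total 0 x with h0 | h0
    · rw [abs_of_nonneg h0] at *
      have : Phi L ≤ Phi (x - δ * (x + 1)) := Phi_mono (by linarith)
      linarith [Phi_le_one (x + δ * (x + 1))]
    · rw [abs_of_nonpos h0] at *
      have : Phi (x + δ * (-x + 1)) ≤ Phi (-L) := Phi_mono (by linarith)
      linarith [Phi_nonneg (x - δ * (-x + 1))]

/-- Pólya's theorem: pointwise convergence of distribution functions to `Phi` is uniform. -/
lemma eventually_abs_cdf_sub_Phi_le {F : ℕ → ℝ → ℝ} (hm : ∀ n, Monotone (F n))
    (h0 : ∀ n x, 0 ≤ F n x) (h1 : ∀ n x, F n x ≤ 1)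
    (hF : ∀ x, Tendsto (fun n => F n x) atTop (𝓝 (Phi x))) {ε : ℝ} (hε : 0 < ε) :
    ∀ᶠ n in atTop, ∀ x, |F n x - Phi x| ≤ ε := by
  obtain ⟨L, hL, hL1, hL2⟩ := Phi_tails (half_pos hε)
  -- A grid of mesh ε/2 covers [-L, L]; `Phi` is 1-Lipschitz, so it moves by at most ε/2 between
  -- neighbours.
  obtain ⟨N, hN⟩ := exists_nat_gt (2 * L / (ε / 2))
  set p : ℕ → ℝ := fun j => -L + j * (ε / 2) with hp
  have hev : ∀ᶠ n in atTop, ∀ j ∈ Finset.range (N + 1), |F n (p j) - Phi (p j)| < ε / 2 := by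
    rw [Finset.eventually_all]
    intro j _
    exact (Metric.tendsto_nhds.1 (hF (p j))) (ε / 2) (by positivity)
  filter_upwards [hev] with n hn x
  have hpN : L < p N := by
    rw [div_lt_iff₀ (by positivity)] at hN
    simp only [hp]; linarith
  rcases lt_or_ge x (-L) with hx | hx
  · have a1 := hn 0 (by simp)
    simp only [hp, Nat.cast_zero, zero_mul, add_zero] at a1
    rw [abs_lt] at a1
    have a2 := hm n hx.le
    have a3 := Phi_mono hx.le
    rw [abs_le]; constructor <;> linarith [h0 n x, Phi_nonneg x]
  · rcases lt_or_ge x (p N) with hx' | hx'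
    · have hy : 0 ≤ (x + L) / (ε / 2) := by
        have : 0 ≤ x + L := by linarith
        positivity
      set j := ⌊(x + L) / (ε / 2)⌋₊ with hj
      have b1 : p j ≤ x := by
        have := Nat.floor_le hy
        rw [← hj, le_div_iff₀ (by positivity)] at this
        simp only [hp]; linarith
      have b2 : x < p (j + 1) := by
        have := Nat.lt_floor_add_one ((x + L) / (ε / 2))
        rw [← hj, div_lt_iff₀ (by positivity)] at this
        simp only [hp]; push_cast; linarith
      have b3 : j < N := by
        have : p j < p N := b1.trans_lt hx'
        simp only [hp] at this
        have h2 : (j : ℝ) * (ε / 2) < N * (ε / 2) := by linarith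
        exact_mod_cast lt_of_mul_lt_mul_right h2 (by positivity)
      have c1 := abs_lt.1 (hn j (Finset.mem_range.2 (by omega)))
      have c2 := abs_lt.1 (hn (j + 1) (Finset.mem_range.2 (by omega)))
      have b4 : p (j + 1) = p j + ε / 2 := by simp only [hp]; push_cast; ring
      have d1 := hm n b1
      have d2 := hm n b2.le
      have d3 := Phi_sub_le b1
      have d4 := Phi_sub_le b2.le
      rw [abs_le]; constructor <;> linarith
    · have a1 := abs_lt.1 (hn N (by simp))
      have a2 := hm n hx'
      have a3 := Phi_mono (hpN.le.trans hx')
      have a4 := Phi_mono hpN.le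
      rw [abs_le]; constructor <;> linarith [h1 n x, Phi_le_one x]

/-- If the characteristic function is close to the Gaussian one on a large interval, then the
distribution function is uniformly close to `Phi`. -/
lemma exists_abs_cdf_sub_Phi_le {ε : ℝ} (hε : 0 < ε) :
    ∃ δ : ℝ, 0 < δ ∧ ∃ L : ℝ, 0 < L ∧ ∀ ν : Measure ℝ, IsProbabilityMeasure ν →
      (∀ l : ℝ, |l| ≤ L → ‖charFun ν l - Real.exp (-l ^ 2 / 2)‖ ≤ δ) →
        ∀ x, |cdf ν x - Phi x| ≤ ε := by
  -- If no δ and L worked, taking δ = 1/(n+1) and L = n+1 would yield bad laws whose characteristic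
  -- functions converge pointwise to the Gaussian one. Lévy's continuity theorem followed by Pólya's
  -- contradicts this. The resulting δ and L depend on ε alone.
  by_contra! hcon
  have hpos : ∀ n : ℕ, (0 : ℝ) < (n : ℝ) + 1 := fun n => by positivity
  choose ν hν hchar hbad using fun n : ℕ =>
    hcon (1 / ((n : ℝ) + 1)) (by positivity) ((n : ℝ) + 1) (hpos n)
  choose x hx using hbad
  let μ : ℕ → ProbabilityMeasure ℝ := fun n => ⟨ν n, hν n⟩
  let γ : ProbabilityMeasure ℝ := ⟨gaussianReal 0 1, inferInstance⟩
  have hγ : ∀ l : ℝ, charFun (gaussianReal 0 1) l = Real.exp (-l ^ 2 / 2) := fun l => by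
    rw [charFun_gaussianReal]; push_cast; congr 1; ring
  have hconv : Tendsto μ atTop (𝓝 γ) := by
    refine ProbabilityMeasure.tendsto_iff_tendsto_charFun.2 fun l => ?_
    change Tendsto (fun n => charFun (ν n) l) atTop (𝓝 (charFun (gaussianReal 0 1) l))
    rw [tendsto_iff_norm_sub_tendsto_zero, hγ]
    refine squeeze_zero' (Eventually.of_forall fun n => norm_nonneg _) ?_
      tendsto_one_div_add_atTop_nhds_zero_nat
    obtain ⟨N, hN⟩ := exists_nat_ge |l|
    filter_upwards [eventually_ge_atTop N] with n hn
    refine hchar n l (hN.trans ?_)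
    have : (N : ℝ) ≤ n := by exact_mod_cast hn
    linarith
  have hcdf : ∀ y, Tendsto (fun n => cdf (ν n) y) atTop (𝓝 (Phi y)) := fun y => by
    have h1 := ProbabilityMeasure.tendsto_measure_of_null_frontier_of_tendsto' hconv
      (E := Set.Iic y) (by
        change gaussianReal 0 1 (frontier (Set.Iic y)) = 0
        rw [frontier_Iic]
        exact (gaussianReal_absolutelyContinuous 0 one_ne_zero) (by simp))
    have h2 := (ENNReal.tendsto_toReal (measure_ne_top _ _)).comp h1
    simp only [Phi, cdf_eq_real]
    exact h2
  have := eventually_abs_cdf_sub_Phi_le (F := fun n => cdf (ν n)) (fun n => monotone_cdf _)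
    (fun n => cdf_nonneg _) (fun n => cdf_le_one _) hcdf hε
  obtain ⟨n, hn⟩ := this.exists
  exact absurd (hn (x n)) (not_le.2 (hx n))

end LocalProjection

/-! ### Regression algebra and deterministic error bounds -/

namespace LocalProjection

lemma sum_Icc_one_eq (f : ℕ → ℝ) (T : ℕ) :
    ∑ t ∈ Finset.Icc 1 T, f t = ∑ i ∈ Finset.range T, f (i + 1) := by
  induction T with
  | zero => simp
  | succ T ih => rw [Finset.sum_Icc_succ_top (by omega), ih, Finset.sum_range_succ]

/-- The normal equations determine the regression coefficients. -/
lemma lpCoef_eq {n h : ℕ} {y : ℕ → ℝ} {β γ : ℝ}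
    (h0 : ∑ t ∈ Finset.Icc 1 (n - h), (y (t + h) - β * y t - γ * y (t - 1)) * y t = 0)
    (h1 : ∑ t ∈ Finset.Icc 1 (n - h), (y (t + h) - β * y t - γ * y (t - 1)) * y (t - 1) = 0)
    (hdet : (∑ t ∈ Finset.Icc 1 (n - h), y t ^ 2) * (∑ t ∈ Finset.Icc 1 (n - h), y (t - 1) ^ 2) -
      (∑ t ∈ Finset.Icc 1 (n - h), y t * y (t - 1)) ^ 2 ≠ 0) :
    lpCoef n h y = ![β, γ] := by
  set A : Matrix (Fin 2) (Fin 2) ℝ :=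
    ∑ t ∈ Finset.Icc 1 (n - h), Matrix.vecMulVec (regressor y t) (regressor y t) with hA
  have a00 : A 0 0 = ∑ t ∈ Finset.Icc 1 (n - h), y t ^ 2 := by
    rw [hA, Matrix.sum_apply]
    simp [Matrix.vecMulVec_apply, regressor, sq]
  have a01 : A 0 1 = ∑ t ∈ Finset.Icc 1 (n - h), y t * y (t - 1) := by
    rw [hA, Matrix.sum_apply]
    simp [Matrix.vecMulVec_apply, regressor]
  have a10 : A 1 0 = ∑ t ∈ Finset.Icc 1 (n - h), y t * y (t - 1) := by
    rw [hA, Matrix.sum_apply]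
    simp [Matrix.vecMulVec_apply, regressor, mul_comm]
  have a11 : A 1 1 = ∑ t ∈ Finset.Icc 1 (n - h), y (t - 1) ^ 2 := by
    rw [hA, Matrix.sum_apply]
    simp [Matrix.vecMulVec_apply, regressor, sq]
  have hdet' : IsUnit A.det := by
    rw [isUnit_iff_ne_zero, Matrix.det_fin_two, a00, a01, a10, a11, ← sq]
    exact hdet
  have hrhs : ∑ t ∈ Finset.Icc 1 (n - h), y (t + h) • regressor y t = A *ᵥ ![β, γ] := by
    ext i
    rw [Finset.sum_apply, Matrix.mulVec, dotProduct, Fin.sum_univ_two]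
    fin_cases i
    · simp only [Fin.zero_eta, Fin.isValue, a00, a01]
      rw [← sub_eq_zero, ← h0]
      simp [regressor, Finset.sum_mul, ← Finset.sum_add_distrib, ← Finset.sum_sub_distrib]
      exact Finset.sum_congr rfl fun t _ => by ring
    · simp only [Fin.mk_one, Fin.isValue, a10, a11]
      rw [← sub_eq_zero, ← h1]
      simp [regressor, Finset.sum_mul, ← Finset.sum_add_distrib, ← Finset.sum_sub_distrib]
      exact Finset.sum_congr rfl fun t _ => by ring
  rw [lpCoef, hrhs, ← hA, Matrix.mulVec_mulVec, Matrix.nonsing_inv_mul A hdet', Matrix.one_mulVec]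

/-- The residual of the regression of `u` on `q` over the dates `i < T`. -/
noncomputable def partialOut (T : ℕ) (u q : ℕ → ℝ) (i : ℕ) : ℝ :=
  u i - (∑ j ∈ Finset.range T, u j * q j) / (∑ j ∈ Finset.range T, q j ^ 2) * q i

/-- The residual of the regression of `ξ` on `u` and `q` over the dates `i < T`. -/
noncomputable def regResidual (T : ℕ) (ξ u q : ℕ → ℝ) (i : ℕ) : ℝ :=
  ξ i - (∑ j ∈ Finset.range T, ξ j * partialOut T u q j) /
      (∑ j ∈ Finset.range T, partialOut T u q j ^ 2) * partialOut T u q i -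
    (∑ j ∈ Finset.range T, ξ j * q j) / (∑ j ∈ Finset.range T, q j ^ 2) * q i

lemma sum_partialOut_mul {T : ℕ} {u q : ℕ → ℝ} (hD : 0 < ∑ j ∈ Finset.range T, q j ^ 2) :
    ∑ i ∈ Finset.range T, partialOut T u q i * q i = 0 := by
  simp only [partialOut, sub_mul, Finset.sum_sub_distrib, mul_assoc, ← Finset.mul_sum, ← sq]
  rw [div_mul_cancel₀ _ hD.ne', sub_self]

/-- Since the partialled-out u is orthogonal to q, the two-variable regression splits into two
one-variable ones. -/
lemma sum_regResidual_mul {T : ℕ} {ξ u q : ℕ → ℝ} (hD : 0 < ∑ j ∈ Finset.range T, q j ^ 2)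
    (hE : 0 < ∑ j ∈ Finset.range T, partialOut T u q j ^ 2) :
    ∑ i ∈ Finset.range T, regResidual T ξ u q i * q i = 0 ∧
      ∑ i ∈ Finset.range T, regResidual T ξ u q i * partialOut T u q i = 0 := by
  have h0 := sum_partialOut_mul (u := u) hD
  have h0' : ∑ i ∈ Finset.range T, q i * partialOut T u q i = 0 := by
    rw [← h0]; exact Finset.sum_congr rfl fun i _ => mul_comm _ _
  constructor
  · simp only [regResidual, sub_mul, Finset.sum_sub_distrib, mul_assoc, ← Finset.mul_sum, ← sq, h0]
    rw [div_mul_cancel₀ _ hD.ne']; ring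
  · simp only [regResidual, sub_mul, Finset.sum_sub_distrib, mul_assoc, ← Finset.mul_sum, ← sq, h0']
    rw [div_mul_cancel₀ _ hE.ne']; ring

/-- Frisch–Waugh–Lovell form of the root. -/
lemma root_eq_of_pos {n h : ℕ} {ρ : ℝ} {w : Fin n → ℝ} {ξ u : ℕ → ℝ}
    (hu : ∀ i < n - h, path ρ w (i + 1) = ρ * path ρ w i + u i)
    (hξ : ∀ i < n - h, path ρ w (i + 1 + h) = ρ ^ h * path ρ w (i + 1) + ξ i)
    (hD : 0 < ∑ j ∈ Finset.range (n - h), path ρ w j ^ 2)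
    (hE : 0 < ∑ j ∈ Finset.range (n - h), partialOut (n - h) u (path ρ w) j ^ 2) :
    root n h ρ w = (∑ i ∈ Finset.range (n - h), ξ i * partialOut (n - h) u (path ρ w) i) /
      √(∑ i ∈ Finset.range (n - h),
        (regResidual (n - h) ξ u (path ρ w) i * partialOut (n - h) u (path ρ w) i) ^ 2) := by
  set q := path ρ w
  set T := n - h
  set D := ∑ j ∈ Finset.range T, q j ^ 2 with hDdef
  set U := partialOut T u q with hU
  set E := ∑ j ∈ Finset.range T, U j ^ 2 with hEdef
  set d := (∑ j ∈ Finset.range T, u j * q j) / D with hd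
  have hUi : ∀ i, U i = u i - d * q i := fun i => rfl
  -- The regressors (y_t, y_{t-1}) and (U, q) are related by a unitriangular change of basis. Hence
  -- the Gram determinant is `E * D`, and ρ + d is the least squares estimate of ρ.
  have hpU : ∀ i < T, q (i + 1) = U i + (ρ + d) * q i := fun i hi => by rw [hu i hi, hUi]; ring
  have hUq : ∑ i ∈ Finset.range T, U i * q i = 0 := sum_partialOut_mul hD
  obtain ⟨hrq, hrU⟩ := sum_regResidual_mul (ξ := ξ) hD hE
  set b := (∑ j ∈ Finset.range T, ξ j * U j) / E with hb
  set κ := (∑ j ∈ Finset.range T, ξ j * q j) / D with hκ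
  set e := regResidual T ξ u q with he
  have hei : ∀ i, e i = ξ i - b * U i - κ * q i := fun i => rfl
  have hpq : ∑ i ∈ Finset.range T, q (i + 1) * q i = (ρ + d) * D := by
    have : ∑ i ∈ Finset.range T, q (i + 1) * q i =
        ∑ i ∈ Finset.range T, U i * q i + (ρ + d) * D := by
      rw [hDdef, Finset.mul_sum, ← Finset.sum_add_distrib]
      exact Finset.sum_congr rfl fun i hi => by rw [hpU i (Finset.mem_range.1 hi)]; ring
    rw [this, hUq, zero_add]
  have hpp : ∑ i ∈ Finset.range T, q (i + 1) ^ 2 = E + (ρ + d) ^ 2 * D := by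
    have : ∑ i ∈ Finset.range T, q (i + 1) ^ 2 =
        E + 2 * (ρ + d) * ∑ i ∈ Finset.range T, U i * q i + (ρ + d) ^ 2 * D := by
      rw [hDdef, hEdef, Finset.mul_sum, Finset.mul_sum, ← Finset.sum_add_distrib,
        ← Finset.sum_add_distrib]
      exact Finset.sum_congr rfl fun i hi => by rw [hpU i (Finset.mem_range.1 hi)]; ring
    rw [this, hUq, mul_zero, add_zero]
  have hres : ∀ i < T, q (i + 1 + h) - (ρ ^ h + b) * q (i + 1) - (κ - b * (ρ + d)) * q i = e i :=
    fun i hi => by rw [hξ i hi, hei, hpU i hi]; ring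
  have hcoef : lpCoef n h q = ![ρ ^ h + b, κ - b * (ρ + d)] := by
    refine lpCoef_eq ?_ ?_ ?_
    · rw [sum_Icc_one_eq (fun t => (q (t + h) - (ρ ^ h + b) * q t - (κ - b * (ρ + d)) * q (t - 1)) * q t)]
      have : ∑ i ∈ Finset.range T, (q (i + 1 + h) - (ρ ^ h + b) * q (i + 1) -
          (κ - b * (ρ + d)) * q (i + 1 - 1)) * q (i + 1) =
          ∑ i ∈ Finset.range T, e i * U i + (ρ + d) * ∑ i ∈ Finset.range T, e i * q i := by
        rw [Finset.mul_sum, ← Finset.sum_add_distrib]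
        refine Finset.sum_congr rfl fun i hi => ?_
        rw [Nat.add_sub_cancel, hres i (Finset.mem_range.1 hi), hpU i (Finset.mem_range.1 hi)]; ring
      rw [this, hrU, hrq]; ring
    · rw [sum_Icc_one_eq
        (fun t => (q (t + h) - (ρ ^ h + b) * q t - (κ - b * (ρ + d)) * q (t - 1)) * q (t - 1)), ← hrq]
      refine Finset.sum_congr rfl fun i hi => ?_
      rw [Nat.add_sub_cancel, hres i (Finset.mem_range.1 hi)]
    · rw [sum_Icc_one_eq (fun t => q t ^ 2), sum_Icc_one_eq (fun t => q (t - 1) ^ 2),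
        sum_Icc_one_eq (fun t => q t * q (t - 1))]
      simp only [Nat.add_sub_cancel]
      rw [hpp, hpq, ← hDdef]
      have : (E + (ρ + d) ^ 2 * D) * D - ((ρ + d) * D) ^ 2 = E * D := by ring
      rw [this]
      exact (mul_pos hE hD).ne'
  have hβ : betaHat n h q = ρ ^ h + b := by simp [betaHat, hcoef]
  have hγ : gammaHat n h q = κ - b * (ρ + d) := by simp [gammaHat, hcoef]
  have hρ : rhoHat n h q = ρ + d := by
    rw [rhoHat, sum_Icc_one_eq (fun t => q (t - 1) ^ 2), sum_Icc_one_eq (fun t => q t * q (t - 1))]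
    simp only [Nat.add_sub_cancel]
    rw [hpq, ← hDdef]
    field_simp
  have huh : ∀ i < T, uHat n h q (i + 1) = U i := fun i hi => by
    rw [uHat, hρ, Nat.add_sub_cancel, hpU i hi]; ring
  have hxh : ∀ i < T, xiHat n h q (i + 1) = e i := fun i hi => by
    rw [xiHat, hβ, hγ, Nat.add_sub_cancel, hres i hi]
  have hs : sHat n h q = √(∑ i ∈ Finset.range T, (e i * U i) ^ 2) / E := by
    rw [sHat, sum_Icc_one_eq (fun t => uHat n h q t ^ 2),
      sum_Icc_one_eq (fun t => xiHat n h q t ^ 2 * uHat n h q t ^ 2)]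
    have h1 : ∑ i ∈ Finset.range T, uHat n h q (i + 1) ^ 2 = E :=
      Finset.sum_congr rfl fun i hi => by rw [huh i (Finset.mem_range.1 hi)]
    have h2 : ∑ i ∈ Finset.range T, xiHat n h q (i + 1) ^ 2 * uHat n h q (i + 1) ^ 2 =
        ∑ i ∈ Finset.range T, (e i * U i) ^ 2 :=
      Finset.sum_congr rfl fun i hi => by
        rw [huh i (Finset.mem_range.1 hi), hxh i (Finset.mem_range.1 hi), mul_pow]
    rw [h1, h2, div_eq_mul_inv]
    nth_rewrite 3 [← Real.mul_self_sqrt hE.le]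
    rw [mul_inv]; ring
  rw [root, hβ, hs, impulseResponse, add_sub_cancel_left, hb, div_div_div_cancel_right₀ hE.ne']

lemma abs_sqrt_sub_one_le {t : ℝ} (ht : 0 ≤ t) : |√t - 1| ≤ |t - 1| := by
  have h1 : t - 1 = (√t - 1) * (√t + 1) := by
    have := Real.mul_self_sqrt ht
    linarith
  rw [h1, abs_mul, abs_of_pos (by positivity : 0 < √t + 1)]
  nlinarith [abs_nonneg (√t - 1), Real.sqrt_nonneg t]

lemma sub_pow_four_le (x y : ℝ) : (x - y) ^ 4 ≤ 8 * x ^ 4 + 8 * y ^ 4 := by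
  have h := pow_le_pow_left₀ (sq_nonneg (x - y))
    (show (x - y) ^ 2 ≤ 2 * x ^ 2 + 2 * y ^ 2 by nlinarith [sq_nonneg (x + y)]) 2
  nlinarith [sq_nonneg (x ^ 2 - y ^ 2)]

/-- The bounds on the sample moments that make the regression errors negligible. -/
structure GoodSample (T : ℕ) (ξ u q : ℕ → ℝ) (A G g r : ℝ) : Prop where
  uq : (∑ i ∈ Finset.range T, u i * q i) ^ 2 ≤ A * T * G
  xiq : (∑ i ∈ Finset.range T, ξ i * q i) ^ 2 ≤ A * r * T ^ 2 * g * G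
  q2 : T * G ≤ A * ∑ i ∈ Finset.range T, q i ^ 2
  u2 : T ≤ A * ∑ i ∈ Finset.range T, u i ^ 2
  xi2q2 : ∑ i ∈ Finset.range T, ξ i ^ 2 * q i ^ 2 ≤ A * T * g * G
  u2q2 : ∑ i ∈ Finset.range T, u i ^ 2 * q i ^ 2 ≤ A * T * G
  u4 : ∑ i ∈ Finset.range T, u i ^ 4 ≤ A * T
  q4 : ∑ i ∈ Finset.range T, q i ^ 4 ≤ A * T * G ^ 2
  xiu : (∑ i ∈ Finset.range T, ξ i * u i) ^ 2 ≤ A * T * g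

set_option maxHeartbeats 1000000 in
-- Up to powers of A, the auxiliary coefficients satisfy d² ≲ 1/(TG), κ² ≲ rg/G and b² ≲ g/T. Both
-- replacement errors are therefore a fraction r of Tg, the order of the squared score.
lemma GoodSample.bounds {T : ℕ} {ξ u q : ℕ → ℝ} {A G g r : ℝ} (H : GoodSample T ξ u q A G g r)
    (hT : 1 ≤ T) (hA : 1 ≤ A) (hG : 0 < G) (hg : 0 < g) (hr : 1 ≤ r * T)
    (hrA : r * (2 * A ^ 3) ≤ 1) :
    0 < ∑ i ∈ Finset.range T, q i ^ 2 ∧ 0 < ∑ i ∈ Finset.range T, partialOut T u q i ^ 2 ∧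
      (∑ i ∈ Finset.range T, ξ i * u i - ∑ i ∈ Finset.range T, ξ i * partialOut T u q i) ^ 2 ≤
        A ^ 4 * r * T * g ∧
      ∑ i ∈ Finset.range T, (ξ i * u i - regResidual T ξ u q i * partialOut T u q i) ^ 2 ≤
        800 * A ^ 13 * r * T * g := by
  have hA0 : 0 < A := by linarith
  have hN : (0 : ℝ) < T := by exact_mod_cast hT
  set N : ℝ := (T : ℝ)
  have hr0 : 0 < r := by
    by_contra hcon
    nlinarith [mul_nonneg (not_lt.1 hcon |> neg_nonneg.2) hN.le]
  have hr1 : r ≤ 1 := by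
    have : (1 : ℝ) ≤ A ^ 3 := one_le_pow₀ hA
    nlinarith
  -- Smallness of r together with rT ≥ 1 forces T to be large; this keeps the sum of U² within a
  -- factor 2 of the lower bound for the sum of u².
  have hNA : 2 * A ^ 3 ≤ N := by
    have h1 : r * (2 * A ^ 3) ≤ r * N := hrA.trans hr
    exact le_of_mul_le_mul_left h1 hr0
  have hN1 : 1 ≤ N := by
    have : (1 : ℝ) ≤ A ^ 3 := one_le_pow₀ hA
    linarith
  set D := ∑ i ∈ Finset.range T, q i ^ 2 with hD
  set U := partialOut T u q with hU
  set E := ∑ i ∈ Finset.range T, U i ^ 2 with hE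
  set Suq := ∑ i ∈ Finset.range T, u i * q i with hSuq
  set Sxq := ∑ i ∈ Finset.range T, ξ i * q i with hSxq
  set d := Suq / D with hd
  set κ := Sxq / D with hκ
  have hDlow : N * G / A ≤ D := by rw [div_le_iff₀ hA0]; linarith [H.q2]
  have hNGA : 0 < N * G / A := by positivity
  have hD0 : 0 < D := hNGA.trans_le hDlow
  have hd2 : d ^ 2 ≤ A ^ 3 / (N * G) := by
    rw [hd, div_pow]
    calc Suq ^ 2 / D ^ 2 ≤ A * N * G / (N * G / A) ^ 2 :=
          div_le_div₀ (by positivity) H.uq (by positivity) (pow_le_pow_left₀ hNGA.le hDlow 2)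
      _ = _ := by field_simp
  have hκ2 : κ ^ 2 ≤ A ^ 3 * r * g / G := by
    rw [hκ, div_pow]
    calc Sxq ^ 2 / D ^ 2 ≤ A * r * N ^ 2 * g * G / (N * G / A) ^ 2 :=
          div_le_div₀ (by positivity) H.xiq (by positivity) (pow_le_pow_left₀ hNGA.le hDlow 2)
      _ = _ := by field_simp
  have hUi : ∀ i, U i = u i - d * q i := fun i => rfl
  have ha : ∑ i ∈ Finset.range T, ξ i * u i - ∑ i ∈ Finset.range T, ξ i * U i = d * Sxq := by
    rw [hSxq, Finset.mul_sum, ← Finset.sum_sub_distrib]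
    exact Finset.sum_congr rfl fun i _ => by rw [hUi]; ring
  have ha2 : (d * Sxq) ^ 2 ≤ A ^ 4 * r * N * g := by
    rw [mul_pow]
    calc d ^ 2 * Sxq ^ 2 ≤ A ^ 3 / (N * G) * (A * r * N ^ 2 * g * G) :=
          mul_le_mul hd2 H.xiq (sq_nonneg _) (by positivity)
      _ = _ := by field_simp
  have hE1 : E = ∑ i ∈ Finset.range T, u i ^ 2 - Suq ^ 2 / D := by
    have h1 : E = ∑ i ∈ Finset.range T, u i ^ 2 - 2 * d * Suq + d ^ 2 * D := by
      rw [hE, hSuq, hD, Finset.mul_sum, Finset.mul_sum, ← Finset.sum_sub_distrib,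
        ← Finset.sum_add_distrib]
      exact Finset.sum_congr rfl fun i _ => by rw [hUi]; ring
    rw [h1, hd]; field_simp; ring
  have hElow : N / (2 * A) ≤ E := by
    have h1 : N / A ≤ ∑ i ∈ Finset.range T, u i ^ 2 := by
      rw [div_le_iff₀ hA0]; linarith [H.u2]
    have h2 : Suq ^ 2 / D ≤ A ^ 2 :=
      calc Suq ^ 2 / D ≤ A * N * G / (N * G / A) :=
            div_le_div₀ (by positivity) H.uq (by positivity) hDlow
        _ = _ := by field_simp
    have h3 : A ^ 2 ≤ N / (2 * A) := by rw [le_div_iff₀ (by positivity)]; linarith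
    have h4 : N / A = N / (2 * A) + N / (2 * A) := by field_simp; ring
    rw [hE1]; linarith
  have hNA0 : 0 < N / (2 * A) := by positivity
  have hE0 : 0 < E := hNA0.trans_le hElow
  refine ⟨hD0, hE0, by rw [ha]; exact ha2, ?_⟩
  set SxU := ∑ i ∈ Finset.range T, ξ i * U i with hSxU
  set b := SxU / E with hb
  have hAA : ∀ {j k : ℕ}, j ≤ k → A ^ j ≤ A ^ k := fun h => pow_le_pow_right₀ hA h
  have hSxU2 : SxU ^ 2 ≤ 4 * A ^ 4 * N * g := by
    have h1 : SxU = ∑ i ∈ Finset.range T, ξ i * u i - d * Sxq := by rw [← ha]; ring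
    have h2 : SxU ^ 2 ≤ 2 * (∑ i ∈ Finset.range T, ξ i * u i) ^ 2 + 2 * (d * Sxq) ^ 2 := by
      rw [h1]; nlinarith [sq_nonneg (∑ i ∈ Finset.range T, ξ i * u i + d * Sxq)]
    have h3 : A * N * g ≤ A ^ 4 * N * g := by
      have := hAA (show 1 ≤ 4 by norm_num)
      rw [pow_one] at this
      gcongr
    have h4 : A ^ 4 * r * N * g ≤ A ^ 4 * 1 * N * g := by gcongr
    linarith [H.xiu]
  have hb2 : b ^ 2 ≤ 16 * A ^ 6 * g / N := by
    rw [hb, div_pow]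
    calc SxU ^ 2 / E ^ 2 ≤ 4 * A ^ 4 * N * g / (N / (2 * A)) ^ 2 :=
          div_le_div₀ (by positivity) hSxU2 (by positivity) (pow_le_pow_left₀ hNA0.le hElow 2)
      _ = _ := by field_simp; ring
  have hU4 : ∑ i ∈ Finset.range T, U i ^ 4 ≤ 16 * A ^ 7 * N := by
    have h1 : ∑ i ∈ Finset.range T, U i ^ 4 ≤
        8 * ∑ i ∈ Finset.range T, u i ^ 4 + 8 * (d ^ 2) ^ 2 * ∑ i ∈ Finset.range T, q i ^ 4 := by
      rw [Finset.mul_sum, Finset.mul_sum, ← Finset.sum_add_distrib]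
      refine Finset.sum_le_sum fun i _ => ?_
      rw [hUi]
      exact (sub_pow_four_le (u i) (d * q i)).trans (le_of_eq (by ring))
    have h2 : (d ^ 2) ^ 2 * ∑ i ∈ Finset.range T, q i ^ 4 ≤ (A ^ 3 / (N * G)) ^ 2 * (A * N * G ^ 2) :=
      mul_le_mul (pow_le_pow_left₀ (sq_nonneg _) hd2 2) H.q4
        (Finset.sum_nonneg fun i _ => by positivity) (by positivity)
    have h3 : (A ^ 3 / (N * G)) ^ 2 * (A * N * G ^ 2) = A ^ 7 / N := by field_simp
    have h4 : A ^ 7 / N ≤ A ^ 7 * N := by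
      rw [div_le_iff₀ hN, mul_assoc]
      exact le_mul_of_one_le_right (by positivity) (by nlinarith)
    have h5 : A * N ≤ A ^ 7 * N := by
      have := hAA (show 1 ≤ 7 by norm_num)
      rw [pow_one] at this
      gcongr
    linarith [H.u4]
  have hq2U2 : ∑ i ∈ Finset.range T, q i ^ 2 * U i ^ 2 ≤ 4 * A ^ 4 * N * G := by
    have h1 : ∑ i ∈ Finset.range T, q i ^ 2 * U i ^ 2 ≤
        2 * ∑ i ∈ Finset.range T, u i ^ 2 * q i ^ 2 + 2 * (d ^ 2 * ∑ i ∈ Finset.range T, q i ^ 4) := by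
      rw [Finset.mul_sum, Finset.mul_sum, Finset.mul_sum, ← Finset.sum_add_distrib]
      refine Finset.sum_le_sum fun i _ => ?_
      rw [hUi]
      nlinarith [mul_nonneg (sq_nonneg (q i)) (sq_nonneg (u i + d * q i))]
    have h2 : d ^ 2 * ∑ i ∈ Finset.range T, q i ^ 4 ≤ A ^ 3 / (N * G) * (A * N * G ^ 2) :=
      mul_le_mul hd2 H.q4 (Finset.sum_nonneg fun i _ => by positivity) (by positivity)
    have h3 : A ^ 3 / (N * G) * (A * N * G ^ 2) = A ^ 4 * 1 * G := by field_simp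
    have h4 : A ^ 4 * 1 * G ≤ A ^ 4 * N * G := by gcongr
    have h5 : A * N * G ≤ A ^ 4 * N * G := by
      have := hAA (show 1 ≤ 4 by norm_num)
      rw [pow_one] at this
      gcongr
    linarith [H.u2q2]
  -- The error splits into three terms, one for each estimated coefficient.
  have hw : ∀ i, ξ i * u i - regResidual T ξ u q i * U i =
      d * (ξ i * q i) + b * U i ^ 2 + κ * (q i * U i) := fun i => by
    have : regResidual T ξ u q i = ξ i - b * U i - κ * q i := rfl
    rw [this]
    have := hUi i
    have h2 : u i = U i + d * q i := by linarith
    rw [h2]; ring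
  have h3 : ∀ x y z : ℝ, (x + y + z) ^ 2 ≤ 3 * (x ^ 2 + y ^ 2 + z ^ 2) := fun x y z => by
    nlinarith [sq_nonneg (x - y), sq_nonneg (y - z), sq_nonneg (x - z)]
  have hsum : ∑ i ∈ Finset.range T, (ξ i * u i - regResidual T ξ u q i * U i) ^ 2 ≤
      3 * (d ^ 2 * ∑ i ∈ Finset.range T, ξ i ^ 2 * q i ^ 2 + b ^ 2 * ∑ i ∈ Finset.range T, U i ^ 4 +
        κ ^ 2 * ∑ i ∈ Finset.range T, q i ^ 2 * U i ^ 2) := by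
    rw [Finset.mul_sum, Finset.mul_sum, Finset.mul_sum, ← Finset.sum_add_distrib,
      ← Finset.sum_add_distrib, Finset.mul_sum]
    refine Finset.sum_le_sum fun i _ => ?_
    rw [hw]
    refine (h3 _ _ _).trans (le_of_eq ?_)
    ring
  -- The first two terms are of order g with no factor r; 1 ≤ rN brings them to the common form. The
  -- third carries r through κ².
  have t1 : d ^ 2 * ∑ i ∈ Finset.range T, ξ i ^ 2 * q i ^ 2 ≤ A ^ 13 * (r * N) * g :=
    calc _ ≤ A ^ 3 / (N * G) * (A * N * g * G) :=
          mul_le_mul hd2 H.xi2q2 (Finset.sum_nonneg fun i _ => by positivity) (by positivity)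
      _ = A ^ 4 * 1 * g := by field_simp
      _ ≤ A ^ 13 * (r * N) * g := by
        have := hAA (show 4 ≤ 13 by norm_num)
        gcongr
  have t2 : b ^ 2 * ∑ i ∈ Finset.range T, U i ^ 4 ≤ 256 * (A ^ 13 * (r * N) * g) :=
    calc _ ≤ 16 * A ^ 6 * g / N * (16 * A ^ 7 * N) :=
          mul_le_mul hb2 hU4 (Finset.sum_nonneg fun i _ => by positivity) (by positivity)
      _ = 256 * (A ^ 13 * 1 * g) := by field_simp; ring
      _ ≤ _ := by gcongr
  have t3 : κ ^ 2 * ∑ i ∈ Finset.range T, q i ^ 2 * U i ^ 2 ≤ 4 * (A ^ 13 * (r * N) * g) :=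
    calc _ ≤ A ^ 3 * r * g / G * (4 * A ^ 4 * N * G) :=
          mul_le_mul hκ2 hq2U2 (Finset.sum_nonneg fun i _ => by positivity) (by positivity)
      _ = 4 * (A ^ 7 * (r * N) * g) := by field_simp
      _ ≤ _ := by
        have := hAA (show 7 ≤ 13 by norm_num)
        gcongr
  have : 0 ≤ A ^ 13 * (r * N) * g := by positivity
  refine hsum.trans ?_
  have e : 800 * A ^ 13 * r * N * g = 800 * (A ^ 13 * (r * N) * g) := by ring
  rw [e]; linarith

/-- The studentised score is a small perturbation of the normalised infeasible score. -/
lemma GoodSample.ratio {T : ℕ} {ξ u q : ℕ → ℝ} {A G g r v δ : ℝ} (H : GoodSample T ξ u q A G g r)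
    (hT : 1 ≤ T) (hA : 1 ≤ A) (hG : 0 < G) (hg : 0 < g) (hr : 1 ≤ r * T)
    (hrA : r * (2 * A ^ 3) ≤ 1) (hv : 0 < v) (hδ : 0 < δ) (hδ2 : δ ≤ 1 / 2)
    (hrδ : r * (3200 * A ^ 13 * (1 + 4 / δ)) ≤ δ * v ^ 2)
    (hlln : |∑ i ∈ Finset.range T, (ξ i * u i) ^ 2 - T * (v ^ 2 * g)| ≤ δ / 4 * (T * (v ^ 2 * g))) :
    ∃ a B : ℝ, |a| ≤ δ ∧ |B - 1| ≤ δ ∧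
      (∑ i ∈ Finset.range T, ξ i * partialOut T u q i) /
        √(∑ i ∈ Finset.range T, (regResidual T ξ u q i * partialOut T u q i) ^ 2) =
      ((∑ i ∈ Finset.range T, ξ i * u i) / (v * √(T * g)) - a) / B := by
  obtain ⟨-, -, ha, hw⟩ := H.bounds hT hA hG hg hr hrA
  have hN : (0 : ℝ) < T := by exact_mod_cast hT
  set N : ℝ := (T : ℝ)
  have hA0 : 0 < A := by linarith
  have hr0 : 0 < r := by
    by_contra hcon
    nlinarith [mul_nonneg (not_lt.1 hcon |> neg_nonneg.2) hN.le]
  set s := v * √(N * g) with hs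
  have hs0 : 0 < s := by positivity
  have hs2 : s ^ 2 = N * (v ^ 2 * g) := by
    rw [hs, mul_pow, Real.sq_sqrt (by positivity)]; ring
  set Sxu := ∑ i ∈ Finset.range T, ξ i * u i with hSxu
  set SxU := ∑ i ∈ Finset.range T, ξ i * partialOut T u q i with hSxU
  set F := ∑ i ∈ Finset.range T, (regResidual T ξ u q i * partialOut T u q i) ^ 2 with hF
  set X := ∑ i ∈ Finset.range T, (ξ i * u i) ^ 2 with hX
  set W := ∑ i ∈ Finset.range T, (ξ i * u i - regResidual T ξ u q i * partialOut T u q i) ^ 2 with hW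
  -- Here a is the normalised change of the numerator and B is the ratio of the feasible to the
  -- infeasible standard deviation.
  refine ⟨(Sxu - SxU) / s, √F / s, ?_, ?_, ?_⟩
  · refine abs_le_of_sq_le_sq ?_ hδ.le
    rw [div_pow, div_le_iff₀ (by positivity), hs2]
    refine ha.trans ?_
    have h1 : r * A ^ 4 ≤ δ * v ^ 2 * (δ / 4) := by
      have h2 : A ^ 4 ≤ A ^ 13 := pow_le_pow_right₀ hA (by norm_num)
      have h3 : r * (3200 * A ^ 13 * (1 + 4 / δ)) * (δ / 4) ≤ δ * v ^ 2 * (δ / 4) :=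
        mul_le_mul_of_nonneg_right hrδ (by positivity)
      have h4 : r * (3200 * A ^ 13 * (1 + 4 / δ)) * (δ / 4) = r * A ^ 13 * (800 * δ + 3200) := by
        field_simp
        ring
      have h5 : r * A ^ 4 ≤ r * A ^ 13 := by gcongr
      have h6 : 0 ≤ r * A ^ 13 := by positivity
      nlinarith
    have h2 : r * A ^ 4 * (N * g) ≤ δ * v ^ 2 * (δ / 4) * (N * g) := by gcongr
    have h3 : 0 ≤ δ ^ 2 * v ^ 2 * (N * g) := by positivity
    nlinarith
  · have hW2 : (1 + 4 / δ) * W ≤ δ / 4 * s ^ 2 := by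
      have h1 : (1 + 4 / δ) * W ≤ (1 + 4 / δ) * (800 * A ^ 13 * r * N * g) := by gcongr
      have h2 : r * (3200 * A ^ 13 * (1 + 4 / δ)) * (N * g / 4) ≤ δ * v ^ 2 * (N * g / 4) := by gcongr
      rw [hs2]
      calc _ ≤ _ := h1
        _ = r * (3200 * A ^ 13 * (1 + 4 / δ)) * (N * g / 4) := by ring
        _ ≤ _ := h2
        _ = _ := by ring
    -- Young's inequality with weight δ/4 compares the feasible and infeasible sums of squares; the
    -- large factor 1 + 4/δ falls on W, which is small through r.
    have hup : F ≤ (1 + δ / 4) * X + (1 + 4 / δ) * W := by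
      rw [hF, hX, hW, Finset.mul_sum, Finset.mul_sum, ← Finset.sum_add_distrib]
      refine Finset.sum_le_sum fun i _ => ?_
      set f := regResidual T ξ u q i * partialOut T u q i
      set x := ξ i * u i
      have h1 : (1 + δ / 4) * x ^ 2 + (1 + 4 / δ) * (x - f) ^ 2 - f ^ 2 =
          (δ / 4) * (x + 4 / δ * (x - f)) ^ 2 := by field_simp; ring
      have h2 : 0 ≤ (δ / 4) * (x + 4 / δ * (x - f)) ^ 2 := by positivity
      linarith
    have hlo : (1 - δ / 4) * X - (1 + 4 / δ) * W ≤ F := by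
      rw [hF, hX, hW, Finset.mul_sum, Finset.mul_sum, ← Finset.sum_sub_distrib]
      refine Finset.sum_le_sum fun i _ => ?_
      set f := regResidual T ξ u q i * partialOut T u q i
      set x := ξ i * u i
      have h1 : f ^ 2 - ((1 - δ / 4) * x ^ 2 - (1 + 4 / δ) * (x - f) ^ 2) =
          (δ / 4) * (x - 4 / δ * (x - f)) ^ 2 + 2 * (x - f) ^ 2 := by field_simp; ring
      have h2 : 0 ≤ (δ / 4) * (x - 4 / δ * (x - f)) ^ 2 + 2 * (x - f) ^ 2 := by positivity
      linarith
    rw [← hs2] at hlln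
    obtain ⟨hl1, hl2⟩ := abs_le.1 hlln
    have hFs : √F / s = √(F / s ^ 2) := by
      rw [Real.sqrt_div' _ (by positivity), Real.sqrt_sq hs0.le]
    rw [hFs]
    refine (abs_sqrt_sub_one_le (div_nonneg (Finset.sum_nonneg fun i _ => sq_nonneg _)
      (sq_nonneg s))).trans ?_
    have hs20 : 0 < s ^ 2 := by positivity
    have hX2 : X ≤ 2 * s ^ 2 := by nlinarith
    rw [abs_le, le_sub_iff_add_le, le_div_iff₀ hs20, sub_le_iff_le_add, div_le_iff₀ hs20]
    have h8 : δ / 4 * X ≤ δ / 4 * (2 * s ^ 2) := by gcongr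
    have h9 : 0 ≤ δ * s ^ 2 := by positivity
    constructor <;> nlinarith
  · rw [← sub_div, div_div_div_cancel_right₀ hs0.ne', sub_sub_cancel]

end LocalProjection

/-! ### Second moments of the sample sums and growth of the gain -/

namespace LocalProjection

/-- Cauchy–Schwarz over the lead j: the sum is a combination of h sums Σ q_i u_{i+1+j} with weights
ρ^{h-1-j}, whose squares add up to `gain ρ h`. Each of these h sums is a forward martingale
transform when q is the level. -/
lemma sq_sum_blk_mul_le {Ω : Type*} (ρ : ℝ) (u : ℕ → Ω → ℝ) (q : ℕ → ℝ) (h T : ℕ) (ω : Ω) :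
    (∑ i ∈ Finset.range T, blk ρ u h (i + 1) ω * q i) ^ 2 ≤
      gain ρ h * ∑ j ∈ Finset.range h, (∑ i ∈ Finset.range T, q i * u (i + (1 + j)) ω) ^ 2 := by
  induction h with
  | zero => simp [blk, gain]
  | succ h ih =>
    set X := ∑ i ∈ Finset.range T, blk ρ u h (i + 1) ω * q i
    set Q := ∑ j ∈ Finset.range h, (∑ i ∈ Finset.range T, q i * u (i + (1 + j)) ω) ^ 2
    rw [Finset.sum_range_succ]
    set m := ∑ i ∈ Finset.range T, q i * u (i + (1 + h)) ω with hm
    have e : ∑ i ∈ Finset.range T, blk ρ u (h + 1) (i + 1) ω * q i = ρ * X + m := by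
      rw [Finset.mul_sum, hm, ← Finset.sum_add_distrib]
      refine Finset.sum_congr rfl fun i _ => ?_
      simp only [blk, add_assoc]; ring
    rw [e]
    have hg := gain_nonneg ρ h
    simp only [gain]
    have hQ : 0 ≤ Q := Finset.sum_nonneg fun _ _ => sq_nonneg _
    rcases hg.eq_or_lt with h0 | h0
    · rw [← h0, zero_mul] at ih
      have : X = 0 := by nlinarith
      rw [this, ← h0]; nlinarith
    · have h1 : 2 * (ρ * X) * m ≤ ρ ^ 2 * gain ρ h * m ^ 2 + X ^ 2 / gain ρ h := by
        have h2 : ρ ^ 2 * gain ρ h * m ^ 2 + X ^ 2 / gain ρ h - 2 * (ρ * X) * m =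
            gain ρ h * (ρ * m - X / gain ρ h) ^ 2 := by
          field_simp; ring
        have : 0 ≤ gain ρ h * (ρ * m - X / gain ρ h) ^ 2 := by positivity
        linarith
      have h2 : X ^ 2 / gain ρ h ≤ Q := by rw [div_le_iff₀ h0]; linarith
      have h3 : ρ ^ 2 * X ^ 2 ≤ ρ ^ 2 * (gain ρ h * Q) := by gcongr
      nlinarith

variable {Ω : Type*} [mΩ : MeasurableSpace Ω]

lemma MartArray.integral_sq_sum {P : Measure Ω} {𝓖 : ℕ → MeasurableSpace Ω}
    {c X : ℕ → Ω → ℝ} {v K : ℝ} {N : ℕ} (hA : MartArray P 𝓖 c X v K N) :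
    Integrable (fun ω => (∑ j ∈ Finset.range N, c j ω * X j ω) ^ 2) P ∧
      ∫ ω, (∑ j ∈ Finset.range N, c j ω * X j ω) ^ 2 ∂P =
        ∑ j ∈ Finset.range N, v * ∫ ω, c j ω ^ 2 ∂P := by
  have := hA.prob
  suffices ∀ m ≤ N, Integrable (fun ω => (∑ j ∈ Finset.range m, c j ω * X j ω) ^ 2) P ∧
      ∫ ω, (∑ j ∈ Finset.range m, c j ω * X j ω) ^ 2 ∂P =
        ∑ j ∈ Finset.range m, v * ∫ ω, c j ω ^ 2 ∂P from this N le_rfl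
  intro m
  induction m with
  | zero => simp
  | succ m ih =>
    intro hm
    obtain ⟨i1, e1⟩ := ih (by omega)
    have hm : m < N := hm
    set S : Ω → ℝ := fun ω => ∑ j ∈ Finset.range m, c j ω * X j ω with hS
    have hSg := hA.measurable_sum hm.le
    have hSm : Measurable S := hSg.mono (hA.le m) le_rfl
    have hcm : Measurable (c m) := (hA.meas_coef m hm).mono (hA.le m) le_rfl
    have hXm : Measurable (X m) := (hA.meas_shock m hm).mono (hA.le _) le_rfl
    have hXp : ∀ {p : ℕ}, p ≤ 4 → Integrable (fun ω => X m ω ^ p) P := fun hp =>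
      integrable_pow_of_fourth hXm (hA.integrable_fourth m hm) hp
    have hX1 : Integrable (X m) P := by simpa using hXp (p := 1) (by norm_num)
    have hc2 : Integrable (fun ω => c m ω ^ 2) P :=
      integrable_pow_of_fourth hcm (hA.coef_fourth m hm) (by norm_num)
    have hSc : Integrable (fun ω => S ω * c m ω) P :=
      ((memLp_two_iff_integrable_sq hSm.aestronglyMeasurable).2 i1).integrable_mul
        ((memLp_two_iff_integrable_sq hcm.aestronglyMeasurable).2 hc2)
    have I1 : IndepFun (fun ω => S ω * c m ω) (X m) P :=
      indep_of_indep_of_le_left (hA.indep m hm) (hSg.mul (hA.meas_coef m hm)).comap_le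
    have I2 : IndepFun (fun ω => c m ω ^ 2) (fun ω => X m ω ^ 2) P :=
      indep_of_indep_of_le_left (indep_of_indep_of_le_right (hA.indep m hm)
        ((measurable_id.pow_const 2).comp (comap_measurable (X m))).comap_le)
        ((hA.meas_coef m hm).pow_const 2).comap_le
    have j1 : Integrable (fun ω => S ω * c m ω * X m ω) P := I1.integrable_mul hSc hX1
    have j2 : Integrable (fun ω => c m ω ^ 2 * X m ω ^ 2) P :=
      I2.integrable_mul hc2 (hXp (by norm_num))
    have z1 : ∫ ω, S ω * c m ω * X m ω ∂P = 0 := by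
      rw [I1.integral_fun_mul_eq_mul_integral hSc.aestronglyMeasurable hXm.aestronglyMeasurable,
        hA.mean_zero m hm, mul_zero]
    have z2 : ∫ ω, c m ω ^ 2 * X m ω ^ 2 ∂P = v * ∫ ω, c m ω ^ 2 ∂P := by
      rw [I2.integral_fun_mul_eq_mul_integral hc2.aestronglyMeasurable
        (hXm.pow_const 2).aestronglyMeasurable, hA.second m hm, mul_comm]
    have e : (fun ω => (∑ j ∈ Finset.range (m + 1), c j ω * X j ω) ^ 2) =
        fun ω => S ω ^ 2 + 2 * (S ω * c m ω * X m ω) + c m ω ^ 2 * X m ω ^ 2 := by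
      ext ω; rw [Finset.sum_range_succ]; ring
    have j3 : Integrable (fun ω => S ω ^ 2 + 2 * (S ω * c m ω * X m ω)) P :=
      i1.add (j1.const_mul 2)
    rw [e]
    refine ⟨j3.add j2, ?_⟩
    rw [integral_add j3 j2, integral_add i1 (j1.const_mul 2), integral_const_mul, z1, z2,
      Finset.sum_range_succ, e1]
    ring

lemma prob_not_le_le {P : Measure Ω} [IsProbabilityMeasure P] {f : Ω → ℝ} (hf : ∀ ω, 0 ≤ f ω)
    (hi : Integrable f P) {c b a ε : ℝ} (hc : ∫ ω, f ω ∂P ≤ c * b) (hb : 0 < b) (ha : 0 < a)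
    (hca : c ≤ ε * a) : P.real {ω | ¬ f ω ≤ a * b} ≤ ε := by
  simp only [not_le]
  refine prob_lt_le hf hi (hc.trans ?_) (by positivity)
  rw [← mul_assoc]
  gcongr

lemma prob_not_mono (P : Measure Ω) [IsProbabilityMeasure P] {p q : Ω → Prop}
    (h : ∀ ω, p ω → q ω) : P.real {ω | ¬ q ω} ≤ P.real {ω | ¬ p ω} :=
  measureReal_mono (Set.ofPred_subset_ofPred.2 fun ω => mt (h ω))

lemma prob_not_and_le (P : Measure Ω) [IsProbabilityMeasure P] {p q : Ω → Prop} {a b : ℝ}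
    (hp : P.real {ω | ¬ p ω} ≤ a) (hq : P.real {ω | ¬ q ω} ≤ b) :
    P.real {ω | ¬ (p ω ∧ q ω)} ≤ a + b := by
  have : {ω | ¬ (p ω ∧ q ω)} ⊆ {ω | ¬ p ω} ∪ {ω | ¬ q ω} := fun ω hω => by
    simp only [Set.mem_ofPred_eq, Set.mem_union] at *
    tauto
  exact (measureReal_mono this).trans ((measureReal_union_le _ _).trans (add_le_add hp hq))

lemma prob_abs_sub_gt_le {P : Measure Ω} [IsProbabilityMeasure P] {f : Ω → ℝ} {m c a ε : ℝ}
    (hi : Integrable (fun ω => (f ω - m) ^ 2) P) (hc : ∫ ω, (f ω - m) ^ 2 ∂P ≤ c) (ha : 0 < a)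
    (hca : c ≤ ε * a ^ 2) : P.real {ω | ¬ |f ω - m| ≤ a} ≤ ε := by
  have : {ω | ¬ |f ω - m| ≤ a} = {ω | a ^ 2 < (f ω - m) ^ 2} := by
    ext ω
    simp only [Set.mem_ofPred_eq, not_le]
    rw [← sq_abs (f ω - m), sq_lt_sq₀ ha.le (abs_nonneg _)]
  rw [this]
  exact prob_lt_le (fun ω => sq_nonneg _) hi (hc.trans hca) (by positivity)

/-- The local-to-unity bound acts through this estimate: within n dates, even an explosive root
amplifies by at most e^M. -/
lemma sq_pow_le_exp {M ρ : ℝ} (hM : 0 < M) {n k : ℕ} (hk : k ≤ n) (hρ : |ρ| ≤ 1 + M / n) :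
    (ρ ^ k) ^ 2 ≤ Real.exp (2 * M) := by
  have h1 : |ρ| ≤ Real.exp (M / n) := hρ.trans (by linarith [Real.add_one_le_exp (M / n)])
  have h2 : |ρ| ^ k ≤ Real.exp M := by
    refine (pow_le_pow_left₀ (abs_nonneg _) h1 k).trans ?_
    rw [← Real.exp_nat_mul]
    refine Real.exp_le_exp.2 ?_
    rcases Nat.eq_zero_or_pos n with rfl | hn
    · simp; exact hM.le
    · have hn : (0 : ℝ) < n := by exact_mod_cast hn
      have hk : (k : ℝ) ≤ n := by exact_mod_cast hk
      rw [mul_div_assoc', div_le_iff₀ hn]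
      nlinarith
  calc (ρ ^ k) ^ 2 = (|ρ| ^ k) ^ 2 := by rw [← abs_pow, sq_abs]
    _ ≤ Real.exp M ^ 2 := pow_le_pow_left₀ (by positivity) h2 2
    _ = _ := by rw [← Real.exp_nat_mul]; norm_num

/-- The n dates are covered by at most n/k + 1 blocks of length k, each adding at most e^{2M} times
the gain of one block. -/
lemma gain_le_mul_gain {M ρ : ℝ} (hM : 0 < M) {n k : ℕ} (hk : 1 ≤ k) (hkn : k ≤ n)
    (hρ : |ρ| ≤ 1 + M / n) :
    gain ρ n ≤ 2 * (n / k) * Real.exp (2 * M) * gain ρ k := by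
  -- The last block may run past n, but the power multiplying its gain still has exponent at most n.
  have h1 : ∀ m, m * k ≤ n + k → gain ρ (m * k) ≤ m * Real.exp (2 * M) * gain ρ k := by
    intro m
    induction m with
    | zero => simp [gain]
    | succ m ih =>
      intro hm
      have h2 : m * k ≤ n := by rw [Nat.add_mul] at hm; omega
      have h3 := ih (by omega)
      rw [Nat.add_mul, one_mul, add_comm, gain_add]
      have := mul_le_mul_of_nonneg_right (sq_pow_le_exp hM h2 hρ) (gain_nonneg ρ k)
      push_cast
      linarith
  have hn : n ≤ (n / k + 1) * k := by
    have h2 := Nat.div_add_mod n k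
    have h3 := Nat.mod_lt n hk
    rw [Nat.add_mul, one_mul, mul_comm]; omega
  have h3 : (n / k + 1) * k ≤ n + k := by
    rw [Nat.add_mul, one_mul]; have := Nat.div_mul_le_self n k; omega
  refine (gain_mono ρ hn).trans ((h1 _ h3).trans ?_)
  have hk0 : (0 : ℝ) < k := by exact_mod_cast hk
  have h4 : ((n / k + 1 : ℕ) : ℝ) ≤ 2 * (n / k) := by
    have h5 : ((n / k : ℕ) : ℝ) ≤ n / k := Nat.cast_div_le
    have h6 : (1 : ℝ) ≤ n / k := by rw [le_div_iff₀ hk0, one_mul]; exact_mod_cast hkn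
    push_cast; linarith
  have := gain_nonneg ρ k
  gcongr

namespace Shocks

variable {P : Measure Ω} {u : ℕ → Ω → ℝ} {v K : ℝ} (hu : Shocks P u v K)
include hu

/-- Forward time works here: the level of date i uses only shocks of index below i, so it is known
before the shock of index i + s arrives, and the increments are orthogonal. -/
lemma integral_sq_sum_blk_mul_lead_le (ρ : ℝ) (s : ℕ) {n T : ℕ} (hT : T ≤ n) :
    Integrable (fun ω => (∑ i ∈ Finset.range T, blk ρ u i 0 ω * u (i + s) ω) ^ 2) P ∧
      ∫ ω, (∑ i ∈ Finset.range T, blk ρ u i 0 ω * u (i + s) ω) ^ 2 ∂P ≤ K * (T * gain ρ n) := by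
  have hA : MartArray P (fun m => sigmaOn u (Set.Iio (m + s))) (fun m => blk ρ u m 0)
      (fun m => u (m + s)) v K T :=
    { prob := hu.prob
      mono := fun m m' hm => sigmaOn_mono u (Set.Iio_subset_Iio (by omega))
      le := fun m => hu.sigmaOn_le _
      meas_coef := fun m _ => measurable_blk ρ u m 0 fun i hi => by
        have := hi.2; simp only [Set.mem_Iio]; omega
      meas_shock := fun m _ => measurable_sigmaOn u (by simp only [Set.mem_Iio]; omega)
      indep := fun m _ => by
        have h1 : Disjoint (Set.Iio (m + s)) {m + s} := by simp
        have h2 : MeasurableSpace.comap (u (m + s)) inferInstance ≤ sigmaOn u {m + s} :=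
          (measurable_sigmaOn u (Set.mem_singleton _)).comap_le
        exact indep_of_indep_of_le_right
          (indep_iSup_of_disjoint (fun i => (hu.meas i).comap_le) hu.indep h1) h2
      integrable_fourth := fun m _ => hu.integrable_fourth _
      mean_zero := fun m _ => hu.mean_zero _
      second := fun m _ => hu.second _
      fourth_le := fun m _ => hu.fourth_le _
      coef_fourth := fun m _ => (hu.blk_moments ρ m 0).1 }
  refine ⟨hA.integral_sq_sum.1, hA.integral_sq_sum.2.trans_le ?_⟩
  have : ∀ i ∈ Finset.range T, v * ∫ ω, blk ρ u i 0 ω ^ 2 ∂P ≤ K * gain ρ n := fun i hi => by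
    have hi := Finset.mem_range.1 hi
    rw [(hu.blk_moments ρ i 0).2.2.1, ← mul_assoc, ← sq]
    exact mul_le_mul hu.var_sq_le (gain_mono ρ (by omega)) (gain_nonneg ρ i)
      ((sq_nonneg v).trans hu.var_sq_le)
  refine (Finset.sum_le_sum this).trans (le_of_eq ?_)
  rw [Finset.sum_const, Finset.card_range, nsmul_eq_mul]; ring

lemma integral_sq_sum_blk_mul_shock_le (ρ : ℝ) (h T : ℕ) :
    Integrable (fun ω => (∑ i ∈ Finset.range T, blk ρ u h (i + 1) ω * u i ω) ^ 2) P ∧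
      ∫ ω, (∑ i ∈ Finset.range T, blk ρ u h (i + 1) ω * u i ω) ^ 2 ∂P ≤ K * (T * gain ρ h) := by
  have hA := hu.martArray ρ 1 h T
  have hS : ∀ ω, ∑ m ∈ Finset.range T, 1 * blk ρ u h (T - m) ω * u (T - 1 - m) ω =
      ∑ i ∈ Finset.range T, blk ρ u h (i + 1) ω * u i ω := fun ω => by
    rw [← Finset.sum_range_reflect (fun i => blk ρ u h (i + 1) ω * u i ω) T]
    exact Finset.sum_congr rfl fun m hm => by
      have := Finset.mem_range.1 hm
      rw [show T - 1 - m + 1 = T - m by omega, one_mul]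
  obtain ⟨h1, h2⟩ := hA.integral_sq_sum
  simp only [hS] at h1 h2
  refine ⟨h1, h2.trans_le ?_⟩
  simp only [one_mul, (hu.blk_moments ρ h _).2.2.1]
  rw [Finset.sum_const, Finset.card_range, nsmul_eq_mul]
  have := mul_le_mul_of_nonneg_right hu.var_sq_le (gain_nonneg ρ h)
  have h3 : (0 : ℝ) ≤ T := Nat.cast_nonneg T
  nlinarith

/-- The order hT, instead of the crude T², is what makes the correction from partialling out the lag
negligible: it is a fraction h/T of the trivial bound. -/
lemma integral_sq_sum_blk_mul_blk_le (ρ : ℝ) (h : ℕ) {n T : ℕ} (hT : T ≤ n) :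
    Integrable (fun ω => (∑ i ∈ Finset.range T, blk ρ u h (i + 1) ω * blk ρ u i 0 ω) ^ 2) P ∧
      ∫ ω, (∑ i ∈ Finset.range T, blk ρ u h (i + 1) ω * blk ρ u i 0 ω) ^ 2 ∂P ≤
        K * (h * T * gain ρ h * gain ρ n) := by
  have hint : Integrable (fun ω => gain ρ h * ∑ j ∈ Finset.range h,
      (∑ i ∈ Finset.range T, blk ρ u i 0 ω * u (i + (1 + j)) ω) ^ 2) P :=
    (integrable_finsetSum _ fun j _ =>
      (hu.integral_sq_sum_blk_mul_lead_le ρ (1 + j) hT).1).const_mul _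
  have hle : ∀ ω, (∑ i ∈ Finset.range T, blk ρ u h (i + 1) ω * blk ρ u i 0 ω) ^ 2 ≤ _ :=
    fun ω => sq_sum_blk_mul_le ρ u (fun i => blk ρ u i 0 ω) h T ω
  have hm : Measurable fun ω => ∑ i ∈ Finset.range T, blk ρ u h (i + 1) ω * blk ρ u i 0 ω :=
    Finset.measurable_fun_sum _ fun i _ =>
      (hu.measurable_blk' ρ h (i + 1)).mul (hu.measurable_blk' ρ i 0)
  have hi : Integrable (fun ω =>
      (∑ i ∈ Finset.range T, blk ρ u h (i + 1) ω * blk ρ u i 0 ω) ^ 2) P :=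
    hint.mono' (hm.pow_const 2).aestronglyMeasurable (ae_of_all _ fun ω => by
      rw [Real.norm_of_nonneg (sq_nonneg _)]; exact hle ω)
  refine ⟨hi, (integral_mono hi hint hle).trans ?_⟩
  rw [integral_const_mul, integral_finsetSum _ fun j _ =>
    (hu.integral_sq_sum_blk_mul_lead_le ρ (1 + j) hT).1]
  refine (mul_le_mul_of_nonneg_left (Finset.sum_le_sum fun j _ =>
    (hu.integral_sq_sum_blk_mul_lead_le ρ (1 + j) hT).2) (gain_nonneg ρ h)).trans (le_of_eq ?_)
  rw [Finset.sum_const, Finset.card_range, nsmul_eq_mul]; ring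

lemma integral_sum_le {Z : ℕ → Ω → ℝ} {T : ℕ} {c : ℝ} (hZ : ∀ i < T, Integrable (Z i) P)
    (hc : ∀ i < T, ∫ ω, Z i ω ∂P ≤ c) :
    Integrable (fun ω => ∑ i ∈ Finset.range T, Z i ω) P ∧
      ∫ ω, ∑ i ∈ Finset.range T, Z i ω ∂P ≤ T * c := by
  have := hu.prob
  refine ⟨integrable_finsetSum _ fun i hi => hZ i (Finset.mem_range.1 hi), ?_⟩
  rw [integral_finsetSum _ fun i hi => hZ i (Finset.mem_range.1 hi)]
  refine (Finset.sum_le_sum fun i hi => hc i (Finset.mem_range.1 hi)).trans (le_of_eq ?_)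
  rw [Finset.sum_const, Finset.card_range, nsmul_eq_mul]

lemma integral_mul_sq_le {S S' : Set ℕ} (hd : Disjoint S S') {X Y : Ω → ℝ}
    (hX : Measurable[sigmaOn u S] X) (hY : Measurable[sigmaOn u S'] Y) {p : ℕ}
    (hXi : Integrable (fun ω => X ω ^ p) P) (hYi : Integrable (fun ω => Y ω ^ p) P) :
    Integrable (fun ω => X ω ^ p * Y ω ^ p) P ∧
      ∫ ω, X ω ^ p * Y ω ^ p ∂P = (∫ ω, X ω ^ p ∂P) * ∫ ω, Y ω ^ p ∂P :=
  ⟨hu.integrable_mul_of_disjoint hd (hX.pow_const p) (hY.pow_const p) hXi hYi,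
    hu.integral_mul_of_disjoint hd (hX.pow_const p) (hY.pow_const p)⟩

lemma blk_shock_moments (ρ : ℝ) (h i p : ℕ) (hp : p ≤ 4) :
    Integrable (fun ω => blk ρ u h (i + 1) ω ^ p * u i ω ^ p) P ∧
      ∫ ω, blk ρ u h (i + 1) ω ^ p * u i ω ^ p ∂P =
        (∫ ω, blk ρ u h (i + 1) ω ^ p ∂P) * ∫ ω, u i ω ^ p ∂P :=
  hu.integral_mul_sq_le (S := Set.Ico (i + 1) (i + 1 + h)) (S' := {i}) (by simp)
    (measurable_blk ρ u h (i + 1) subset_rfl) (measurable_sigmaOn u rfl)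
    (hu.integrable_blk_pow ρ h (i + 1) hp) (hu.integrable_pow i hp)

/-- Law of large numbers behind the standard error: the squared score terms depend on one another
over only h dates. -/
lemma sum_blk_mul_shock_sq (ρ : ℝ) (h T : ℕ) :
    Integrable (fun ω => (∑ i ∈ Finset.range T, (blk ρ u h (i + 1) ω * u i ω) ^ 2 -
        T * (v ^ 2 * gain ρ h)) ^ 2) P ∧
      ∫ ω, (∑ i ∈ Finset.range T, (blk ρ u h (i + 1) ω * u i ω) ^ 2 -
        T * (v ^ 2 * gain ρ h)) ^ 2 ∂P ≤ T * (2 * h + 1) * (3 * K ^ 2 * gain ρ h ^ 2) := by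
  have e : ∀ i, (fun ω => ((blk ρ u h (i + 1) ω * u i ω) ^ 2) ^ 2) =
      fun ω => blk ρ u h (i + 1) ω ^ 4 * u i ω ^ 4 := fun i => by ext ω; ring
  have hK : 0 ≤ K := (sq_nonneg v).trans hu.var_sq_le
  refine hu.integral_sq_sum_sub_le (Z := fun i ω => (blk ρ u h (i + 1) ω * u i ω) ^ 2)
    (fun i => ?_) (fun i => ?_) (fun i => ?_) (fun i => ?_) T
  · have h1 : Measurable[sigmaOn u (Set.Ico i (i + h + 1))] (blk ρ u h (i + 1)) :=
      measurable_blk ρ u h (i + 1) (Set.Ico_subset_Ico (by omega) (by omega))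
    have h2 : Measurable[sigmaOn u (Set.Ico i (i + h + 1))] (u i) :=
      measurable_sigmaOn u ⟨le_rfl, by omega⟩
    exact (h1.mul h2).pow_const 2
  · rw [e]; exact (hu.blk_shock_moments ρ h i 4 le_rfl).1
  · simp only [mul_pow]
    rw [(hu.blk_shock_moments ρ h i 2 (by norm_num)).2, (hu.blk_moments ρ h (i + 1)).2.2.1,
      hu.second]
    ring
  · rw [e, (hu.blk_shock_moments ρ h i 4 le_rfl).2]
    have := mul_le_mul (hu.blk_moments ρ h (i + 1)).2.2.2 (hu.fourth_le i)
      (integral_nonneg fun ω => by positivity) (by positivity)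
    linarith

end Shocks

end LocalProjection

/-! ### Good samples have high probability -/

namespace LocalProjection

namespace Shocks

variable {Ω : Type*} [mΩ : MeasurableSpace Ω] {P : Measure Ω} {u : ℕ → Ω → ℝ} {v K : ℝ}
  (hu : Shocks P u v K)
include hu

/-- The sum of squares of the levels is of the order of `T * gain ρ n` with high probability. -/
lemma prob_not_sum_blk_sq_ge_le {M ρ κ A ε : ℝ} {n T : ℕ} (hv : 0 < v) (hM : 0 < M)
    (hρ : |ρ| ≤ 1 + M / n) (hTn : T ≤ n) (hnT : n ≤ 2 * T) (hκ : 0 < κ) (hκ4 : κ ≤ 1 / 4)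
    (hκT : 1 ≤ κ * T) (hκε : 144 * K * κ ≤ ε * v ^ 2)
    (hA : 64 * Real.exp (2 * M) ^ 2 ≤ A * (κ * v)) :
    P.real {ω | ¬ T * gain ρ n ≤ A * ∑ i ∈ Finset.range T, blk ρ u i 0 ω ^ 2} ≤ ε := by
  have := hu.prob
  have hK : 0 ≤ K := (sq_nonneg v).trans hu.var_sq_le
  have hT0 : (0 : ℝ) < T := by
    by_contra hcon
    nlinarith
  have hε : 0 ≤ ε := by
    have h1 : 0 ≤ ε * v ^ 2 := le_trans (by positivity) hκε
    exact nonneg_of_mul_nonneg_left h1 (by positivity)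
  set c := Real.exp (2 * M) with hc
  have hc1 : 1 ≤ c := Real.one_le_exp (by positivity)
  -- The block length is a small fraction of T: short enough for k-dependent averages to
  -- concentrate, long enough for `gain ρ n` to be at most a constant multiple of `gain ρ k`.
  set k := ⌈κ * T⌉₊ with hk
  have hk1 : κ * T ≤ k := Nat.le_ceil _
  have hk2 : (k : ℝ) ≤ 2 * (κ * T) := by
    have := Nat.ceil_lt_add_one (a := κ * T) (by positivity)
    linarith
  have hk0 : (1 : ℝ) ≤ k := hκT.trans hk1
  have hk1' : 1 ≤ k := by exact_mod_cast hk0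
  have hkT2 : 2 * (k : ℝ) ≤ T := by nlinarith
  have hkT : k ≤ T := by
    have : (k : ℝ) ≤ T := by linarith
    exact_mod_cast this
  have hT' : (T : ℝ) / 2 ≤ (T - k : ℕ) := by
    rw [Nat.cast_sub hkT]; linarith
  set T' : ℝ := ((T - k : ℕ) : ℝ) with hT'def
  have hT'0 : 0 < T' := by linarith
  set g := gain ρ k with hg
  have hg0 : 0 < g := lt_of_lt_of_le one_pos (one_le_gain ρ hk1')
  obtain ⟨h1, h2⟩ := hu.integral_sq_sum_blk_sq_sub_le ρ k 0 (T - k)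
  have hcheb : P.real {ω | ¬ |∑ i ∈ Finset.range (T - k), blk ρ u k (i + 0) ω ^ 2 - T' * (v * g)| ≤
      T' * (v * g) / 2} ≤ ε := by
    refine prob_abs_sub_gt_le h1 h2 (by positivity) ?_
    have h3 : 2 * ((k + 0 : ℕ) : ℝ) + 1 ≤ 6 * (κ * T) := by
      push_cast; linarith
    have h4 : 12 * K * (6 * (κ * T)) ≤ ε * v ^ 2 * T' := by
      have h5 : 144 * K * κ * (T / 2) ≤ ε * v ^ 2 * T' := mul_le_mul hκε hT' (by positivity) (by positivity)
      linarith
    have h6 : 12 * K * (2 * ((k + 0 : ℕ) : ℝ) + 1) ≤ ε * v ^ 2 * T' :=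
      (mul_le_mul_of_nonneg_left h3 (by positivity)).trans h4
    have h7 := mul_le_mul_of_nonneg_right h6 (by positivity : 0 ≤ T' * g ^ 2 / 4)
    calc _ = 12 * K * (2 * ((k + 0 : ℕ) : ℝ) + 1) * (T' * g ^ 2 / 4) := by ring
      _ ≤ _ := h7
      _ = _ := by ring
  refine (prob_not_mono P fun ω hcon => ?_).trans hcheb
  set D := ∑ i ∈ Finset.range T, blk ρ u i 0 ω ^ 2 with hD
  have hD0 : 0 ≤ D := Finset.sum_nonneg fun _ _ => sq_nonneg _
  have e1 : ∑ i ∈ Finset.range (T - k), blk ρ u (i + k) 0 ω ^ 2 ≤ D := by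
    have := Finset.sum_Ico_eq_sum_range (fun i => blk ρ u i 0 ω ^ 2) k T
    simp only [add_comm k] at this
    rw [← this, hD, Finset.range_eq_Ico]
    exact Finset.sum_le_sum_of_subset_of_nonneg (Finset.Ico_subset_Ico_left (Nat.zero_le k))
      fun _ _ _ => sq_nonneg _
  have e2 : ∑ i ∈ Finset.range (T - k), blk ρ u i 0 ω ^ 2 ≤ D :=
    Finset.sum_le_sum_of_subset_of_nonneg (Finset.range_mono (Nat.sub_le T k))
      fun _ _ _ => sq_nonneg _
  have hck : (ρ ^ k) ^ 2 ≤ c := sq_pow_le_exp hM (hkT.trans hTn) hρ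
  -- A block of length k is the quasi-difference y_{i+k} - ρ^k y_i, so a large sum of squared blocks
  -- forces a large sum of squared levels.
  have e3 : ∑ i ∈ Finset.range (T - k), blk ρ u k (i + 0) ω ^ 2 ≤ 2 * D + 2 * c * D := by
    have : ∑ i ∈ Finset.range (T - k), blk ρ u k (i + 0) ω ^ 2 ≤
        2 * ∑ i ∈ Finset.range (T - k), blk ρ u (i + k) 0 ω ^ 2 +
        2 * c * ∑ i ∈ Finset.range (T - k), blk ρ u i 0 ω ^ 2 := by
      rw [Finset.mul_sum, Finset.mul_sum, ← Finset.sum_add_distrib]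
      refine Finset.sum_le_sum fun i _ => ?_
      have h3 := blk_add ρ u i k 0 ω
      rw [zero_add] at h3
      rw [add_zero, h3]
      have h4 := mul_le_mul_of_nonneg_right hck (sq_nonneg (blk ρ u i 0 ω))
      nlinarith [sq_nonneg (2 * ρ ^ k * blk ρ u i 0 ω + blk ρ u k i ω)]
    have h3 : 2 * c * ∑ i ∈ Finset.range (T - k), blk ρ u i 0 ω ^ 2 ≤ 2 * c * D := by gcongr
    linarith
  have e4 : T / 2 * (v * g) ≤ T' * (v * g) := by gcongr
  have e5 : T * (v * g) ≤ 16 * c * D := by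
    have := (abs_le.1 hcon).1
    nlinarith
  have e6 : (n : ℝ) / k ≤ 2 / κ := by
    rw [div_le_div_iff₀ (by linarith) hκ]
    have : (n : ℝ) ≤ 2 * T := by exact_mod_cast hnT
    nlinarith
  have e7 : gain ρ n ≤ 2 * (2 / κ) * c * g :=
    (gain_le_mul_gain hM hk1' (hkT.trans hTn) hρ).trans (by gcongr)
  have e8 : T * gain ρ n ≤ T * (2 * (2 / κ) * c * g) := by gcongr
  have hκv : 0 < κ * v := by positivity
  refine e8.trans (le_of_mul_le_mul_right ?_ hκv)
  calc T * (2 * (2 / κ) * c * g) * (κ * v) = 4 * c * (T * (v * g)) := by field_simp; ring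
    _ ≤ 4 * c * (16 * c * D) := by gcongr
    _ = 64 * c ^ 2 * D := by ring
    _ ≤ A * (κ * v) * D := by gcongr
    _ = _ := by ring

lemma prob_not_sum_shock_sq_ge_le {A ε : ℝ} {T : ℕ} (hv : 0 < v) (hT : 1 ≤ T)
    (hTε : 36 * K ≤ ε * v ^ 2 * T) (hA : 2 ≤ A * v) :
    P.real {ω | ¬ T ≤ A * ∑ i ∈ Finset.range T, u i ω ^ 2} ≤ ε := by
  have := hu.prob
  have hT0 : (0 : ℝ) < T := by exact_mod_cast hT
  -- With ρ = 0 a block of length 1 is a single shock with gain 1.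
  obtain ⟨h1, h2⟩ := hu.integral_sq_sum_blk_sq_sub_le 0 1 0 T
  simp only [blk, gain, add_zero, mul_zero, zero_add, mul_one, one_pow] at h1 h2
  have hcheb : P.real {ω | ¬ |∑ i ∈ Finset.range T, u i ω ^ 2 - T * v| ≤ T * v / 2} ≤ ε := by
    refine prob_abs_sub_gt_le h1 h2 (by positivity) ?_
    have := mul_le_mul_of_nonneg_right hTε (by positivity : 0 ≤ (T : ℝ) / 4)
    push_cast
    nlinarith
  refine (prob_not_mono P fun ω hcon => ?_).trans hcheb
  have h3 := (abs_le.1 hcon).1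
  have h4 : T * v / 2 ≤ ∑ i ∈ Finset.range T, u i ω ^ 2 := by linarith
  have hA0 : 0 ≤ A := by
    by_contra hcon
    nlinarith
  calc (T : ℝ) = 2 * (T / 2) := by ring
    _ ≤ A * v * (T / 2) := by gcongr
    _ = A * (T * v / 2) := by ring
    _ ≤ _ := by gcongr

lemma prob_not_abs_sum_blk_mul_shock_sq_sub_le {ρ ε δ r : ℝ} {h T : ℕ} (hv : 0 < v) (hδ : 0 < δ)
    (hh : 1 ≤ h) (hT : 1 ≤ T) (hhT : (h : ℝ) ≤ r * T)
    (hr : 144 * K ^ 2 * r ≤ ε * δ ^ 2 * v ^ 4) :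
    P.real {ω | ¬ |∑ i ∈ Finset.range T, (blk ρ u h (i + 1) ω * u i ω) ^ 2 -
      T * (v ^ 2 * gain ρ h)| ≤ δ / 4 * (T * (v ^ 2 * gain ρ h))} ≤ ε := by
  have := hu.prob
  have hT0 : (0 : ℝ) < T := by exact_mod_cast hT
  have hh0 : (1 : ℝ) ≤ h := by exact_mod_cast hh
  have hg0 : 0 < gain ρ h := lt_of_lt_of_le one_pos (one_le_gain ρ hh)
  obtain ⟨h1, h2⟩ := hu.sum_blk_mul_shock_sq ρ h T
  refine prob_abs_sub_gt_le h1 h2 (by positivity) ?_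
  have h3 : 2 * (h : ℝ) + 1 ≤ 3 * (r * T) := by linarith
  calc T * (2 * (h : ℝ) + 1) * (3 * K ^ 2 * gain ρ h ^ 2)
      ≤ T * (3 * (r * T)) * (3 * K ^ 2 * gain ρ h ^ 2) := by gcongr
    _ = 144 * K ^ 2 * r * (T ^ 2 * gain ρ h ^ 2 / 16) := by ring
    _ ≤ ε * δ ^ 2 * v ^ 4 * (T ^ 2 * gain ρ h ^ 2 / 16) := by gcongr
    _ = _ := by ring

/-- Each of the nine conditions fails with probability at most ε. The seven upper bounds follow from
Markov's inequality, the two lower bounds from the law of large numbers for blocks. -/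
lemma prob_not_goodSample_le {M ρ κ A ε r : ℝ} {n h T : ℕ} (hv : 0 < v) (hM : 0 < M)
    (hρ : |ρ| ≤ 1 + M / n) (hT : 1 ≤ T) (hTn : T ≤ n) (hnT : n ≤ 2 * T) (hh : 1 ≤ h)
    (hr : r * T = h) (hκ : 0 < κ) (hκ4 : κ ≤ 1 / 4)
    (hκT : 1 ≤ κ * T) (hκε : 144 * K * κ ≤ ε * v ^ 2) (hA0 : 0 < A)
    (hA : 64 * Real.exp (2 * M) ^ 2 ≤ A * (κ * v)) (hAK : 3 * K ≤ ε * A) :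
    P.real {ω | ¬ GoodSample T (fun i => blk ρ u h (i + 1) ω) (fun i => u i ω)
      (fun i => blk ρ u i 0 ω) A (gain ρ n) (gain ρ h) r} ≤ 9 * ε := by
  have := hu.prob
  have hK : 0 ≤ K := (sq_nonneg v).trans hu.var_sq_le
  have hT0 : (0 : ℝ) < T := by exact_mod_cast hT
  have hh0 : (0 : ℝ) < h := by exact_mod_cast hh
  have hg0 : 0 < gain ρ h := lt_of_lt_of_le one_pos (one_le_gain ρ hh)
  have hG0 : 0 < gain ρ n := lt_of_lt_of_le one_pos (one_le_gain ρ (hT.trans hTn))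
  have hKA : K ≤ ε * A := by linarith
  have hvG : ∀ i < T, v * gain ρ i ≤ v * gain ρ n := fun i hi =>
    mul_le_mul_of_nonneg_left (gain_mono ρ (by omega)) hv.le
  obtain ⟨i1, b1⟩ := hu.integral_sq_sum_blk_mul_lead_le ρ 0 hTn
  have p1 := prob_not_le_le (fun ω => sq_nonneg _) i1 b1 (by positivity) hA0 hKA
  obtain ⟨i2, b2⟩ := hu.integral_sq_sum_blk_mul_blk_le ρ h hTn
  have p2 := prob_not_le_le (fun ω => sq_nonneg _) i2 b2 (by positivity) hA0 hKA
  have p3 := hu.prob_not_sum_blk_sq_ge_le hv hM hρ hTn hnT hκ hκ4 hκT hκε hA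
  have p4 : P.real {ω | ¬ T ≤ A * ∑ i ∈ Finset.range T, u i ω ^ 2} ≤ ε := by
    refine hu.prob_not_sum_shock_sq_ge_le hv hT ?_ ?_
    · have h1 := mul_le_mul_of_nonneg_right hκε hT0.le
      have h2 := mul_le_mul_of_nonneg_left hκT hK
      nlinarith
    · have h1 : (1 : ℝ) ≤ Real.exp (2 * M) ^ 2 := one_le_pow₀ (Real.one_le_exp (by positivity))
      have h2 : A * v * κ ≤ A * v * (1 / 4) := by gcongr
      linarith
  have z5 : ∀ i, Integrable (fun ω => blk ρ u h (i + 1) ω ^ 2 * blk ρ u i 0 ω ^ 2) P ∧ _ := fun i =>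
    hu.integral_mul_sq_le (S := Set.Ico (i + 1) (i + 1 + h)) (S' := Set.Ico 0 (0 + i))
      (by rw [Set.disjoint_left]; rintro x ⟨hx, _⟩ ⟨_, hx'⟩; omega)
      (measurable_blk ρ u h (i + 1) subset_rfl) (measurable_blk ρ u i 0 subset_rfl)
      (hu.integrable_blk_pow ρ h (i + 1) (p := 2) (by norm_num))
      (hu.integrable_blk_pow ρ i 0 (p := 2) (by norm_num))
  obtain ⟨i5, b5⟩ := hu.integral_sum_le (T := T) (c := K * (gain ρ h * gain ρ n))
    (fun i _ => (z5 i).1) (fun i hi => by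
      rw [(z5 i).2, (hu.blk_moments ρ h (i + 1)).2.2.1, (hu.blk_moments ρ i 0).2.2.1]
      have h1 := mul_le_mul_of_nonneg_left (hvG i hi) (by positivity : 0 ≤ v * gain ρ h)
      have h2 := mul_le_mul_of_nonneg_right hu.var_sq_le (mul_nonneg hg0.le hG0.le)
      nlinarith)
  have p5 := prob_not_le_le (fun ω => Finset.sum_nonneg fun _ _ => by positivity) i5
    (b5.trans_eq (show _ = K * (T * gain ρ h * gain ρ n) by ring)) (by positivity) hA0 hKA
  have z6 : ∀ i, Integrable (fun ω => u i ω ^ 2 * blk ρ u i 0 ω ^ 2) P ∧ _ := fun i =>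
    hu.integral_mul_sq_le (S := {i}) (S' := Set.Ico 0 (0 + i)) (by simp)
      (measurable_sigmaOn u rfl) (measurable_blk ρ u i 0 subset_rfl)
      (hu.integrable_pow i (p := 2) (by norm_num))
      (hu.integrable_blk_pow ρ i 0 (p := 2) (by norm_num))
  obtain ⟨i6, b6⟩ := hu.integral_sum_le (T := T) (c := K * gain ρ n)
    (fun i _ => (z6 i).1) (fun i hi => by
      rw [(z6 i).2, hu.second, (hu.blk_moments ρ i 0).2.2.1]
      have h1 := mul_le_mul_of_nonneg_left (hvG i hi) hv.le
      have h2 := mul_le_mul_of_nonneg_right hu.var_sq_le hG0.le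
      nlinarith)
  have p6 := prob_not_le_le (fun ω => Finset.sum_nonneg fun _ _ => by positivity) i6
    (b6.trans_eq (show _ = K * (T * gain ρ n) by ring)) (by positivity) hA0 hKA
  obtain ⟨i7, b7⟩ := hu.integral_sum_le (T := T) (fun i _ => hu.integrable_fourth i)
    (fun i _ => hu.fourth_le i)
  have p7 := prob_not_le_le (fun ω => Finset.sum_nonneg fun _ _ => by positivity) i7
    (b7.trans_eq (mul_comm _ _)) hT0 hA0 hKA
  obtain ⟨i8, b8⟩ := hu.integral_sum_le (T := T) (c := 3 * K * gain ρ n ^ 2)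
    (fun i _ => (hu.blk_moments ρ i 0).1) (fun i hi => (hu.blk_moments ρ i 0).2.2.2.trans (by
      have := gain_mono ρ (show i ≤ n by omega)
      have := gain_nonneg ρ i
      gcongr))
  have p8 := prob_not_le_le (fun ω => Finset.sum_nonneg fun _ _ => by positivity) i8
    (b8.trans_eq (show _ = 3 * K * (T * gain ρ n ^ 2) by ring)) (by positivity) hA0 hAK
  obtain ⟨i9, b9⟩ := hu.integral_sq_sum_blk_mul_shock_le ρ h T
  have p9 := prob_not_le_le (fun ω => sq_nonneg _) i9 b9 (by positivity) hA0 hKA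
  have hall := prob_not_and_le P p1 (prob_not_and_le P p2 (prob_not_and_le P p3 (prob_not_and_le P p4
    (prob_not_and_le P p5 (prob_not_and_le P p6 (prob_not_and_le P p7 (prob_not_and_le P p8 p9)))))))
  refine (prob_not_mono P fun ω hcon => ?_).trans (hall.trans (le_of_eq (by ring)))
  obtain ⟨c1, c2, c3, c4, c5, c6, c7, c8, c9⟩ := hcon
  refine ⟨?_, ?_, c3, c4, ?_, ?_, c7, ?_, ?_⟩
  · simp only [mul_comm (u _ ω)]; rw [mul_assoc]; exact c1
  · refine c2.trans (le_of_eq ?_); rw [← hr]; ring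
  · refine c5.trans (le_of_eq (by ring))
  · rw [mul_assoc]; exact c6
  · rw [mul_assoc]; exact c8
  · rw [mul_assoc]; exact c9

end Shocks

end LocalProjection

/-! ### Normal approximation of the root -/

namespace LocalProjection

lemma path_eq_blk {Ω : Type*} (ρ : ℝ) (u : ℕ → Ω → ℝ) (ω : Ω) {n t : ℕ} (ht : t ≤ n) :
    path ρ (fun i : Fin n => u i ω) t = blk ρ u t 0 ω := by
  induction t with
  | zero => rfl
  | succ t ih =>
    rw [path, ih (by omega), dif_pos (show t < n by omega)]
    simp [blk]

variable {Ω : Type*} [mΩ : MeasurableSpace Ω]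

/-- Perturbation bound for distribution functions close to `Phi`. -/
lemma abs_prob_le_sub_Phi_le {P : Measure Ω} [IsProbabilityMeasure P] {R S : Ω → ℝ}
    (hS : Measurable S) {δ ε₁ ε₂ ε₃ : ℝ} (hδ0 : 0 ≤ δ) (hδ : δ < 1)
    (h1 : ∀ x, Phi (x + δ * (|x| + 1)) - Phi (x - δ * (|x| + 1)) ≤ ε₁)
    (h2 : ∀ x, |cdf (P.map S) x - Phi x| ≤ ε₂)
    (h3 : P.real {ω | ¬ ∃ a B : ℝ, |a| ≤ δ ∧ |B - 1| ≤ δ ∧ R ω = (S ω - a) / B} ≤ ε₃) (x : ℝ) :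
    |P.real {ω | R ω ≤ x} - Phi x| ≤ ε₁ + ε₂ + ε₃ := by
  set bad : Set Ω := {ω | ¬ ∃ a B : ℝ, |a| ≤ δ ∧ |B - 1| ≤ δ ∧ R ω = (S ω - a) / B} with hbad
  have hF : ∀ y, cdf (P.map S) y = P.real {ω | S ω ≤ y} := fun y => by
    have := Measure.isProbabilityMeasure_map (μ := P) hS.aemeasurable
    rw [cdf_eq_real, measureReal_def, Measure.map_apply hS measurableSet_Iic]
    rfl
  set t := δ * (|x| + 1) with ht
  -- For B > 0, (S - a)/B ≤ x means S ≤ x + (a + x(B - 1)), which explains the window δ(|x| + 1).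
  have key : ∀ a B : ℝ, |a| ≤ δ → |B - 1| ≤ δ → 0 < B ∧ |a + x * (B - 1)| ≤ t := fun a B ha hB => by
    refine ⟨by linarith [(abs_le.1 hB).1], (abs_add_le _ _).trans ?_⟩
    rw [abs_mul, ht]
    have := mul_le_mul_of_nonneg_left hB (abs_nonneg x)
    linarith
  have up : {ω | R ω ≤ x} ⊆ {ω | S ω ≤ x + t} ∪ bad := fun ω hω => by
    by_cases hb : ω ∈ bad
    · exact Or.inr hb
    · obtain ⟨a, B, ha, hB, hR⟩ := not_not.1 hb
      obtain ⟨hB0, hk⟩ := key a B ha hB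
      have hω : R ω ≤ x := hω
      rw [hR, div_le_iff₀ hB0] at hω
      exact Or.inl (show S ω ≤ x + t by linarith [(abs_le.1 hk).2])
  have lo : {ω | S ω ≤ x - t} ⊆ {ω | R ω ≤ x} ∪ bad := fun ω hω => by
    by_cases hb : ω ∈ bad
    · exact Or.inr hb
    · obtain ⟨a, B, ha, hB, hR⟩ := not_not.1 hb
      obtain ⟨hB0, hk⟩ := key a B ha hB
      have hω : S ω ≤ x - t := hω
      refine Or.inl (show R ω ≤ x from ?_)
      rw [hR, div_le_iff₀ hB0]
      linarith [(abs_le.1 hk).1]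
  have u1 := (measureReal_mono (μ := P) up).trans (measureReal_union_le _ _)
  have l1 := (measureReal_mono (μ := P) lo).trans (measureReal_union_le _ _)
  rw [← hF] at u1 l1
  have ht0 : 0 ≤ t := by positivity
  have a1 := abs_le.1 (h2 (x + t))
  have a2 := abs_le.1 (h2 (x - t))
  have a3 := Phi_mono (show x ≤ x + t by linarith)
  have a4 := Phi_mono (show x - t ≤ x by linarith)
  have a5 := h1 x
  rw [abs_le]; constructor <;> linarith

/-- The score `∑ ξ_t u_t`, normalised by its standard deviation. -/
noncomputable def score (ρ v : ℝ) (u : ℕ → Ω → ℝ) (h T : ℕ) (ω : Ω) : ℝ :=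
  (∑ i ∈ Finset.range T, blk ρ u h (i + 1) ω * u i ω) / (v * √(T * gain ρ h))

lemma Shocks.charFun_map_score_sub_le {P : Measure Ω} {u : ℕ → Ω → ℝ} {v K σ : ℝ}
    (hu : Shocks P u v K) (hσ : 0 < σ) (hv : σ ≤ v) (ρ : ℝ) {h T : ℕ} (hh : 1 ≤ h) (hT : 1 ≤ T)
    {r : ℝ} (hr : 0 < r) (hr2 : (2 * h + 3 : ℝ) ≤ r ^ 2 * T) {l L : ℝ} (hl : |l| ≤ L) :
    ‖charFun (P.map (score ρ v u h T)) l - Real.exp (-l ^ 2 / 2)‖ ≤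
      r * (Real.exp (L ^ 2) * (4 * L ^ 2 + 9 * K ^ 2 * L ^ 4 / σ ^ 4) +
        (Real.exp (L ^ 2 / 2) * L ^ 2 + 2) * (√(3 * K) / σ)) := by
  have hv0 : 0 < v := hσ.trans_le hv
  have hm : Measurable (score ρ v u h T) := (hu.measurable_sum_blk_mul ρ h T).div_const _
  have key := hu.norm_integral_exp_score_le hv0 ρ hh hT hr hr2 l
  have e : charFun (P.map (score ρ v u h T)) l = ∫ ω, Complex.exp ((l *
      ((∑ i ∈ Finset.range T, blk ρ u h (i + 1) ω * u i ω) / (v * √(T * gain ρ h))) : ℝ) *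
        Complex.I) ∂P := by
    rw [charFun_apply_real, integral_map hm.aemeasurable
      (Measurable.aestronglyMeasurable (by fun_prop))]
    simp only [score]
    push_cast
    rfl
  rw [e]
  refine key.trans ?_
  have hL : 0 ≤ L := (abs_nonneg l).trans hl
  have h2 : l ^ 2 ≤ L ^ 2 := sq_le_sq' (by linarith [(abs_le.1 hl).1]) (abs_le.1 hl).2
  have h4 : l ^ 4 ≤ L ^ 4 := by
    have := pow_le_pow_left₀ (sq_nonneg l) h2 2
    nlinarith
  gcongr

/-- Uniform normal approximation of the root for independent shocks indexed by `ℕ`. -/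
theorem exists_abs_prob_root_le_sub_Phi_le {K σ M ε : ℝ} (hK : 0 < K) (hσ : 0 < σ) (hM : 0 < M)
    (hε : 0 < ε) : ∃ r₀ : ℝ, 0 < r₀ ∧ ∀ (P : Measure Ω) (u : ℕ → Ω → ℝ) (v : ℝ), Shocks P u v K →
      σ ≤ v → ∀ (n h : ℕ) (ρ x : ℝ), 1 ≤ h → h < n → |ρ| ≤ 1 + M / n →
        (h : ℝ) ≤ r₀ * (n - h : ℕ) →
          |P.real {ω | root n h ρ (fun i : Fin n => u i ω) ≤ x} - Phi x| ≤ ε := by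
  obtain ⟨δ, hδ, hδ2, hmod⟩ := Phi_modulus (show 0 < ε / 3 by positivity)
  obtain ⟨δc, hδc, L, hL, hcdf⟩ := exists_abs_cdf_sub_Phi_le (show 0 < ε / 3 by positivity)
  -- Ten bad events, nine from the good sample and one from the law of large numbers, have total
  -- probability at most 10e = ε/3.
  set e := ε / 30 with he
  have he0 : 0 < e := by positivity
  set κ := min (1 / 4) (e * σ ^ 2 / (144 * K)) with hκ
  have hκ0 : 0 < κ := by positivity
  have hκε : 144 * K * κ ≤ e * σ ^ 2 := by
    have := min_le_right (1 / 4) (e * σ ^ 2 / (144 * K))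
    rw [← hκ, le_div_iff₀ (by positivity)] at this
    linarith
  set c := Real.exp (2 * M) with hc
  set A := 1 + 3 * K / e + 64 * c ^ 2 / (κ * σ) with hA
  have hA1 : 1 ≤ A := by
    have : 0 ≤ 3 * K / e + 64 * c ^ 2 / (κ * σ) := by positivity
    linarith
  have hA0 : 0 < A := by linarith
  have hAK : 3 * K ≤ e * A := by
    have h1 : 3 * K / e ≤ A := by
      have : 0 ≤ 64 * c ^ 2 / (κ * σ) := by positivity
      linarith
    rw [div_le_iff₀ he0] at h1; linarith
  have hAc : 64 * c ^ 2 ≤ A * (κ * σ) := by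
    have h1 : 64 * c ^ 2 / (κ * σ) ≤ A := by
      have : 0 ≤ 3 * K / e := by positivity
      linarith
    rwa [div_le_iff₀ (by positivity)] at h1
  set C := Real.exp (L ^ 2) * (4 * L ^ 2 + 9 * K ^ 2 * L ^ 4 / σ ^ 4) +
        (Real.exp (L ^ 2 / 2) * L ^ 2 + 2) * (√(3 * K) / σ) with hC
  have hC0 : 0 < C := by positivity
  -- The characteristic function error is `rc * C`, which is then exactly the tolerance `δc`.
  set rc := δc / C with hrc
  have hrc0 : 0 < rc := by positivity
  set d1 := 2 * A ^ 3 with hd1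
  set d2 := 3200 * A ^ 13 * (1 + 4 / δ) with hd2
  have hd10 : 0 < d1 := by positivity
  have hd20 : 0 < d2 := by positivity
  -- The entries serve, in order: κT ≥ 1 and n ≤ 2T; `GoodSample.bounds`; `GoodSample.ratio`; the
  -- law of large numbers; and 2h + 3 ≤ 5h ≤ rc²T for the score. Lower bounds on T come from rT = h
  -- ≥ 1.
  refine ⟨min (min (min κ (1 / d1)) (min (δ * σ ^ 2 / d2) (e * δ ^ 2 * σ ^ 4 / (144 * K ^ 2))))
    (rc ^ 2 / 5), by positivity, ?_⟩
  intro P u v hu hv n h ρ x hh hhn hρ hr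
  have := hu.prob
  have hv0 : 0 < v := hσ.trans_le hv
  set T := n - h with hT
  have hT1 : 1 ≤ T := by omega
  have hT0 : (0 : ℝ) < T := by exact_mod_cast hT1
  have hh1 : (1 : ℝ) ≤ h := by exact_mod_cast hh
  set r := (h : ℝ) / T with hrdef
  have hrT : r * T = h := div_mul_cancel₀ _ hT0.ne'
  have hr0 : 0 < r := by positivity
  have hrle := (div_le_iff₀ hT0).2 hr
  rw [← hrdef] at hrle
  simp only [le_min_iff] at hrle
  obtain ⟨⟨⟨q1, q2⟩, q3, q4⟩, q5⟩ := hrle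
  rw [le_div_iff₀ (by positivity)] at q2 q3 q4 q5
  have hκT : 1 ≤ κ * T := by
    have : r * T ≤ κ * T := by gcongr
    linarith
  have hnT : n ≤ 2 * T := by
    have h1 : (h : ℝ) ≤ T := by
      have h2 : κ ≤ 1 / 4 := min_le_left _ _
      have h3 : r * T ≤ 1 * T := by gcongr; linarith
      linarith
    have : h ≤ T := by exact_mod_cast h1
    omega
  have hσv2 : σ ^ 2 ≤ v ^ 2 := by gcongr
  have hσv4 : σ ^ 4 ≤ v ^ 4 := by gcongr
  have g1 := hu.prob_not_goodSample_le (T := T) (A := A) (ε := e) (r := r) (κ := κ) hv0 hM hρ hT1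
    (Nat.sub_le n h) hnT hh hrT hκ0 (min_le_left _ _) hκT (hκε.trans (by gcongr)) hA0
    (hAc.trans (by gcongr)) hAK
  have g2 := hu.prob_not_abs_sum_blk_mul_shock_sq_sub_le (ρ := ρ) (T := T) (ε := e) (r := r) hv0 hδ
    hh hT1 hrT.ge (by
      have : e * δ ^ 2 * σ ^ 4 ≤ e * δ ^ 2 * v ^ 4 := by gcongr
      linarith)
  have g := prob_not_and_le P g1 g2
  have hm : Measurable (score ρ v u h T) := (hu.measurable_sum_blk_mul ρ h T).div_const _
  have hcd := hcdf (P.map (score ρ v u h T)) (Measure.isProbabilityMeasure_map hm.aemeasurable)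
    (fun l hl => (hu.charFun_map_score_sub_le hσ hv ρ hh hT1 hrc0 (by
      have h1 : r * 5 * T ≤ rc ^ 2 * T := by gcongr
      linarith) hl).trans (le_of_eq (div_mul_cancel₀ _ hC0.ne')))
  have hg0 : 0 < gain ρ h := lt_of_lt_of_le one_pos (one_le_gain ρ hh)
  have hG0 : 0 < gain ρ n := lt_of_lt_of_le one_pos (one_le_gain ρ (by omega))
  have hfin := abs_prob_le_sub_Phi_le (P := P) (R := fun ω => root n h ρ (fun i : Fin n => u i ω))
    hm (δ := δ) (ε₃ := 9 * e + e) hδ.le (by linarith) hmod hcd (by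
      refine (prob_not_mono P fun ω hω => ?_).trans g
      obtain ⟨H, hlln⟩ := hω
      have hr1 : 1 ≤ r * T := by linarith
      have hb := H.bounds hT1 hA1 hG0 hg0 hr1 q2
      obtain ⟨a, B, ha, hB, hR⟩ := H.ratio hT1 hA1 hG0 hg0 hr1 q2 hv0 hδ hδ2
        (q3.trans (by gcongr)) hlln
      refine ⟨a, B, ha, hB, ?_⟩
      rw [score, ← hR]
      -- The path and the blocks are identified only up to date n, so the replacement is made inside
      -- the finite sums.
      have hpath : ∀ t ≤ n, path ρ (fun i : Fin n => u i ω) t = blk ρ u t 0 ω := fun t ht =>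
        path_eq_blk ρ u ω ht
      have hq : ∀ i < T, path ρ (fun i : Fin n => u i ω) i = blk ρ u i 0 ω := fun i hi =>
        hpath i (by omega)
      have s1 : ∀ f : ℕ → ℝ → ℝ, ∑ i ∈ Finset.range T, f i (path ρ (fun i : Fin n => u i ω) i) =
          ∑ i ∈ Finset.range T, f i (blk ρ u i 0 ω) := fun f =>
        Finset.sum_congr rfl fun i hi => by rw [hq i (Finset.mem_range.1 hi)]
      have s2 : ∀ i < T, partialOut T (fun i => u i ω) (path ρ (fun i : Fin n => u i ω)) i =
          partialOut T (fun i => u i ω) (fun i => blk ρ u i 0 ω) i := fun i hi => by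
        rw [partialOut, partialOut, s1 (fun _ y => y ^ 2), s1 (fun i y => u i ω * y), hq i hi]
      have s3 : ∀ f : ℕ → ℝ → ℝ, ∑ i ∈ Finset.range T,
          f i (partialOut T (fun i => u i ω) (path ρ (fun i : Fin n => u i ω)) i) =
          ∑ i ∈ Finset.range T,
            f i (partialOut T (fun i => u i ω) (fun i => blk ρ u i 0 ω) i) := fun f =>
        Finset.sum_congr rfl fun i hi => by rw [s2 i (Finset.mem_range.1 hi)]
      have s4 : ∀ i < T, regResidual T (fun i => blk ρ u h (i + 1) ω) (fun i => u i ω)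
          (path ρ (fun i : Fin n => u i ω)) i =
          regResidual T (fun i => blk ρ u h (i + 1) ω) (fun i => u i ω)
            (fun i => blk ρ u i 0 ω) i := fun i hi => by
        rw [regResidual, regResidual, s1 (fun _ y => y ^ 2),
          s1 (fun i y => blk ρ u h (i + 1) ω * y), hq i hi, s2 i hi, s3 (fun _ y => y ^ 2),
          s3 (fun i y => blk ρ u h (i + 1) ω * y)]
      rw [root_eq_of_pos (ξ := fun i => blk ρ u h (i + 1) ω) (u := fun i => u i ω)]
      · rw [← hT, s3 (fun i y => blk ρ u h (i + 1) ω * y)]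
        congr 2
        refine Finset.sum_congr rfl fun i hi => ?_
        rw [s4 i (Finset.mem_range.1 hi), s2 i (Finset.mem_range.1 hi)]
      · intro i hi
        rw [hpath _ (by omega), hpath _ (by omega)]
        simp [blk]
      · intro i hi
        rw [hpath _ (by omega), hpath _ (by omega), blk_add, zero_add]
      · rw [← hT, s1 (fun _ y => y ^ 2)]; exact hb.1
      · rw [← hT, s3 (fun _ y => y ^ 2)]; exact hb.2.1) x
  refine hfin.trans (le_of_eq ?_)
  rw [he]; ring

end LocalProjection

/-! ### Measurability, extension to infinite sequences, and the theorem -/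

namespace LocalProjection

lemma measurable_path {n : ℕ} (ρ : ℝ) (t : ℕ) : Measurable fun w : Fin n → ℝ => path ρ w t := by
  induction t with
  | zero => exact measurable_const
  | succ t ih =>
    simp only [path]
    refine (ih.const_mul ρ).add ?_
    split_ifs with ht
    · exact measurable_pi_apply _
    · exact measurable_const

lemma measurable_lpCoef {α : Type*} [MeasurableSpace α] (n h : ℕ) {y : α → ℕ → ℝ}
    (hy : ∀ t, Measurable fun a => y a t) (i : Fin 2) : Measurable fun a => lpCoef n h (y a) i := by
  have hreg : ∀ t i, Measurable fun a => regressor (y a) t i := fun t i => by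
    fin_cases i
    · exact hy t
    · exact hy (t - 1)
  have hA : ∀ i j, Measurable fun a => (∑ t ∈ Finset.Icc 1 (n - h),
      Matrix.vecMulVec (regressor (y a) t) (regressor (y a) t)) i j := fun i j => by
    simp only [Matrix.sum_apply, Matrix.vecMulVec_apply]
    exact Finset.measurable_fun_sum _ fun t _ => (hreg t i).mul (hreg t j)
  have hb : ∀ i, Measurable fun a => (∑ t ∈ Finset.Icc 1 (n - h),
      y a (t + h) • regressor (y a) t) i := fun i => by
    simp only [Finset.sum_apply, Pi.smul_apply, smul_eq_mul]
    exact Finset.measurable_fun_sum _ fun t _ => (hy (t + h)).mul (hreg t i)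
  -- The explicit 2×2 inverse, with zero as the inverse of a zero determinant, is measurable in the
  -- entries, singular case included.
  have hinv : ∀ i j, Measurable fun a => ((∑ t ∈ Finset.Icc 1 (n - h),
      Matrix.vecMulVec (regressor (y a) t) (regressor (y a) t))⁻¹) i j := fun i j => by
    simp only [Matrix.inv_def, Matrix.adjugate_fin_two, Matrix.det_fin_two, Ring.inverse_eq_inv',
      Matrix.smul_apply, smul_eq_mul]
    refine Measurable.mul ?_ ?_
    · exact (((hA 0 0).mul (hA 1 1)).sub ((hA 0 1).mul (hA 1 0))).inv
    · fin_cases i <;> fin_cases j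
      · exact hA 1 1
      · exact (hA 0 1).neg
      · exact (hA 1 0).neg
      · exact hA 0 0
  simp only [lpCoef, Matrix.mulVec, dotProduct]
  exact Finset.measurable_fun_sum _ fun j _ => (hinv i j).mul (hb j)

/-- Needed to pull the event about the root back along the projection from infinite shock sequences.
-/
lemma measurable_root (n h : ℕ) (ρ : ℝ) : Measurable (root n h ρ) := by
  have hy : ∀ t, Measurable fun w : Fin n → ℝ => path ρ w t := measurable_path ρ
  have hβ : Measurable fun w : Fin n → ℝ => betaHat n h (path ρ w) := measurable_lpCoef n h hy 0
  have hγ : Measurable fun w : Fin n → ℝ => gammaHat n h (path ρ w) := measurable_lpCoef n h hy 1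
  have hρ : Measurable fun w : Fin n → ℝ => rhoHat n h (path ρ w) :=
    (Finset.measurable_fun_sum _ fun t _ => (hy (t - 1)).pow_const 2).inv.mul
      (Finset.measurable_fun_sum _ fun t _ => (hy t).mul (hy (t - 1)))
  have hu : ∀ t, Measurable fun w : Fin n → ℝ => uHat n h (path ρ w) t := fun t =>
    (hy t).sub (hρ.mul (hy (t - 1)))
  have hξ : ∀ t, Measurable fun w : Fin n → ℝ => xiHat n h (path ρ w) t := fun t =>
    ((hy (t + h)).sub (hβ.mul (hy t))).sub (hγ.mul (hy (t - 1)))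
  have hE : Measurable fun w : Fin n → ℝ =>
      (√(∑ t ∈ Finset.Icc 1 (n - h), uHat n h (path ρ w) t ^ 2))⁻¹ :=
    (Finset.measurable_fun_sum _ fun t _ => (hu t).pow_const 2).sqrt.inv
  have hs : Measurable fun w : Fin n → ℝ => sHat n h (path ρ w) :=
    (hE.mul (Finset.measurable_fun_sum _ fun t _ =>
      ((hξ t).pow_const 2).mul ((hu t).pow_const 2)).sqrt).mul hE
  exact (hβ.sub_const _).div hs

/-- An admissible law is the law of the first `n` coordinates of an infinite sequence of shocks. -/
lemma IsShockLaw.exists_shocks {K₄ σlo σhi : ℝ} {n : ℕ} {P : Measure (Fin n → ℝ)}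
    (hP : IsShockLaw K₄ σlo σhi n P) (hn : 0 < n) :
    ∃ (Q : Measure (ℕ → ℝ)) (v : ℝ), Shocks Q (fun t ω => ω t) v K₄ ∧ σlo ≤ v ∧
      P = Q.map fun ω (i : Fin n) => ω i := by
  have := hP.isProbabilityMeasure
  set X : (Fin n → ℝ) → ℝ := fun w => w ⟨0, hn⟩ with hX
  have hXm : Measurable X := measurable_pi_apply _
  set μ := P.map X with hμ
  have hμp : IsProbabilityMeasure μ := Measure.isProbabilityMeasure_map hXm.aemeasurable
  have hmarg : ∀ i : Fin n, P.map (fun w => w i) = μ := fun i => (hP.identDistrib i ⟨0, hn⟩).map_eq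
  -- An i.i.d. law is the power of its marginal, hence a projection of the infinite product of that
  -- marginal.
  have hPpi : P = Measure.pi fun _ : Fin n => μ := by
    have := (iIndepFun_iff_map_fun_eq_pi_map (fun i => (measurable_pi_apply i).aemeasurable)).1 hP.indep
    simp only [hmarg] at this
    rw [← this]
    exact Measure.map_id.symm
  have hmap : ∀ t, (Measure.infinitePi fun _ : ℕ => μ).map (fun ω => ω t) = μ := fun t =>
    Measure.infinitePi_map_eval _ t
  have hint : ∀ {f : ℝ → ℝ}, Measurable f → ∀ t,
      ∫ ω, f (ω t) ∂(Measure.infinitePi fun _ : ℕ => μ) = ∫ w, f (X w) ∂P := fun {f} hf t => by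
    have h1 := integral_map (μ := Measure.infinitePi fun _ : ℕ => μ) (f := f)
      (measurable_pi_apply t).aemeasurable hf.aestronglyMeasurable
    rw [hmap t] at h1
    rw [← integral_map hXm.aemeasurable hf.aestronglyMeasurable, ← hμ, h1]
  refine ⟨Measure.infinitePi fun _ : ℕ => μ, variance X P, ?_, (hP.variance_mem _).1, ?_⟩
  · refine ⟨inferInstance, fun t => measurable_pi_apply t, ?_, fun t => ?_, fun t => ?_, fun t => ?_,
      fun t => ?_⟩
    · exact iIndepFun_infinitePi (X := fun _ x => x) fun _ => measurable_id
    · have h4 : Integrable (fun x : ℝ => x ^ 4) μ :=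
        (integrable_map_measure (by fun_prop) hXm.aemeasurable).2 (hP.integrable_fourth _)
      rw [← hmap t] at h4
      exact (integrable_map_measure (continuous_pow 4).aestronglyMeasurable
        (measurable_pi_apply t).aemeasurable).1 h4
    · rw [hint (f := fun x => x) measurable_id t]; exact hP.mean_zero _
    · rw [hint (f := fun x => x ^ 2) (measurable_id.pow_const 2) t, variance_eq_integral hXm.aemeasurable,
        hP.mean_zero ⟨0, hn⟩]
      simp
    · rw [hint (f := fun x => x ^ 4) (measurable_id.pow_const 4) t]; exact (hP.fourth_lt _).le
  · rw [hPpi, Measure.map_infinitePi_infinitePi_of_inj (P := fun _ : ℕ => μ)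
      (f := fun i : Fin n => (i : ℕ)) Fin.val_injective, Measure.infinitePi_eq_pi]

end LocalProjection

theorem theoremB1 (K₄ σlo σhi M : ℝ) (hK₄ : 0 < K₄) (hσlo : 0 < σlo) (hσ : σlo ≤ σhi) (hM : 0 < M)
    (H : ℕ → ℕ) (hHn : ∀ n, H n ≤ n)
    (hHo : (fun n => (H n : ℝ)) =o[atTop] (fun n => (n : ℝ))) :
    Tendsto
      (fun n : ℕ =>
        ⨆ h ∈ Set.Icc 1 (H n),
          ⨆ P ∈ LocalProjection.shockLaws K₄ σlo σhi n,
            ⨆ ρ ∈ {ρ : ℝ | |ρ| ≤ 1 + M / n},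
              ⨆ x : ℝ, ENNReal.ofReal |LocalProjection.rootCDF n h P ρ x - LocalProjection.Phi x|)
      atTop (𝓝 0) := by
  rw [ENNReal.tendsto_nhds_zero]
  intro ε hε
  rcases eq_or_ne ε ⊤ with rfl | hεt
  · exact Eventually.of_forall fun _ => le_top
  have hε0 : 0 < ε.toReal := ENNReal.toReal_pos hε.ne' hεt
  obtain ⟨r₀, hr₀, hmain⟩ := LocalProjection.exists_abs_prob_root_le_sub_Phi_le (Ω := ℕ → ℝ)
    hK₄ hσlo hM hε0
  -- The entry 1/2 gives n - h ≥ n/2, and then h ≤ (r₀/2)n yields h ≤ r₀(n - h).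
  have hη : 0 < min (1 / 2) (r₀ / 2) := by positivity
  filter_upwards [hHo.bound hη, eventually_gt_atTop 0] with n hn hn0
  refine iSup₂_le fun h hh => iSup₂_le fun P hP => iSup₂_le fun ρ hρ => iSup_le fun x => ?_
  refine ENNReal.ofReal_le_of_le_toReal ?_
  obtain ⟨hh1, hhH⟩ := hh
  have hn0' : (0 : ℝ) < n := by exact_mod_cast hn0
  have hhn : (h : ℝ) ≤ min (1 / 2) (r₀ / 2) * n := by
    have h1 : (h : ℝ) ≤ H n := by exact_mod_cast hhH
    simp only [Real.norm_natCast] at hn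
    exact h1.trans hn
  have h2 : (h : ℝ) ≤ 1 / 2 * n := hhn.trans (by gcongr; exact min_le_left _ _)
  have h3 : (h : ℝ) ≤ r₀ / 2 * n := hhn.trans (by gcongr; exact min_le_right _ _)
  have hlt : h < n := by
    have : (h : ℝ) < n := by linarith
    exact_mod_cast this
  obtain ⟨Q, v, hQ, hv, rfl⟩ := LocalProjection.IsShockLaw.exists_shocks hP hn0
  have key := hmain Q (fun t ω => ω t) v hQ hv n h ρ x hh1 hlt hρ (by
    rw [Nat.cast_sub hlt.le]; nlinarith)
  have hmeas : Measurable fun (ω : ℕ → ℝ) (i : Fin n) => ω i :=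
    measurable_pi_lambda _ fun i => measurable_pi_apply _
  rw [LocalProjection.rootCDF, map_measureReal_apply hmeas
    (measurableSet_le (LocalProjection.measurable_root n h ρ) measurable_const)]
  exact key
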